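/- **Conventions.** Let $S_n$ be the symmetric group and $B_n$ the group of signed permutations $w=w_1\cdots w_n$ (symbols $1,\dots,n$ in some order, some of them barred; $\bar j=-j$, products are compositions, $u(-j)=-u(j)$), with the order $\cdots<\bar2<\bar1<1<2<\cdots$. Let $\mathbb{Q}S=\bigoplus_{n\ge0}\mathbb{Q}S_n$ and $\mathbb{Q}B=\bigoplus_{n\ge0}\mathbb{Q}B_n$. Let $\mathrm{Sh}(p,q)$ be the set of $\xi\in S_{p+q}$ with $\xi_1<\cdots<\xi_p$ and $\xi_{p+1}<\cdots<\xi_{p+q}$, and let $(u,v)\mapsto u\times v$ be the standard embeddings $S_p\times S_q\to S_{p+q}$ and $B_p\times B_q\to B_{p+q}$. The *external* (Malvenuto–Reutenauer) structure on $\mathbb{Q}S$ and on $\mathbb{Q}B$ has the product $u*v=\sum_{\xi\in\mathrm{Sh}(p,q)}\xi\cdot(u\times v)$ for $u,v$ of degrees $p,q$, and the coproduct $\Delta(w)=\sum_{p=0}^n w_{(p)}\otimes w'_{(p)}$ for $w$ of degree $n$, where $w=(w_{(p)}\times w'_{(p)})\cdot\xi^{-1}$ with $w_{(p)}$ of degree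 $p$, $w'_{(p)}$ of degree $n-p$ and $\xi\in\mathrm{Sh}(p,n-p)$. The unit is the identity of degree $0$, and the counit is the projection on degree $0$. Consider the following graded subspaces, each of which is $\mathbb{Q}$ in degree $0$. * $\mathrm{Sol}(A)\subseteq\mathbb{Q}S$ is spanned in degree $n$ by the sums $Y_J$ of all $w\in S_n$ with descent set $\{i\in[n-1] : w_i>w_{i+1}\}=J$, for $J\subseteq[n-1]$. * $P^\circ\subseteq\mathbb{Q}S$ is spanned in degree $n$ by the sums $P^\circ_F$ of all $w\in S_n$ with set of interior peaks $\{i\in\{2,\dots,n-1\}: w_{i-1}<w_i>w_{i+1}\}=F$, for $F\subseteq\{2,\dots,n-1\}$ without two consecutive elements. * $\Omega(B)\subseteq\mathbb{Q}B$ (the Mantaci–Reutenauer algebra) is spanned in degree $n$ by the elements $T_\alpha$, for $\alpha=(a_1,\dots,a_k)$ a signed composition of $n$ (nonzero integers with $\sum|a_i|=n$). Here $T_\alpha$ is the sum of all $w\in B_n$ such that, on each of the successive subintervals of $[n]$ of lengths $|a_1|,\dots,|a_k|$, the $|w_j|$ increase and the $w_j$ have the sign of the corresponding part $a_i$, and such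 that these intervals are maximal among the intervals on which the $|w_j|$ increase and the sign is constant. * $I^0\subseteq\mathbb{Q}B$ is spanned in degree $n$ by the sums $X^0_J$ of all $w\in B_n$ with $\{i\in\{0,\dots,n-1\}:w_i>w_{i+1}\}\subseteq\{0\}\cup J$ (where $w_0=0$), for $J\subseteq[n-1]$. In degree $n$, let $\Theta^{\pm}$ be the morphism of right modules over $\Omega(B)_n$ (with the product of the group algebra $\mathbb{Q}B_n$) such that $\Theta^{\pm}(1)=X^0_\emptyset$. In degree $n\ge1$, let $\Theta$ be the morphism of right modules over $\mathrm{Sol}(A)_n$ (with the product of $\mathbb{Q}S_n$) such that $\Theta(1)=2P^\circ_\emptyset$; in degree $0$, let $\Theta$ be the identity. **Proposition.** With the external structure, $\Omega(B)$, $I^0$, $\mathrm{Sol}(A)$ and $P^\circ$ are graded Hopf algebras, and the maps $$\Theta^{\pm}:\Omega(B)\to I^0\qquad\text{and}\qquad\Theta:\mathrm{Sol}(A)\to P^\circ$$ are morphisms of graded Hopf algebras. -/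

import Mathlib

open scoped DirectSum TensorProduct

noncomputable section

/-! ## Ordinary and signed permutations -/

/-- The symmetric group `S_n`, whose product is composition of permutations. -/
abbrev SymPerm (n : ℕ) : Type := Equiv.Perm (Fin n)

/-- A signed permutation `w = w_1 ... w_n`: the symbol `w_i` has absolute value `perm i` and sign
`sign i` (it is barred when the sign is `-1`). -/
@[ext]
structure SignedPerm (n : ℕ) where
  perm : Equiv.Perm (Fin n)
  sign : Fin n → ℤˣ

namespace SignedPerm

variable {n : ℕ}

/-- Composition of signed permutations, each extended to barred symbols by `u(-j) = -u(j)`. -/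
instance : Mul (SignedPerm n) where
  mul u v := ⟨u.perm * v.perm, fun i => u.sign (v.perm i) * v.sign i⟩

instance : One (SignedPerm n) where
  one := ⟨1, fun _ => 1⟩

instance : Inv (SignedPerm n) where
  inv u := ⟨u.perm⁻¹, fun i => (u.sign (u.perm⁻¹ i))⁻¹⟩

@[simp] theorem mul_perm (u v : SignedPerm n) : (u * v).perm = u.perm * v.perm := rfl
@[simp] theorem mul_sign (u v : SignedPerm n) (i : Fin n) :
    (u * v).sign i = u.sign (v.perm i) * v.sign i := rfl
@[simp] theorem one_perm : (1 : SignedPerm n).perm = 1 := rfl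
@[simp] theorem one_sign (i : Fin n) : (1 : SignedPerm n).sign i = 1 := rfl
@[simp] theorem inv_perm (u : SignedPerm n) : (u⁻¹).perm = u.perm⁻¹ := rfl
@[simp] theorem inv_sign (u : SignedPerm n) (i : Fin n) :
    (u⁻¹).sign i = (u.sign (u.perm⁻¹ i))⁻¹ := rfl

/-- The hyperoctahedral group `B_n`. -/
instance : Group (SignedPerm n) :=
  Group.ofLeftAxioms
    (fun a b c => by ext i <;> simp [mul_assoc])
    (fun a => by ext i <;> simp)
    (fun a => by ext i <;> simp)

/-- A signed permutation is a pair (permutation, vector of signs). -/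
def equivProd : SignedPerm n ≃ Equiv.Perm (Fin n) × (Fin n → ℤˣ) where
  toFun w := (w.perm, w.sign)
  invFun p := ⟨p.1, p.2⟩
  left_inv _ := rfl
  right_inv _ := rfl

instance : Fintype (SignedPerm n) := Fintype.ofEquiv _ equivProd.symm

/-- The embedding of `S_n` in `B_n` as the signed permutations without bars. -/
def ofPerm (u : SymPerm n) : SignedPerm n := ⟨u, fun _ => 1⟩

/-- The entry `w_i` of a signed permutation, for `1 ≤ i ≤ n`; in particular `w_0 = 0`. -/
def entry (w : SignedPerm n) (i : ℕ) : ℤ :=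
  if h : 1 ≤ i ∧ i ≤ n then
    (w.sign ⟨i - 1, by omega⟩ : ℤ) * ((w.perm ⟨i - 1, by omega⟩ : ℕ) + 1)
  else 0

/-- The descents of type B: the `i ∈ {0, ..., n-1}` with `w_i > w_{i+1}`, where `w_0 = 0`. -/
def des (w : SignedPerm n) : Finset ℕ :=
  (Finset.range n).filter fun i => w.entry (i + 1) < w.entry i

/-- The embedding `B_p × B_q → B_{p+q}`. -/
def prod {p q : ℕ} (u : SignedPerm p) (v : SignedPerm q) : SignedPerm (p + q) :=
  ⟨finSumFinEquiv.permCongr (Equiv.sumCongr u.perm v.perm), Fin.append u.sign v.sign⟩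

end SignedPerm

namespace SymPerm

variable {n : ℕ}

/-- The entry `w_i` of a permutation, for `1 ≤ i ≤ n` (and `0` for other `i`). -/
def entry (w : SymPerm n) (i : ℕ) : ℕ :=
  if h : 1 ≤ i ∧ i ≤ n then (w ⟨i - 1, by omega⟩ : ℕ) + 1 else 0

/-- The descents of `w`: the `i ∈ {1, ..., n-1}` with `w_i > w_{i+1}`. -/
def des (w : SymPerm n) : Finset ℕ :=
  (Finset.Ico 1 n).filter fun i => entry w (i + 1) < entry w i

/-- The interior peaks of `w`: the `i ∈ {2, ..., n-1}` with `w_{i-1} < w_i > w_{i+1}`. -/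
def intPeak (w : SymPerm n) : Finset ℕ :=
  (Finset.Ico 2 n).filter fun i => entry w (i - 1) < entry w i ∧ entry w (i + 1) < entry w i

/-- The embedding `S_p × S_q → S_{p+q}`. -/
def prod {p q : ℕ} (u : SymPerm p) (v : SymPerm q) : SymPerm (p + q) :=
  finSumFinEquiv.permCongr (Equiv.sumCongr u v)

end SymPerm

/-- The sum, in the group algebra of `G`, of the elements of `G` with property `P`. -/
def classSum {G : Type} [Group G] [Fintype G] (P : G → Prop) : MonoidAlgebra ℚ G :=
  open scoped Classical in ∑ w ∈ Finset.univ.filter P, MonoidAlgebra.single w 1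

/-! ## The external structure -/

/-- The `(p,q)`-shuffles. -/
def shuffles (p q : ℕ) : Finset (SymPerm (p + q)) :=
  open scoped Classical in Finset.univ.filter fun ξ =>
    StrictMono (fun i : Fin p => ξ (Fin.castAdd q i)) ∧
    StrictMono (fun j : Fin q => ξ (Fin.natAdd p j))

/-- The direct sum over `n ≥ 0` of the group algebras of the groups `G n`. -/
abbrev TotalAlg (G : ℕ → Type) [∀ n, Group (G n)] : Type :=
  ⨁ n, MonoidAlgebra ℚ (G n)

/-- A linear map on the direct sum of the group algebras from its values on the group elements. -/
def TotalAlg.lift {G : ℕ → Type} [∀ n, Group (G n)] {M : Type} [AddCommGroup M] [Module ℚ M]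
    (f : ∀ n, G n → M) : TotalAlg G →ₗ[ℚ] M :=
  DirectSum.toModule ℚ ℕ M fun n =>
    (Finsupp.linearCombination ℚ (f n)).comp (MonoidAlgebra.coeffLinearEquiv ℚ).toLinearMap

/-- A group element as an element of the direct sum of the group algebras. -/
def TotalAlg.elt {G : ℕ → Type} [∀ n, Group (G n)] {n : ℕ} (w : G n) : TotalAlg G :=
  DirectSum.lof ℚ ℕ (fun n => MonoidAlgebra ℚ (G n)) n (MonoidAlgebra.single w 1)

/-- Structure maps of a would-be graded Hopf algebra, to be compared with those of actual ones. -/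
structure HopfOps (V : Type) [AddCommGroup V] [Module ℚ V] where
  one : V
  mul : V →ₗ[ℚ] V →ₗ[ℚ] V
  counit : V →ₗ[ℚ] ℚ
  comul : V →ₗ[ℚ] V ⊗[ℚ] V
  deg : ℕ → Submodule ℚ V

/-- The external structure on the direct sum of the group algebras of the `G n`, where `emb` embeds
the symmetric groups and `prod` is the product `(u, v) ↦ u × v`. The sum defining `Δ(w)` is over
the `p + q = n`, `u ∈ G p`, `v ∈ G q` and `(p,q)`-shuffles `ξ` with `w = (u × v) · ξ⁻¹`. -/
def externalOps (G : ℕ → Type) [∀ n, Group (G n)] [∀ n, Fintype (G n)]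
    (emb : ∀ n, SymPerm n → G n) (prod : ∀ p q, G p → G q → G (p + q)) : HopfOps (TotalAlg G) where
  one := TotalAlg.elt (1 : G 0)
  mul := TotalAlg.lift fun p u => TotalAlg.lift fun q v =>
    ∑ ξ ∈ shuffles p q, TotalAlg.elt (emb (p + q) ξ * prod p q u v)
  counit := TotalAlg.lift fun n _ => if n = 0 then 1 else 0
  comul := TotalAlg.lift fun n w =>
    open scoped Classical in
    ∑ pq ∈ Finset.HasAntidiagonal.antidiagonal n,
      ∑ t ∈ (Finset.univ ×ˢ (Finset.univ ×ˢ shuffles pq.1 pq.2) :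
          Finset (G pq.1 × G pq.2 × SymPerm (pq.1 + pq.2))).filter
        (fun t => (⟨n, w⟩ : Σ m, G m) =
          ⟨pq.1 + pq.2, prod pq.1 pq.2 t.1 t.2.1 * (emb (pq.1 + pq.2) t.2.2)⁻¹⟩),
        TotalAlg.elt t.1 ⊗ₜ[ℚ] TotalAlg.elt t.2.1
  deg n := LinearMap.range (DirectSum.lof ℚ ℕ (fun n => MonoidAlgebra ℚ (G n)) n)

/-- The external structure on `ℚS`, the sum of the group algebras of the symmetric groups. -/
def opsA : HopfOps (TotalAlg SymPerm) :=
  externalOps SymPerm (fun _ ξ => ξ) (fun _ _ => SymPerm.prod)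

/-- The external structure on `ℚB`, the sum of the group algebras of the hyperoctahedral groups. -/
def opsB : HopfOps (TotalAlg SignedPerm) :=
  externalOps SignedPerm (fun _ => SignedPerm.ofPerm) (fun _ _ => SignedPerm.prod)

/-- The subspace of the direct sum whose component of degree `n` is `S n`. -/
def totalSubspace {G : ℕ → Type} [∀ n, Group (G n)]
    (S : ∀ n, Submodule ℚ (MonoidAlgebra ℚ (G n))) : Submodule ℚ (TotalAlg G) :=
  ⨆ n, (S n).map (DirectSum.lof ℚ ℕ (fun n => MonoidAlgebra ℚ (G n)) n)

/-! ## Graded Hopf algebras inside a space with structure maps -/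

/-- A graded Hopf algebra structure on the subspace `S` of `V` given by the structure maps `O`
of `V`: a Hopf algebra with an injective linear map into `V`, with image `S`, that respects unit,
product, counit and coproduct, and that is graded by the degree of `V`. -/
structure GradedHopfOn {V : Type} [AddCommGroup V] [Module ℚ V] (O : HopfOps V)
    (S : Submodule ℚ V) where
  carrier : Type
  [ring : Ring carrier]
  [hopf : HopfAlgebra ℚ carrier]
  incl : carrier →ₗ[ℚ] V
  incl_injective : Function.Injective incl
  range_incl : LinearMap.range incl = S
  incl_one : incl 1 = O.one
  incl_mul : ∀ x y, incl (x * y) = O.mul (incl x) (incl y)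
  counit_incl : ∀ x, O.counit (incl x) = Coalgebra.counit (R := ℚ) x
  comul_incl : ∀ x, O.comul (incl x) = TensorProduct.map incl incl (Coalgebra.comul (R := ℚ) x)
  graded_internal : DirectSum.IsInternal fun n => (O.deg n).comap incl
  graded_mul : SetLike.GradedMonoid fun n => (O.deg n).comap incl
  graded_counit : ∀ n, n ≠ 0 → ∀ x, incl x ∈ O.deg n → Coalgebra.counit (R := ℚ) x = 0
  graded_comul : ∀ n x, incl x ∈ O.deg n → Coalgebra.comul (R := ℚ) x ∈
    ⨆ pq ∈ Finset.HasAntidiagonal.antidiagonal n, LinearMap.range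
      (TensorProduct.map ((O.deg pq.1).comap incl).subtype ((O.deg pq.2).comap incl).subtype)
  graded_antipode : ∀ n x, incl x ∈ O.deg n → incl (HopfAlgebra.antipode ℚ x) ∈ O.deg n

attribute [instance] GradedHopfOn.ring GradedHopfOn.hopf

/-- The structure maps `O` of `V` make the subspaces `S` and `T` graded Hopf algebras, and `θ`
restricts to a morphism of graded Hopf algebras `S → T`. -/
def IsGradedHopfMorphism {V : Type} [AddCommGroup V] [Module ℚ V] (O : HopfOps V)
    (S T : Submodule ℚ V) (θ : V →ₗ[ℚ] V) : Prop :=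
  ∃ (H : GradedHopfOn O S) (K : GradedHopfOn O T) (f : H.carrier →ₐc[ℚ] K.carrier),
    (∀ x, K.incl (f x) = θ (H.incl x)) ∧
    (∀ x, f (HopfAlgebra.antipode ℚ x) = HopfAlgebra.antipode ℚ (f x)) ∧
    (∀ n x, H.incl x ∈ O.deg n → K.incl (f x) ∈ O.deg n)

/-! ## Type A: descents and interior peaks -/

/-- `Y_J`, the sum of the permutations with descent set `J`. -/
def descentY (n : ℕ) (J : Finset ℕ) : MonoidAlgebra ℚ (SymPerm n) :=
  classSum fun w => SymPerm.des w = J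

/-- Solomon's descent algebra of type `A_{n-1}` (for `n = 0`, this is `ℚ`). -/
def solA (n : ℕ) : Submodule ℚ (MonoidAlgebra ℚ (SymPerm n)) :=
  Submodule.span ℚ {x | ∃ J ⊆ Finset.Ico 1 n, x = descentY n J}

/-- `F ⊆ {2, ..., n-1}` contains no two consecutive integers. -/
def IsIntPeakSet (n : ℕ) (F : Finset ℕ) : Prop :=
  F ⊆ Finset.Ico 2 n ∧ ∀ i ∈ F, i + 1 ∉ F

/-- The sum of the permutations with set of interior peaks `F`. -/
def intPeakP (n : ℕ) (F : Finset ℕ) : MonoidAlgebra ℚ (SymPerm n) :=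
  classSum fun w => SymPerm.intPeak w = F

/-- The peak ideal: the span of the sums of permutations with given interior peaks
(for `n = 0`, this is `ℚ`). -/
def peakIdeal (n : ℕ) : Submodule ℚ (MonoidAlgebra ℚ (SymPerm n)) :=
  Submodule.span ℚ {x | ∃ F, IsIntPeakSet n F ∧ x = intPeakP n F}

/-! ## Type B: the Mantaci-Reutenauer algebra and the canonical ideal -/

/-- A signed composition of `n`. -/
def IsSignedComposition (n : ℕ) (α : List ℤ) : Prop :=
  0 ∉ α ∧ (α.map Int.natAbs).sum = n

/-- The `i`-th (from `i = 0`) of the successive subintervals of `{1, ..., n}` whose lengths are the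
absolute values of the parts of `α`. -/
def block (α : List ℤ) (i : ℕ) : Finset ℕ :=
  Finset.Ioc ((α.take i).map Int.natAbs).sum ((α.take (i + 1)).map Int.natAbs).sum

/-- On `I`, the absolute values of the entries of `w` are increasing and the sign is constant. -/
def SignedPerm.IncreasingOn {n : ℕ} (w : SignedPerm n) (I : Finset ℕ) : Prop :=
  ∀ j ∈ I, ∀ k ∈ I, j < k →
    |w.entry j| < |w.entry k| ∧ (w.entry j).sign = (w.entry k).sign

/-- `T_α`: the sum of the signed permutations such that on each block of `α` the absolute values of
the entries are increasing and the entries have the sign of the corresponding part of `α`, and such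
that the blocks are maximal among the intervals of `{1, ..., n}` on which the absolute values are
increasing and the sign is constant. -/
def classT (n : ℕ) (α : List ℤ) : MonoidAlgebra ℚ (SignedPerm n) :=
  classSum fun w => ∀ i (hi : i < α.length),
    w.IncreasingOn (block α i) ∧ (∀ j ∈ block α i, (w.entry j).sign = α[i].sign) ∧
    ∀ a b, 1 ≤ a → b ≤ n → block α i ⊆ Finset.Icc a b → w.IncreasingOn (Finset.Icc a b) →
      Finset.Icc a b = block α i

/-- The algebra of Mantaci and Reutenauer (for `n = 0`, this is `ℚ`). -/
def omegaB (n : ℕ) : Submodule ℚ (MonoidAlgebra ℚ (SignedPerm n)) :=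
  Submodule.span ℚ {x | ∃ α, IsSignedComposition n α ∧ x = classT n α}

/-- `X⁰_J = X_{{0} ∪ J}`: the sum of the signed permutations with descents contained in
`{0} ∪ J`. In particular `X⁰_∅` is the sum of those with `w_1 < ... < w_n`. -/
def X0 (n : ℕ) (J : Finset ℕ) : MonoidAlgebra ℚ (SignedPerm n) :=
  classSum fun w => w.des ⊆ insert 0 J

/-- The canonical ideal `I⁰_n`, spanned by the `X⁰_J`, `J ⊆ {1, ..., n-1}`
(for `n = 0`, this is `ℚ`). -/
def canonicalIdeal (n : ℕ) : Submodule ℚ (MonoidAlgebra ℚ (SignedPerm n)) :=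
  Submodule.span ℚ {x | ∃ J ⊆ Finset.Ico 1 n, x = X0 n J}

/-! ## The descents-to-peaks transform and its type B analog -/

/-- A morphism of right modules on a subspace containing `1` is left multiplication by the image
of `1`. -/
theorem rightModuleMap_eq_mul {A : Type} [Ring A] [Algebra ℚ A] (S : Submodule ℚ A)
    (h1 : (1 : A) ∈ S) (hmul : ∀ x ∈ S, ∀ y ∈ S, x * y ∈ S) (θ : S →ₗ[ℚ] S)
    (hθ : ∀ x y : S, (θ ⟨x * y, hmul x x.2 y y.2⟩ : A) = θ x * y) (x : S) :
    (θ x : A) = θ ⟨1, h1⟩ * x := by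
  simpa using hθ ⟨1, h1⟩ x

/-- The value at `1` of the descents-to-peaks transform in degree `n`: twice the sum of the
permutations without interior peaks, except that it is `1` for `n = 0`. -/
def thetaGen (n : ℕ) : MonoidAlgebra ℚ (SymPerm n) :=
  if n = 0 then 1 else (2 : ℚ) • intPeakP n ∅

/-- The descents-to-peaks transform: in degree `n`, the morphism of right modules that sends `1` to
`thetaGen n`. -/
def theta : TotalAlg SymPerm →ₗ[ℚ] TotalAlg SymPerm :=
  DirectSum.lmap fun n => LinearMap.mulLeft ℚ (thetaGen n)

/-- Its type B analog: in degree `n`, the morphism of right modules that sends `1` to `X⁰_∅`. -/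
def thetaPM : TotalAlg SignedPerm →ₗ[ℚ] TotalAlg SignedPerm :=
  DirectSum.lmap fun n => LinearMap.mulLeft ℚ (X0 n ∅)

end

noncomputable section

/-! ## Shuffles -/

/-! Encode a signed permutation `w` by the word of `w⁻¹`: the letter at position `j` has as key the
place of the symbol `j` in `w`, up to a shift, and as sign the sign of that symbol. Inverting the
formulas of the external structure, left multiplication by shuffles becomes the shuffling of words
with separated keys (`mul_word`), and the factorizations `(u × v) · ξ⁻¹` become the ways to cut a
word in two (`comul_word`). The bialgebra laws of `ℚB` then say that filtering words by keys is
compatible with concatenation and with further filtering (`opsB_isBialgebra`). Those of `ℚS` descend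
along the surjection `forgetSigns` (`opsA_isBialgebra`).

Each of the four subspaces is a subalgebra generated by sequences of divided powers: `g₀ = 1` and `Δ
gₙ = Σ g_p ⊗ g_q`. Such a subalgebra is a graded connected subbialgebra
(`HopfOps.IsDivided.isGradedSub`), and so has an antipode, given by the geometric series that
inverts the identity under convolution (`exists_antipode`). A multiplicative map that sends divided
powers to divided powers respects the coproduct on the subalgebra (`HopfOps.isGradedHopfMorphism`).
The generators are `1 2 ... n` and its fully barred version for `Ω(B)` (`monSpan_signGen`), the
`X⁰_∅` for `I⁰` and the identities for `Sol(A)` (`monSpan_desGen`), and the `2P°_∅` for `P°`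
(`monSpan_peakGen`). The spanning families are reached by triangular recursions, since multiplying
by a generator leaves free only the conditions at the junction of the two blocks.

`Θ±` is left multiplication by `X⁰_∅`. It is multiplicative because a signed permutation that
increases on each of two blocks factors uniquely in two ways: as `w · ξ` with `w` increasing, and as
`ξ · (u × v)` with `u` and `v` increasing (`thetaPM_mul`); here `ξ` is a shuffle. It sends the
generator of sign `s` to the sum of the signed permutations whose entries times `s` increase. These
correspond to free choices of a sign for each symbol, and cutting a word cuts the choice, so they
are again divided powers (`monoSum_isDivided`).

If the entries of `w` increase, then their absolute values decrease and afterwards increase, so that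
there is no interior peak; conversely the signs can be recovered, except that of the symbol 1. Hence
`forgetSigns` sends `X⁰_∅` to `2P°_∅` in positive degree (`sum_incPerms_perm`) and intertwines `Θ±`
with `Θ` (`theta_forgetSigns`), which settles type A. -/

theorem mem_shuffles {p q : ℕ} {ξ : SymPerm (p + q)} :
    ξ ∈ shuffles p q ↔ StrictMono (fun i : Fin p => ξ (Fin.castAdd q i)) ∧
      StrictMono (fun j : Fin q => ξ (Fin.natAdd p j)) := by
  simp [shuffles]

/-- A permutation of `Fin n` that is strictly monotone is the identity. -/
theorem perm_eq_one_of_strictMono {n : ℕ} {σ : Equiv.Perm (Fin n)} (h : StrictMono σ) : σ = 1 :=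
  (Equiv.Perm.monotone_iff σ).1 h.monotone

namespace SymPerm

@[simp] theorem prod_castAdd {p q : ℕ} (u : SymPerm p) (v : SymPerm q) (i : Fin p) :
    prod u v (Fin.castAdd q i) = Fin.castAdd q (u i) := by
  simp [prod, Equiv.permCongr_apply]

@[simp] theorem prod_natAdd {p q : ℕ} (u : SymPerm p) (v : SymPerm q) (j : Fin q) :
    prod u v (Fin.natAdd p j) = Fin.natAdd p (v j) := by
  simp [prod, Equiv.permCongr_apply]

theorem prod_mul {p q : ℕ} (u u' : SymPerm p) (v v' : SymPerm q) :
    prod (u * u') (v * v') = prod u v * prod u' v' := by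
  ext k
  refine Fin.addCases (fun i => ?_) (fun j => ?_) k <;> simp

/-- Shuffles represent the cosets of `S_p × S_q`: sorting the values of `w` within each block of
positions picks the representative. -/
theorem exists_shuffle_mul_prod {p q : ℕ} (w : SymPerm (p + q)) :
    ∃ ξ ∈ shuffles p q, ∃ (u : SymPerm p) (v : SymPerm q), w = ξ * prod u v := by
  let a := Tuple.sort (fun i : Fin p => w (Fin.castAdd q i))
  let b := Tuple.sort (fun j : Fin q => w (Fin.natAdd p j))
  refine ⟨w * prod a b, mem_shuffles.2 ⟨?_, ?_⟩, a⁻¹, b⁻¹, ?_⟩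
  · have h := Tuple.monotone_sort (fun i : Fin p => w (Fin.castAdd q i))
    refine (h.strictMono_of_injective ?_ : StrictMono _) |> fun h => by simpa [a, Function.comp_def] using h
    exact (w.injective.comp (Fin.castAdd_injective p q)).comp a.injective
  · have h := Tuple.monotone_sort (fun i : Fin q => w (Fin.natAdd p i))
    refine (h.strictMono_of_injective ?_ : StrictMono _) |> fun h => by simpa [b, Function.comp_def] using h
    exact (w.injective.comp (Fin.natAdd_injective q p)).comp b.injective
  · rw [mul_assoc, ← prod_mul]
    simp only [mul_inv_cancel]
    ext k
    refine Fin.addCases (fun i => ?_) (fun j => ?_) k <;> simp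

/-- Two shuffles in the same coset differ by a block permutation; since both increase on each block,
so does that permutation, which is therefore trivial. -/
theorem shuffle_mul_prod_injective {p q : ℕ} {ξ ξ' : SymPerm (p + q)} {u u' : SymPerm p}
    {v v' : SymPerm q} (hξ : ξ ∈ shuffles p q) (hξ' : ξ' ∈ shuffles p q)
    (h : ξ * prod u v = ξ' * prod u' v') : ξ = ξ' ∧ u = u' ∧ v = v' := by
  rw [mem_shuffles] at hξ hξ'
  have e : ∀ k, ξ (prod (u * u'⁻¹) (v * v'⁻¹) k) = ξ' k := by
    intro k
    have := DFunLike.congr_fun h (prod u'⁻¹ v'⁻¹ k)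
    simp only [Equiv.Perm.mul_apply] at this
    rw [prod_mul, Equiv.Perm.mul_apply, this]
    refine Fin.addCases (fun i => ?_) (fun j => ?_) k <;> simp
  have hu : u * u'⁻¹ = 1 := by
    refine perm_eq_one_of_strictMono fun i j hij => ?_
    have := hξ'.1 hij
    simp only [← e, prod_castAdd] at this
    exact hξ.1.lt_iff_lt.1 this
  have hv : v * v'⁻¹ = 1 := by
    refine perm_eq_one_of_strictMono fun i j hij => ?_
    have := hξ'.2 hij
    simp only [← e, prod_natAdd] at this
    exact hξ.2.lt_iff_lt.1 this
  refine ⟨?_, mul_inv_eq_one.1 hu, mul_inv_eq_one.1 hv⟩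
  ext k
  rw [← e k, hu, hv]
  refine congrArg (fun x => (ξ x : ℕ)) ?_
  refine Fin.addCases (fun i => ?_) (fun j => ?_) k <;> simp

end SymPerm

namespace SignedPerm

variable {n : ℕ}

theorem ofPerm_mul (u v : SymPerm n) : ofPerm (u * v) = ofPerm u * ofPerm v := by
  ext <;> simp [ofPerm]

@[simp] theorem ofPerm_perm (u : SymPerm n) : (ofPerm u).perm = u := rfl
@[simp] theorem ofPerm_sign (u : SymPerm n) (i : Fin n) : (ofPerm u).sign i = 1 := rfl
@[simp] theorem prod_perm {p q : ℕ} (u : SignedPerm p) (v : SignedPerm q) :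
    (prod u v).perm = SymPerm.prod u.perm v.perm := rfl
@[simp] theorem prod_sign {p q : ℕ} (u : SignedPerm p) (v : SignedPerm q) :
    (prod u v).sign = Fin.append u.sign v.sign := rfl

theorem prod_mul {p q : ℕ} (u u' : SignedPerm p) (v v' : SignedPerm q) :
    prod (u * u') (v * v') = prod u v * prod u' v' := by
  apply SignedPerm.ext
  · simp [SymPerm.prod_mul]
  · ext k
    refine Fin.addCases (fun i => ?_) (fun j => ?_) k <;> simp

end SignedPerm

/-! ## Families of groups with an external structure -/

/-- The properties of the embeddings of `S_n` and of `G p × G q` on which the external structure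
depends. -/
structure IsExternal (G : ℕ → Type) [∀ n, Group (G n)]
    (emb : ∀ n, SymPerm n → G n) (prod : ∀ p q, G p → G q → G (p + q)) : Prop where
  prod_mul : ∀ p q u u' v v', prod p q (u * u') (v * v') = prod p q u v * prod p q u' v'
  exists_eq : ∀ p q (w : G (p + q)),
    ∃ ξ ∈ shuffles p q, ∃ u v, w = emb (p + q) ξ * prod p q u v
  injective : ∀ p q ξ ξ' u u' v v', ξ ∈ shuffles p q → ξ' ∈ shuffles p q →
    emb (p + q) ξ * prod p q u v = emb (p + q) ξ' * prod p q u' v' → ξ = ξ' ∧ u = u' ∧ v = v'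

theorem isExternal_symPerm :
    IsExternal SymPerm (fun _ ξ => ξ) (fun _ _ => SymPerm.prod) where
  prod_mul _ _ := SymPerm.prod_mul
  exists_eq _ _ := SymPerm.exists_shuffle_mul_prod
  injective _ _ _ _ _ _ _ _ := SymPerm.shuffle_mul_prod_injective

theorem isExternal_signedPerm :
    IsExternal SignedPerm (fun _ => SignedPerm.ofPerm) (fun _ _ => SignedPerm.prod) where
  prod_mul _ _ := SignedPerm.prod_mul
  exists_eq p q w := by
    obtain ⟨ξ, hξ, u, v, h⟩ := SymPerm.exists_shuffle_mul_prod w.perm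
    -- Left multiplication by an unsigned permutation leaves the signs in place, so the sign vector
    -- of `w` is just cut in two.
    refine ⟨ξ, hξ, ⟨u, fun i => w.sign (Fin.castAdd q i)⟩, ⟨v, fun j => w.sign (Fin.natAdd p j)⟩, ?_⟩
    apply SignedPerm.ext
    · simpa using h
    · ext k
      refine Fin.addCases (fun i => ?_) (fun j => ?_) k <;> simp
  injective p q ξ ξ' u u' v v' hξ hξ' h := by
    obtain ⟨h1, h2, h3⟩ := SymPerm.shuffle_mul_prod_injective hξ hξ'
      (u := u.perm) (v := v.perm) (u' := u'.perm) (v' := v'.perm)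
      (by simpa using congrArg SignedPerm.perm h)
    have hs := congrArg SignedPerm.sign h
    refine ⟨h1, ?_, ?_⟩
    · apply SignedPerm.ext h2
      ext i
      simpa using congrArg Units.val (congrFun hs (Fin.castAdd q i))
    · apply SignedPerm.ext h3
      ext i
      simpa using congrArg Units.val (congrFun hs (Fin.natAdd p i))

namespace TotalAlg

variable {G : ℕ → Type} [∀ n, Group (G n)] {M : Type} [AddCommGroup M] [Module ℚ M]

@[simp] theorem lift_elt (f : ∀ n, G n → M) {n : ℕ} (w : G n) :
    TotalAlg.lift f (TotalAlg.elt w) = f n w := by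
  simp [TotalAlg.lift, TotalAlg.elt, DirectSum.toModule_lof]

theorem ext_elt {f g : TotalAlg G →ₗ[ℚ] M} (h : ∀ n (w : G n), f (elt w) = g (elt w)) : f = g := by
  refine DirectSum.linearMap_ext ℚ fun n => ?_
  ext w
  exact h n w

end TotalAlg

section ExternalOps

variable {G : ℕ → Type} [∀ n, Group (G n)] [∀ n, Fintype (G n)]
  {emb : ∀ n, SymPerm n → G n} {prod : ∀ p q, G p → G q → G (p + q)}

open TotalAlg

theorem externalOps_mul_elt {p q : ℕ} (u : G p) (v : G q) :
    (externalOps G emb prod).mul (elt u) (elt v) =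
      ∑ ξ ∈ shuffles p q, elt (emb (p + q) ξ * prod p q u v) := by
  simp [externalOps]

open scoped Classical in
/-- The part of degree `pq` of the coproduct of a group element. -/
def comulTerm (emb : ∀ n, SymPerm n → G n) (prod : ∀ p q, G p → G q → G (p + q)) {n : ℕ}
    (w : G n) (pq : ℕ × ℕ) : TotalAlg G ⊗[ℚ] TotalAlg G :=
  ∑ t ∈ (Finset.univ ×ˢ (Finset.univ ×ˢ shuffles pq.1 pq.2) :
      Finset (G pq.1 × G pq.2 × SymPerm (pq.1 + pq.2))).filter
    (fun t => (⟨n, w⟩ : Σ m, G m) =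
      ⟨pq.1 + pq.2, prod pq.1 pq.2 t.1 t.2.1 * (emb (pq.1 + pq.2) t.2.2)⁻¹⟩),
    elt t.1 ⊗ₜ[ℚ] elt t.2.1

theorem externalOps_comul_elt {n : ℕ} (w : G n) :
    (externalOps G emb prod).comul (elt w) =
      ∑ pq ∈ Finset.HasAntidiagonal.antidiagonal n, comulTerm emb prod w pq := by
  simp [externalOps, comulTerm]

@[simp] theorem externalOps_counit_elt {n : ℕ} (w : G n) :
    (externalOps G emb prod).counit (elt w) = if n = 0 then 1 else 0 := by
  simp [externalOps]

namespace IsExternal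

variable (hG : IsExternal G emb prod)
include hG

theorem prod_one (p q : ℕ) : prod p q 1 1 = 1 := by
  have := hG.prod_mul p q 1 1 1 1
  simpa using this

theorem prod_inv (p q : ℕ) (u : G p) (v : G q) : prod p q u⁻¹ v⁻¹ = (prod p q u v)⁻¹ := by
  rw [eq_inv_iff_mul_eq_one, ← hG.prod_mul]
  simp [hG.prod_one]

theorem exists_eq_prod_mul_inv {p q : ℕ} (w : G (p + q)) :
    ∃ u v, ∃ ξ ∈ shuffles p q, w = prod p q u v * (emb (p + q) ξ)⁻¹ := by
  obtain ⟨ξ, hξ, u, v, h⟩ := hG.exists_eq p q w⁻¹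
  refine ⟨u⁻¹, v⁻¹, ξ, hξ, ?_⟩
  rw [hG.prod_inv, ← mul_inv_rev, ← h, inv_inv]

/-- Uniqueness of the factorization, applied to the inverse, leaves one term of the coproduct in
each bidegree. -/
theorem comulTerm_eq {p q : ℕ} (u : G p) (v : G q) {ξ : SymPerm (p + q)} (hξ : ξ ∈ shuffles p q) :
    comulTerm emb prod (prod p q u v * (emb (p + q) ξ)⁻¹) (p, q) = elt u ⊗ₜ[ℚ] elt v := by
  classical
  rw [comulTerm, Finset.sum_eq_single (u, v, ξ)]
  · rintro ⟨u', v', ξ'⟩ ht hne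
    simp only [Finset.mem_filter, Finset.mem_product, Finset.mem_univ, true_and, Sigma.mk.injEq,
      heq_eq_eq] at ht
    obtain ⟨hξ', h⟩ := ht
    have h := congrArg (·⁻¹) h
    simp only [mul_inv_rev, inv_inv, ← hG.prod_inv] at h
    obtain ⟨h1, h2, h3⟩ := hG.injective p q _ _ _ _ _ _ hξ hξ' h
    exact absurd (by rw [inv_injective h2, inv_injective h3, h1]) hne
  · intro h
    simp [hξ] at h

end IsExternal

end ExternalOps

/-! ## Sums over classes of group elements -/

section ClassSum

variable {G : ℕ → Type} [∀ n, Group (G n)] [∀ n, Fintype (G n)]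
  {emb : ∀ n, SymPerm n → G n} {prod : ∀ p q, G p → G q → G (p + q)}

open TotalAlg

open scoped Classical in
theorem lof_classSum {n : ℕ} (P : G n → Prop) :
    DirectSum.lof ℚ ℕ (fun n => MonoidAlgebra ℚ (G n)) n (classSum P) =
      ∑ w ∈ Finset.univ.filter P, elt w := by
  simp [classSum, elt]

open scoped Classical in
/-- The sum of the group elements with property `P`, in the direct sum of the group algebras. -/
def classElt {n : ℕ} (P : G n → Prop) : TotalAlg G := ∑ w ∈ Finset.univ.filter P, elt w

theorem lof_classSum' {n : ℕ} (P : G n → Prop) :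
    DirectSum.lof ℚ ℕ (fun n => MonoidAlgebra ℚ (G n)) n (classSum P) = classElt P :=
  lof_classSum P

theorem classElt_congr {n : ℕ} {P Q : G n → Prop} (h : ∀ w, P w ↔ Q w) :
    classElt P = classElt Q := by
  have : P = Q := funext fun w => propext (h w)
  rw [this]

/-- The map `(ξ, u, v) ↦ ξ · (u × v)` is bijective, so a product of class sums is a class sum as
soon as membership can be read from `u` and `v` alone. All product formulas for the spanning
families come from this. -/
theorem IsExternal.mul_classElt (hG : IsExternal G emb prod) {p q : ℕ} (P : G p → Prop)
    (Q : G q → Prop) (R : G (p + q) → Prop)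
    (h : ∀ ξ ∈ shuffles p q, ∀ u v, R (emb (p + q) ξ * prod p q u v) ↔ P u ∧ Q v) :
    (externalOps G emb prod).mul (classElt P) (classElt Q) = classElt R := by
  classical
  simp only [classElt, map_sum, LinearMap.sum_apply, externalOps_mul_elt]
  rw [Finset.sum_comm, ← Finset.sum_product', Finset.sum_sigma']
  refine Finset.sum_bij (fun t _ => emb (p + q) t.2 * prod p q t.1.1 t.1.2) ?_ ?_ ?_ ?_
  · rintro ⟨⟨u, v⟩, ξ⟩ ht
    simp at ht ⊢
    exact (h ξ ht.2 u v).2 ht.1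
  · rintro ⟨⟨u, v⟩, ξ⟩ ht ⟨⟨u', v'⟩, ξ'⟩ ht' he
    simp at ht ht' he
    obtain ⟨rfl, rfl, rfl⟩ := hG.injective p q _ _ _ _ _ _ ht.2 ht'.2 he
    rfl
  · intro w hw
    obtain ⟨ξ, hξ, u, v, rfl⟩ := hG.exists_eq p q w
    have := (h ξ hξ u v).1 (by simpa using hw)
    exact ⟨⟨⟨u, v⟩, ξ⟩, by simp [this, hξ], rfl⟩
  · intros; rfl

end ClassSum
end

noncomputable section

/-! ## Standardization of words -/

open TotalAlg

/-- A letter: a key, by which letters are compared, and a sign. -/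
abbrev Letter : Type := ℤ × ℤˣ

/-- Ties are broken by position, so sorting amounts to a strict lexicographic order on (key,
position). -/
theorem eq_sort_iff_forall {n : ℕ} (f : Fin n → ℤ) (σ : Equiv.Perm (Fin n)) :
    σ = Tuple.sort f ↔
      ∀ i j, i < j → f (σ i) < f (σ j) ∨ f (σ i) = f (σ j) ∧ σ i < σ j := by
  rw [Tuple.eq_sort_iff]
  constructor
  · rintro ⟨h1, h2⟩ i j hij
    rcases (h1 hij.le : f (σ i) ≤ f (σ j)).lt_or_eq with h | h
    · exact Or.inl h
    · exact Or.inr ⟨h, h2 i j hij h⟩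
  · intro h
    refine ⟨fun i j hij => ?_, fun i j hij he => ?_⟩
    · rcases hij.lt_or_eq with h' | rfl
      · rcases h i j h' with h | h
        · exact h.le
        · exact h.1.le
      · exact le_rfl
    · rcases h i j hij with h | h
      · exact absurd he h.ne
      · exact h.2

theorem sort_lt_sort_iff {n : ℕ} (f : Fin n → ℤ) (i j : Fin n) :
    (Tuple.sort f).symm i < (Tuple.sort f).symm j ↔ f i < f j ∨ f i = f j ∧ i < j := by
  have h := (eq_sort_iff_forall f _).1 rfl
  constructor
  · intro hij
    simpa using h _ _ hij
  · intro hij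
    by_contra hle
    rcases (not_lt.1 hle).lt_or_eq with h' | h'
    · have := h _ _ h'
      simp only [Equiv.apply_symm_apply] at this
      omega
    · rw [(Tuple.sort f).symm.injective h'] at hij
      simp at hij

/-- The standardization of a word: the signed permutation that lists the positions of the word in
the order of the keys of their letters, with the signs of these letters. -/
def std {n : ℕ} (c : Fin n → Letter) : SignedPerm n where
  perm := Tuple.sort fun i => (c i).1
  sign i := (c (Tuple.sort (fun i => (c i).1) i)).2

/-- The shuffle `s⁻¹ * (a × b)` sends the rank of a letter within its half to its rank in the whole
word. It increases on each block because both ranks use the same comparison of letters. -/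
theorem std_eq_prod_mul {p q : ℕ} (c : Fin (p + q) → Letter) :
    ∃ ξ ∈ shuffles p q, std c =
      SignedPerm.prod (std fun i => c (Fin.castAdd q i)) (std fun j => c (Fin.natAdd p j)) *
        (SignedPerm.ofPerm ξ)⁻¹ := by
  set s := Tuple.sort fun i => (c i).1 with hs
  set a := Tuple.sort fun i => (c (Fin.castAdd q i)).1 with ha
  set b := Tuple.sort fun j => (c (Fin.natAdd p j)).1 with hb
  refine ⟨s⁻¹ * SymPerm.prod a b, mem_shuffles.2 ⟨fun i j hij => ?_, fun i j hij => ?_⟩, ?_⟩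
  · have := (eq_sort_iff_forall _ a).1 ha i j hij
    change s.symm (SymPerm.prod a b _) < s.symm (SymPerm.prod a b _)
    rw [SymPerm.prod_castAdd, SymPerm.prod_castAdd, hs, sort_lt_sort_iff]
    exact this
  · have := (eq_sort_iff_forall _ b).1 hb i j hij
    simpa [hs, sort_lt_sort_iff] using this
  · rw [eq_mul_inv_iff_mul_eq]
    apply SignedPerm.ext
    · simp [std, ← hs, ← ha, ← hb]
    · ext k
      simp only [std, ← hs, ← ha, ← hb]
      refine Fin.addCases (fun i => ?_) (fun j => ?_) k <;> simp

/-- The permutation `ξ` says at which positions the letters of the two words are put. All keys of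
`c₁` are smaller, so sorting lists first the positions of `c₁`, then those of `c₂`; within each word
`ξ` preserves the order of positions, hence also the way ties are broken. -/
theorem std_append_comp_inv {p q : ℕ} (c₁ : Fin p → Letter) (c₂ : Fin q → Letter) (m : ℤ)
    (h₁ : ∀ i, (c₁ i).1 < m) (h₂ : ∀ j, m ≤ (c₂ j).1) {ξ : SymPerm (p + q)}
    (hξ : ξ ∈ shuffles p q) :
    std (fun k => Fin.append c₁ c₂ (ξ.symm k)) =
      SignedPerm.ofPerm ξ * SignedPerm.prod (std c₁) (std c₂) := by
  rw [mem_shuffles] at hξ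
  set a := Tuple.sort fun i => (c₁ i).1 with ha
  set b := Tuple.sort fun j => (c₂ j).1 with hb
  have key : ξ * SymPerm.prod a b =
      Tuple.sort fun k => (Fin.append c₁ c₂ (ξ.symm k)).1 := by
    rw [eq_sort_iff_forall]
    intro k l hkl
    refine Fin.addCases (fun i hkl => ?_) (fun i hkl => ?_) k hkl <;>
      refine Fin.addCases (fun j hkl => ?_) (fun j hkl => ?_) l hkl
    · have hij : i < j := hkl
      have := (eq_sort_iff_forall _ a).1 ha i j hij
      simpa [hξ.1.lt_iff_lt] using this
    · left
      simpa using (h₁ _).trans_le (h₂ _)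
    · simp [Fin.lt_def] at hkl
      omega
    · have hij : i < j := by simpa using hkl
      have := (eq_sort_iff_forall _ b).1 hb i j hij
      simpa [hξ.2.lt_iff_lt] using this
  apply SignedPerm.ext
  · simp [std, ← key, ← ha, ← hb]
  · ext k
    simp only [std, ← key]
    refine Fin.addCases (fun i => ?_) (fun j => ?_) k <;> simp [← ha, ← hb]

/-- The element of `ℚB` given by a word. -/
def wordFn {n : ℕ} (c : Fin n → Letter) : TotalAlg SignedPerm := elt (std c)

/-- The element of `ℚB` given by a word. -/
def word (l : List Letter) : TotalAlg SignedPerm := wordFn l.get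

theorem exists_eq_ofFn {α : Type} (l : List α) {n : ℕ} (h : l.length = n) :
    ∃ c : Fin n → α, l = List.ofFn c := by
  subst h
  exact ⟨l.get, (List.ofFn_get l).symm⟩

theorem word_ofFn {n : ℕ} (c : Fin n → Letter) : word (List.ofFn c) = wordFn c := by
  have key : ∀ m (d : Fin m → Letter), List.ofFn c = List.ofFn d → wordFn c = wordFn d := by
    intro m d h
    have hl : n = m := by simpa using congrArg List.length h
    subst hl
    rw [List.ofFn_injective h]
  exact (key _ _ (List.ofFn_get _).symm).symm

theorem comulTerm_std {p q : ℕ} (c : Fin (p + q) → Letter) :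
    comulTerm (fun _ => SignedPerm.ofPerm) (fun _ _ => SignedPerm.prod) (std c) (p, q) =
      wordFn (fun i => c (Fin.castAdd q i)) ⊗ₜ[ℚ] wordFn (fun j => c (Fin.natAdd p j)) := by
  obtain ⟨ξ, hξ, h⟩ := std_eq_prod_mul c
  rw [h]
  exact isExternal_signedPerm.comulTerm_eq _ _ hξ

/-- The pairs of words whose concatenation is a given word. -/
def splits (l : List Letter) : Finset (List Letter × List Letter) :=
  (Finset.HasAntidiagonal.antidiagonal l.length).image fun pq => (l.take pq.1, l.drop pq.1)

theorem mem_splits {l : List Letter} {t : List Letter × List Letter} :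
    t ∈ splits l ↔ t.1 ++ t.2 = l := by
  simp only [splits, Finset.mem_image, Finset.HasAntidiagonal.mem_antidiagonal]
  constructor
  · rintro ⟨pq, -, rfl⟩
    simp
  · rintro rfl
    exact ⟨(t.1.length, t.2.length), by simp, by simp⟩

theorem comul_word (l : List Letter) :
    opsB.comul (word l) = ∑ t ∈ splits l, word t.1 ⊗ₜ[ℚ] word t.2 := by
  rw [splits, Finset.sum_image]
  · rw [word, wordFn, opsB, externalOps_comul_elt]
    refine Finset.sum_congr rfl fun pq hpq => ?_
    -- The length is generalized so that it can be replaced by `p + q`.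
    have key : ∀ n (c : Fin n → Letter) (pq : ℕ × ℕ), pq.1 + pq.2 = n →
        comulTerm (fun _ => SignedPerm.ofPerm) (fun _ _ => SignedPerm.prod) (std c) pq =
        word ((List.ofFn c).take pq.1) ⊗ₜ[ℚ] word ((List.ofFn c).drop pq.1) := by
      rintro n c ⟨p, q⟩ rfl
      rw [comulTerm_std, ← word_ofFn, ← word_ofFn, List.ofFn_add]
      simp [Fin.castAdd, Fin.natAdd]
    rw [key _ _ _ (Finset.HasAntidiagonal.mem_antidiagonal.1 hpq), List.ofFn_get]
  · rintro ⟨p, q⟩ hp ⟨p', q'⟩ hp' h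
    simp only [Finset.mem_coe, Finset.HasAntidiagonal.mem_antidiagonal] at hp hp'
    have := congrArg (fun t => t.1.length) h
    simp at this hp hp'
    simp
    omega

/-- The letters with key below `m`. -/
def lo (m : ℤ) (x : Letter) : Bool := decide (x.1 < m)

/-- The letters with key at least `m`. -/
def hi (m : ℤ) (x : Letter) : Bool := decide (m ≤ x.1)

@[simp] theorem lo_iff {m : ℤ} {x : Letter} : lo m x = true ↔ x.1 < m := by simp [lo]
@[simp] theorem hi_iff {m : ℤ} {x : Letter} : hi m x = true ↔ m ≤ x.1 := by simp [hi]
theorem hi_eq_not_lo (m : ℤ) : hi m = fun x => !lo m x := by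
  ext x
  simp only [hi, lo, ← not_lt, decide_not]

/-- The shuffles of two words, the keys of which are below, respectively at least, `m`. -/
def shuf (m : ℤ) (a b : List Letter) : Finset (List Letter) :=
  (a ++ b).permutations.toFinset.filter fun l => l.filter (lo m) = a ∧ l.filter (hi m) = b

theorem mem_shuf {m : ℤ} {a b l : List Letter} :
    l ∈ shuf m a b ↔ l.filter (lo m) = a ∧ l.filter (hi m) = b := by
  simp only [shuf, Finset.mem_filter, List.mem_toFinset, List.mem_permutations, and_iff_right_iff_imp]
  rintro ⟨rfl, rfl⟩
  rw [hi_eq_not_lo]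
  exact (List.filter_append_perm _ l).symm

/-! ### Products of words as sums over shuffled words -/

theorem filter_finRange_shuffle {p q : ℕ} {ξ : SymPerm (p + q)} (hξ : ξ ∈ shuffles p q)
    (P : Fin (p + q) → Bool) (h₁ : ∀ i, P (ξ (Fin.castAdd q i)) = true)
    (h₂ : ∀ j, P (ξ (Fin.natAdd p j)) = false) :
    (List.finRange (p + q)).filter P = List.ofFn fun i => ξ (Fin.castAdd q i) := by
  rw [mem_shuffles] at hξ
  refine List.Pairwise.eq_of_mem_iff (r := (· < ·)) ?_ ?_ ?_
  · exact (List.pairwise_lt_finRange _).filter _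
  · rw [List.pairwise_ofFn]
    exact fun i j h => hξ.1 h
  · intro k
    simp only [List.mem_filter, List.mem_finRange, true_and, List.mem_ofFn]
    obtain ⟨k, rfl⟩ := ξ.surjective k
    refine Fin.addCases (fun i => ?_) (fun j => ?_) k
    · simp [h₁]
    · simp [h₂, Fin.ext_iff]
      intro i
      omega

theorem filter_finRange_shuffle' {p q : ℕ} {ξ : SymPerm (p + q)} (hξ : ξ ∈ shuffles p q)
    (P : Fin (p + q) → Bool) (h₁ : ∀ i, P (ξ (Fin.castAdd q i)) = false)
    (h₂ : ∀ j, P (ξ (Fin.natAdd p j)) = true) :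
    (List.finRange (p + q)).filter P = List.ofFn fun j => ξ (Fin.natAdd p j) := by
  rw [mem_shuffles] at hξ
  refine List.Pairwise.eq_of_mem_iff (r := (· < ·)) ?_ ?_ ?_
  · exact (List.pairwise_lt_finRange _).filter _
  · rw [List.pairwise_ofFn]
    exact fun i j h => hξ.2 h
  · intro k
    simp only [List.mem_filter, List.mem_finRange, true_and, List.mem_ofFn]
    obtain ⟨k, rfl⟩ := ξ.surjective k
    refine Fin.addCases (fun i => ?_) (fun j => ?_) k
    · simp [h₁, Fin.ext_iff]
      intro i
      omega
    · simp [h₂]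

/-- Since the keys are separated by `m`, a shuffled word determines its shuffle: the positions of
the low letters, in order, are the values of `ξ` on the first block, and those of the high letters
its values on the second. -/
theorem mul_wordFn {p q : ℕ} (c₁ : Fin p → Letter) (c₂ : Fin q → Letter) (m : ℤ)
    (h₁ : ∀ i, (c₁ i).1 < m) (h₂ : ∀ j, m ≤ (c₂ j).1) :
    opsB.mul (wordFn c₁) (wordFn c₂) =
      ∑ l ∈ shuf m (List.ofFn c₁) (List.ofFn c₂), word l := by
  rw [wordFn, wordFn, opsB, externalOps_mul_elt]
  have hfil : ∀ (f : Fin (p + q) → Letter) (P : Letter → Bool),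
      (List.ofFn f).filter P = ((List.finRange (p + q)).filter fun k => P (f k)).map f := by
    intro f P
    rw [List.ofFn_eq_map, List.filter_map]
    rfl
  have hlo : ∀ ξ ∈ shuffles p q, (List.finRange (p + q)).filter
      (fun k => lo m (Fin.append c₁ c₂ (ξ.symm k))) = List.ofFn fun i => ξ (Fin.castAdd q i) :=
    fun ξ hξ => filter_finRange_shuffle hξ _ (fun i => by simp [h₁]) (fun j => by simp [lo, h₂])
  have hhi : ∀ ξ ∈ shuffles p q, (List.finRange (p + q)).filter
      (fun k => hi m (Fin.append c₁ c₂ (ξ.symm k))) = List.ofFn fun i => ξ (Fin.natAdd p i) :=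
    fun ξ hξ => filter_finRange_shuffle' hξ _ (fun i => by simp [hi, h₁]) (fun j => by simp [h₂])
  refine Finset.sum_bij (fun ξ _ => List.ofFn fun k => Fin.append c₁ c₂ (ξ.symm k)) ?_ ?_ ?_ ?_
  · intro ξ hξ
    rw [mem_shuf, hfil, hlo ξ hξ, hfil, hhi ξ hξ]
    constructor <;> simp [List.map_ofFn, Function.comp_def]
  · intro ξ hξ ξ' hξ' h
    have h := List.ofFn_injective h
    have e1 := hlo ξ hξ
    have e2 := hhi ξ hξ
    simp only [fun k => congrFun h k] at e1 e2
    rw [hlo ξ' hξ'] at e1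
    rw [hhi ξ' hξ'] at e2
    ext k
    refine congrArg Fin.val (?_ : ξ k = ξ' k)
    refine Fin.addCases (fun i => ?_) (fun j => ?_) k
    · exact (congrFun (List.ofFn_injective e1) i).symm
    · exact (congrFun (List.ofFn_injective e2) j).symm
  · intro l hl
    rw [mem_shuf] at hl
    have hlen : l.length = p + q := by
      have := (List.filter_append_perm (lo m) l).length_eq
      rw [← hi_eq_not_lo, hl.1, hl.2] at this
      simpa using this.symm
    obtain ⟨c, rfl⟩ := exists_eq_ofFn l hlen
    obtain ⟨hl1, hl2⟩ := hl
    rw [hfil] at hl1 hl2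
    -- `s₁` and `s₂` list the positions of the low and of the high letters. Together they list every
    -- position once, so they are the two halves of a permutation, which is the required shuffle.
    obtain ⟨s₁, hs₁⟩ := exists_eq_ofFn ((List.finRange (p + q)).filter fun k => lo m (c k)) (n := p)
      (by simpa using congrArg List.length hl1)
    obtain ⟨s₂, hs₂⟩ := exists_eq_ofFn ((List.finRange (p + q)).filter fun k => hi m (c k)) (n := q)
      (by simpa using congrArg List.length hl2)
    have hs : List.ofFn (Fin.append s₁ s₂) =
        ((List.finRange (p + q)).filter fun k => lo m (c k)) ++
        ((List.finRange (p + q)).filter fun k => hi m (c k)) := by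
      rw [List.ofFn_fin_append, hs₁, hs₂]
    have hinj : Function.Injective (Fin.append s₁ s₂) := by
      rw [← List.nodup_ofFn, hs]
      have : (fun k => hi m (c k)) = fun k => !(fun k => lo m (c k)) k := by
        rw [hi_eq_not_lo]
      rw [this, (List.filter_append_perm _ _).nodup_iff]
      exact List.nodup_finRange _
    let ξ : SymPerm (p + q) := Equiv.ofBijective _ (Finite.injective_iff_bijective.1 hinj)
    have hξ : ∀ k, ξ k = Fin.append s₁ s₂ k := fun _ => rfl
    refine ⟨ξ, mem_shuffles.2 ⟨?_, ?_⟩, ?_⟩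
    · have := (List.pairwise_lt_finRange (p + q)).filter (fun k => lo m (c k))
      rw [hs₁, List.pairwise_ofFn] at this
      intro i j hij
      simpa [hξ] using this hij
    · have := (List.pairwise_lt_finRange (p + q)).filter (fun k => hi m (c k))
      rw [hs₂, List.pairwise_ofFn] at this
      intro i j hij
      simpa [hξ] using this hij
    · congr 1
      ext1 k
      obtain ⟨k, rfl⟩ := ξ.surjective k
      rw [hs₁, List.map_ofFn] at hl1
      rw [hs₂, List.map_ofFn] at hl2
      simp only [Equiv.symm_apply_apply]
      refine Fin.addCases (fun i => ?_) (fun j => ?_) k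
      · simpa [hξ] using (congrFun (List.ofFn_injective hl1) i).symm
      · simpa [hξ] using (congrFun (List.ofFn_injective hl2) j).symm
  · intro ξ hξ
    rw [word_ofFn, wordFn, std_append_comp_inv c₁ c₂ m h₁ h₂ hξ]

theorem mul_word (a b : List Letter) (m : ℤ) (ha : ∀ x ∈ a, x.1 < m) (hb : ∀ x ∈ b, m ≤ x.1) :
    opsB.mul (word a) (word b) = ∑ l ∈ shuf m a b, word l := by
  obtain ⟨p, c₁, rfl⟩ : ∃ p, ∃ c : Fin p → Letter, a = List.ofFn c := ⟨_, exists_eq_ofFn a rfl⟩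
  obtain ⟨q, c₂, rfl⟩ : ∃ q, ∃ c : Fin q → Letter, b = List.ofFn c := ⟨_, exists_eq_ofFn b rfl⟩
  rw [word_ofFn, word_ofFn]
  exact mul_wordFn _ _ _ (fun i => ha _ (by simp)) (fun j => hb _ (by simp))

/-- The word is that of `w⁻¹`, with keys shifted by `k`. The freedom in `k` serves to separate the
keys of several factors. -/
theorem exists_word_eq_elt {n : ℕ} (w : SignedPerm n) (k : ℤ) :
    ∃ l : List Letter, word l = elt w ∧ l.length = n ∧ ∀ x ∈ l, k ≤ x.1 ∧ x.1 < k + n := by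
  let c : Fin n → Letter := fun i => (k + (w.perm.symm i : ℕ), w.sign (w.perm.symm i))
  refine ⟨List.ofFn c, ?_, by simp, ?_⟩
  · rw [word_ofFn, wordFn]
    congr 1
    have h : w.perm = Tuple.sort fun i => (c i).1 := by
      rw [eq_sort_iff_forall]
      intro i j hij
      left
      simp [c]
      exact hij
    apply SignedPerm.ext
    · simp only [std, ← h]
    · ext i
      simp only [std, ← h]
      simp [c]
  · intro x hx
    simp only [List.mem_ofFn] at hx
    obtain ⟨i, rfl⟩ := hx
    simp [c]

end

noncomputable section

/-! ## Bialgebra laws -/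

/-- The structure maps `O` make `V` a bialgebra. -/
structure HopfOps.IsBialgebra {V : Type} [AddCommGroup V] [Module ℚ V] (O : HopfOps V) :
    Prop where
  mul_assoc : ∀ x y z, O.mul (O.mul x y) z = O.mul x (O.mul y z)
  one_mul : ∀ x, O.mul O.one x = x
  mul_one : ∀ x, O.mul x O.one = x
  coassoc : ∀ x, TensorProduct.assoc ℚ V V V (O.comul.rTensor V (O.comul x)) =
    O.comul.lTensor V (O.comul x)
  rTensor_counit : ∀ x, O.counit.rTensor V (O.comul x) = 1 ⊗ₜ x
  lTensor_counit : ∀ x, O.counit.lTensor V (O.comul x) = x ⊗ₜ 1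
  counit_one : O.counit O.one = 1
  counit_mul : ∀ x y, O.counit (O.mul x y) = O.counit x * O.counit y
  comul_one : O.comul O.one = O.one ⊗ₜ O.one
  comul_mul : ∀ x y, O.comul (O.mul x y) = TensorProduct.map₂ O.mul O.mul (O.comul x) (O.comul y)

namespace TotalAlg

variable {G : ℕ → Type} [∀ n, Group (G n)]

theorem span_range_elt :
    Submodule.span ℚ (Set.range fun w : Σ n, G n => (elt w.2 : TotalAlg G)) = ⊤ := by
  rw [← Submodule.ker_mkQ (Submodule.span ℚ _), LinearMap.ker_eq_top]
  refine ext_elt fun n w => ?_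
  rw [LinearMap.zero_apply, Submodule.mkQ_apply, Submodule.Quotient.mk_eq_zero]
  exact Submodule.subset_span ⟨⟨n, w⟩, rfl⟩

theorem induction_elt {P : TotalAlg G → Prop} (h : ∀ n (w : G n), P (elt w)) (h0 : P 0)
    (hadd : ∀ x y, P x → P y → P (x + y)) (hsmul : ∀ (a : ℚ) x, P x → P (a • x))
    (x : TotalAlg G) : P x := by
  have hx : x ∈ Submodule.span ℚ (Set.range fun w : Σ n, G n => (elt w.2 : TotalAlg G)) := by
    rw [span_range_elt]; trivial
  induction hx using Submodule.span_induction with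
  | mem x hx =>
    obtain ⟨⟨n, w⟩, rfl⟩ := hx
    exact h n w
  | zero => exact h0
  | add x y _ _ hx hy => exact hadd x y hx hy
  | smul a x _ hx => exact hsmul a x hx

end TotalAlg

open TotalAlg

theorem word_nil : word [] = opsB.one := by
  obtain ⟨l, hl, h0, -⟩ := exists_word_eq_elt (1 : SignedPerm 0) 0
  rw [List.length_eq_zero_iff.1 h0] at hl
  exact hl

theorem shuf_nil_left {m : ℤ} {a : List Letter} (ha : ∀ x ∈ a, m ≤ x.1) : shuf m [] a = {a} := by
  ext l
  rw [mem_shuf, Finset.mem_singleton]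
  constructor
  · rintro ⟨h1, rfl⟩
    rw [eq_comm, List.filter_eq_self]
    intro x hx
    have := List.filter_eq_nil_iff.1 h1 x hx
    simpa using this
  · rintro rfl
    exact ⟨List.filter_eq_nil_iff.2 fun x hx => by simpa using ha x hx,
      List.filter_eq_self.2 fun x hx => by simpa using ha x hx⟩

theorem shuf_nil_right {m : ℤ} {a : List Letter} (ha : ∀ x ∈ a, x.1 < m) : shuf m a [] = {a} := by
  ext l
  rw [mem_shuf, Finset.mem_singleton]
  constructor
  · rintro ⟨rfl, h1⟩
    rw [eq_comm, List.filter_eq_self]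
    intro x hx
    have := List.filter_eq_nil_iff.1 h1 x hx
    simpa using this
  · rintro rfl
    exact ⟨List.filter_eq_self.2 fun x hx => by simpa using ha x hx,
      List.filter_eq_nil_iff.2 fun x hx => by simpa using ha x hx⟩

theorem mem_of_mem_shuf {m : ℤ} {a b l : List Letter} (hl : l ∈ shuf m a b) {x : Letter}
    (hx : x ∈ l) : x ∈ a ∨ x ∈ b := by
  rw [mem_shuf] at hl
  rcases lt_or_ge x.1 m with h | h
  · left
    rw [← hl.1, List.mem_filter]
    exact ⟨hx, by simpa using h⟩
  · right
    rw [← hl.2, List.mem_filter]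
    exact ⟨hx, by simpa using h⟩

/-- Both sides sum over the words whose letters with keys below `m`, in `[m, m')` and from `m'` on
form `a`, `b` and `c`. The intermediate word of either bracketing is the subword of letters from `m`
on, respectively below `m'`. -/
theorem opsB_mul_assoc_word {a b c : List Letter} {m m' : ℤ} (hm : m ≤ m')
    (ha : ∀ x ∈ a, x.1 < m) (hb : ∀ x ∈ b, m ≤ x.1 ∧ x.1 < m') (hc : ∀ x ∈ c, m' ≤ x.1) :
    opsB.mul (opsB.mul (word a) (word b)) (word c) =
      opsB.mul (word a) (opsB.mul (word b) (word c)) := by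
  rw [mul_word a b m ha fun x hx => (hb x hx).1, mul_word b c m' (fun x hx => (hb x hx).2) hc,
    map_sum, LinearMap.sum_apply, map_sum,
    Finset.sum_congr rfl fun d hd => mul_word d c m' (fun x hx => ?_) hc,
    Finset.sum_congr (s₁ := shuf m' b c) rfl fun d hd => mul_word a d m ha (fun x hx => ?_),
    Finset.sum_sigma', Finset.sum_sigma']
  · have hlo : ∀ l : List Letter, (l.filter (lo m')).filter (lo m) = l.filter (lo m) := fun l => by
      rw [List.filter_filter]
      refine List.filter_congr fun x _ => ?_
      simp only [lo, ← Bool.decide_and, decide_eq_decide]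
      omega
    have hhi : ∀ l : List Letter, (l.filter (hi m)).filter (hi m') = l.filter (hi m') := fun l => by
      rw [List.filter_filter]
      refine List.filter_congr fun x _ => ?_
      simp only [hi, ← Bool.decide_and, decide_eq_decide]
      omega
    have hlh : ∀ l : List Letter,
        (l.filter (hi m)).filter (lo m') = (l.filter (lo m')).filter (hi m) := fun l => by
      rw [List.filter_filter, List.filter_filter]
      refine List.filter_congr fun x _ => ?_
      rw [Bool.and_comm]
    refine Finset.sum_bij' (fun t _ => ⟨t.2.filter (hi m), t.2⟩)
      (fun t _ => ⟨t.2.filter (lo m'), t.2⟩) ?_ ?_ ?_ ?_ ?_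
    · rintro ⟨d, l⟩ h
      simp only [Finset.mem_sigma, mem_shuf] at h ⊢
      obtain ⟨⟨rfl, rfl⟩, rfl, rfl⟩ := h
      exact ⟨⟨hlh _, hhi _⟩, (hlo _).symm, trivial⟩
    · rintro ⟨d, l⟩ h
      simp only [Finset.mem_sigma, mem_shuf] at h ⊢
      obtain ⟨⟨rfl, rfl⟩, rfl, rfl⟩ := h
      exact ⟨⟨hlo _, (hlh _).symm⟩, trivial, (hhi _).symm⟩
    · rintro ⟨d, l⟩ h
      simp only [Finset.mem_sigma, mem_shuf] at h
      simp [h.2.1]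
    · rintro ⟨d, l⟩ h
      simp only [Finset.mem_sigma, mem_shuf] at h
      simp [h.2.2]
    · intros; rfl
  · rcases mem_of_mem_shuf hd hx with h | h
    · exact (hb x h).1
    · exact hm.trans (hc x h)
  · rcases mem_of_mem_shuf hd hx with h | h
    · exact (ha x h).trans_le hm
    · exact (hb x h).2

/-- Filtering commutes with concatenation: to cut a shuffle of `a` and `b` is to cut `a` and `b` and
to shuffle the corresponding pieces. -/
theorem opsB_comul_mul_word {a b : List Letter} {m : ℤ}
    (ha : ∀ x ∈ a, x.1 < m) (hb : ∀ x ∈ b, m ≤ x.1) :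
    opsB.comul (opsB.mul (word a) (word b)) =
      TensorProduct.map₂ opsB.mul opsB.mul (opsB.comul (word a)) (opsB.comul (word b)) := by
  rw [mul_word a b m ha hb, map_sum, comul_word, comul_word]
  simp only [comul_word, map_sum, LinearMap.sum_apply, TensorProduct.map₂_apply_tmul,
    TensorProduct.map_tmul]
  have key : ∀ s ∈ splits a, ∀ r ∈ splits b,
      opsB.mul (word s.1) (word r.1) ⊗ₜ[ℚ] opsB.mul (word s.2) (word r.2) =
      ∑ l ∈ shuf m s.1 r.1 ×ˢ shuf m s.2 r.2, word l.1 ⊗ₜ[ℚ] word l.2 := by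
    intro s hs r hr
    rw [mem_splits] at hs hr
    rw [mul_word s.1 r.1 m, mul_word s.2 r.2 m, TensorProduct.sum_tmul, Finset.sum_product]
    · simp only [TensorProduct.tmul_sum]
    · intro x hx
      exact ha x (by rw [← hs]; simp [hx])
    · intro x hx
      exact hb x (by rw [← hr]; simp [hx])
    · intro x hx
      exact ha x (by rw [← hs]; simp [hx])
    · intro x hx
      exact hb x (by rw [← hr]; simp [hx])
  rw [Finset.sum_comm, Finset.sum_congr rfl fun s hs => Finset.sum_congr rfl fun r hr => key s hs r hr]
  rw [← Finset.sum_product', Finset.sum_sigma', Finset.sum_sigma']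
  refine Finset.sum_bij' (fun t _ => ⟨⟨(t.2.1.filter (lo m), t.2.2.filter (lo m)),
      (t.2.1.filter (hi m), t.2.2.filter (hi m))⟩, t.2⟩)
    (fun t _ => ⟨t.2.1 ++ t.2.2, t.2⟩) ?_ ?_ ?_ ?_ ?_
  · rintro ⟨l, t⟩ h
    simp only [Finset.mem_sigma, Finset.mem_product, mem_shuf, mem_splits] at h ⊢
    obtain ⟨⟨rfl, rfl⟩, rfl⟩ := h
    simp
  · rintro ⟨⟨s, r⟩, t⟩ h
    simp only [Finset.mem_sigma, Finset.mem_product, mem_shuf, mem_splits] at h ⊢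
    obtain ⟨⟨h1, h2⟩, ⟨h3, h4⟩, h5, h6⟩ := h
    simp [h1, h2, h3, h4, h5, h6]
  · rintro ⟨l, t⟩ h
    simp only [Finset.mem_sigma, mem_shuf, mem_splits] at h ⊢
    simp [h.2]
  · rintro ⟨⟨s, r⟩, t⟩ h
    simp only [Finset.mem_sigma, Finset.mem_product, mem_shuf, mem_splits] at h ⊢
    simp [h.2]
  · intros; rfl

/-- Both sides run over the cuts of the word into three pieces. -/
theorem opsB_coassoc_word (l : List Letter) :
    TensorProduct.assoc ℚ _ _ _ (opsB.comul.rTensor _ (opsB.comul (word l))) =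
      opsB.comul.lTensor _ (opsB.comul (word l)) := by
  simp only [comul_word, map_sum, LinearMap.rTensor_tmul, LinearMap.lTensor_tmul,
    TensorProduct.sum_tmul, TensorProduct.tmul_sum, TensorProduct.assoc_tmul]
  rw [Finset.sum_sigma', Finset.sum_sigma']
  refine Finset.sum_bij' (fun t _ => ⟨(t.2.1, t.2.2 ++ t.1.2), (t.2.2, t.1.2)⟩)
    (fun t _ => ⟨(t.1.1 ++ t.2.1, t.2.2), (t.1.1, t.2.1)⟩) ?_ ?_ ?_ ?_ ?_
  · rintro ⟨t, s⟩ h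
    simp only [Finset.mem_sigma, mem_splits] at h ⊢
    rw [← h.1, ← h.2]
    simp
  · rintro ⟨t, s⟩ h
    simp only [Finset.mem_sigma, mem_splits] at h ⊢
    rw [← h.1, ← h.2]
    simp
  · rintro ⟨t, s⟩ h
    simp only [Finset.mem_sigma, mem_splits] at h ⊢
    simp [h.2]
  · rintro ⟨t, s⟩ h
    simp only [Finset.mem_sigma, mem_splits] at h ⊢
    simp [h.2]
  · intros; rfl

theorem counit_word (l : List Letter) : opsB.counit (word l) = if l = [] then 1 else 0 := by
  simp [word, wordFn, opsB]

theorem opsB_isBialgebra : opsB.IsBialgebra where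
  mul_assoc x y z := by
    induction x using induction_elt with
    | h n u =>
      induction y using induction_elt with
      | h p v =>
        induction z using induction_elt with
        | h q w =>
          -- The keys of the three words lie in the consecutive intervals `[0, n)`, `[n, n + p)` and
          -- `[n + p, n + p + q)`.
          obtain ⟨a, ha, -, ha'⟩ := exists_word_eq_elt u 0
          obtain ⟨b, hb, -, hb'⟩ := exists_word_eq_elt v n
          obtain ⟨c, hc, -, hc'⟩ := exists_word_eq_elt w (n + p)
          rw [← ha, ← hb, ← hc]
          exact opsB_mul_assoc_word (m := n) (m' := n + p) (by omega)
            (fun x hx => by simpa using (ha' x hx).2) hb' fun x hx => (hc' x hx).1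
        | h0 => simp
        | hadd x y hx hy => simp [hx, hy]
        | hsmul a x hx => simp [hx]
      | h0 => simp
      | hadd x y hx hy => simp [hx, hy]
      | hsmul a x hx => simp [hx]
    | h0 => simp
    | hadd x y hx hy => simp [hx, hy]
    | hsmul a x hx => simp [hx]
  one_mul x := by
    induction x using induction_elt with
    | h n u =>
      obtain ⟨a, ha, -, ha'⟩ := exists_word_eq_elt u 0
      rw [← ha, ← word_nil, mul_word [] a 0 (by simp) fun x hx => (ha' x hx).1,
        shuf_nil_left fun x hx => (ha' x hx).1, Finset.sum_singleton]
    | h0 => simp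
    | hadd x y hx hy => simp [hx, hy]
    | hsmul a x hx => simp [hx]
  mul_one x := by
    induction x using induction_elt with
    | h n u =>
      obtain ⟨a, ha, -, ha'⟩ := exists_word_eq_elt u 0
      rw [← ha, ← word_nil, mul_word a [] (0 + n) (fun x hx => (ha' x hx).2) (by simp),
        shuf_nil_right fun x hx => (ha' x hx).2, Finset.sum_singleton]
    | h0 => simp
    | hadd x y hx hy => simp [hx, hy]
    | hsmul a x hx => simp [hx]
  coassoc x := by
    induction x using induction_elt with
    | h n u =>
      obtain ⟨a, ha, -⟩ := exists_word_eq_elt u 0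
      rw [← ha, opsB_coassoc_word]
    | h0 => simp
    | hadd x y hx hy => simp only [map_add, hx, hy]
    | hsmul a x hx => simp only [map_smul, hx]
  rTensor_counit x := by
    induction x using induction_elt with
    | h n u =>
      obtain ⟨a, ha, -⟩ := exists_word_eq_elt u 0
      rw [← ha, comul_word, map_sum, Finset.sum_eq_single ([], a)]
      · simp [counit_word]
      · rintro ⟨s, t⟩ h hne
        rw [mem_splits] at h
        have : s ≠ [] := by
          rintro rfl
          exact hne (by simpa using h)
        simp [counit_word, this]
      · simp [mem_splits]
    | h0 => simp
    | hadd x y hx hy => simp only [map_add, hx, hy, TensorProduct.tmul_add]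
    | hsmul a x hx => simp only [map_smul, hx, TensorProduct.tmul_smul]
  lTensor_counit x := by
    induction x using induction_elt with
    | h n u =>
      obtain ⟨a, ha, -⟩ := exists_word_eq_elt u 0
      rw [← ha, comul_word, map_sum, Finset.sum_eq_single (a, [])]
      · simp [counit_word]
      · rintro ⟨s, t⟩ h hne
        rw [mem_splits] at h
        have : t ≠ [] := by
          rintro rfl
          exact hne (by simpa using h)
        simp [counit_word, this]
      · simp [mem_splits]
    | h0 => simp
    | hadd x y hx hy => simp only [map_add, hx, hy, TensorProduct.add_tmul]
    | hsmul a x hx => simp only [map_smul, hx, TensorProduct.smul_tmul']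
  counit_one := by simp [← word_nil, counit_word]
  counit_mul x y := by
    induction x using induction_elt with
    | h n u =>
      induction y using induction_elt with
      | h p v =>
        rw [opsB, externalOps_mul_elt, map_sum]
        simp only [externalOps_counit_elt]
        rcases Nat.eq_zero_or_pos n with rfl | hn
        · rcases Nat.eq_zero_or_pos p with rfl | hp
          · have : shuffles 0 0 = {1} := by
              ext ξ
              have h1 : ξ = 1 := Equiv.ext fun i => i.elim0
              simp only [h1, Finset.mem_singleton, iff_true, mem_shuffles]
              exact ⟨fun i => i.elim0, fun i => i.elim0⟩
            simp [this]
          · simp [hp.ne']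
        · simp [hn.ne']
      | h0 => simp
      | hadd x y hx hy => simp [hx, hy, mul_add]
      | hsmul a x hx => simp [hx]; ring
    | h0 => simp
    | hadd x y hx hy => simp [hx, hy, add_mul]
    | hsmul a x hx => simp [hx]; ring
  comul_one := by
    rw [← word_nil, comul_word]
    rfl
  comul_mul x y := by
    induction x using induction_elt with
    | h n u =>
      induction y using induction_elt with
      | h p v =>
        obtain ⟨a, ha, -, ha'⟩ := exists_word_eq_elt u 0
        obtain ⟨b, hb, -, hb'⟩ := exists_word_eq_elt v n
        rw [← ha, ← hb]
        exact opsB_comul_mul_word (m := n)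
          (fun x hx => by simpa using (ha' x hx).2) fun x hx => (hb' x hx).1
      | h0 => simp
      | hadd x y hx hy => simp only [map_add, hx, hy]
      | hsmul a x hx => simp only [map_smul, hx]
    | h0 => simp
    | hadd x y hx hy => simp only [map_add, LinearMap.add_apply, hx, hy]
    | hsmul a x hx => simp only [map_smul, LinearMap.smul_apply, hx]

end

noncomputable section

/-! ## Antipodes of graded connected bialgebras -/

section Antipode

open Coalgebra WithConv

/-- The part of degree `n` of the tensor square of a graded space. -/
def tensorDeg {A : Type} [AddCommGroup A] [Module ℚ A] (𝒜 : ℕ → Submodule ℚ A) (n : ℕ) :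
    Submodule ℚ (A ⊗[ℚ] A) :=
  ⨆ pq ∈ Finset.HasAntidiagonal.antidiagonal n, LinearMap.range
    (TensorProduct.map (𝒜 pq.1).subtype (𝒜 pq.2).subtype)

theorem tensorDeg_le {A : Type} [AddCommGroup A] [Module ℚ A] {𝒜 : ℕ → Submodule ℚ A} {n : ℕ}
    {N : Submodule ℚ (A ⊗[ℚ] A)}
    (h : ∀ p q, p + q = n → ∀ a ∈ 𝒜 p, ∀ b ∈ 𝒜 q, a ⊗ₜ[ℚ] b ∈ N) : tensorDeg 𝒜 n ≤ N := by
  refine iSup₂_le fun pq hpq => ?_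
  rw [TensorProduct.range_map_eq_span_tmul, Submodule.span_le]
  rintro _ ⟨a, b, rfl⟩
  exact h _ _ (Finset.HasAntidiagonal.mem_antidiagonal.1 hpq) _ a.2 _ b.2

theorem tmul_mem_tensorDeg {A : Type} [AddCommGroup A] [Module ℚ A] {𝒜 : ℕ → Submodule ℚ A}
    {p q n : ℕ} (hn : p + q = n) {a b : A} (ha : a ∈ 𝒜 p) (hb : b ∈ 𝒜 q) :
    a ⊗ₜ[ℚ] b ∈ tensorDeg 𝒜 n := by
  refine Submodule.mem_iSup_of_mem (p, q) (Submodule.mem_iSup_of_mem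
    (Finset.HasAntidiagonal.mem_antidiagonal.2 hn) ?_)
  exact ⟨(⟨a, ha⟩ : 𝒜 p) ⊗ₜ (⟨b, hb⟩ : 𝒜 q), rfl⟩

variable {A : Type} [Ring A] [Bialgebra ℚ A] (𝒜 : ℕ → Submodule ℚ A)

/-- The projection `ηε - id` of a connected bialgebra, up to sign, on the augmentation ideal. -/
def augProj (A : Type) [Ring A] [Bialgebra ℚ A] : WithConv (A →ₗ[ℚ] A) := 1 - toConv LinearMap.id

variable {𝒜}

theorem augProj_eq_zero (h0 : 𝒜 0 ≤ Submodule.span ℚ {1}) {x : A} (hx : x ∈ 𝒜 0) :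
    (augProj A).ofConv x = 0 := by
  obtain ⟨a, rfl⟩ := Submodule.mem_span_singleton.1 (h0 hx)
  simp [augProj, LinearMap.convOne_def, Algebra.smul_def]

/-- In `f * f ^ k`, a tensor of bidegree `(p, q)` is killed by the first factor if `p = 0`;
otherwise `q < n`, so `q < k` and the second factor kills it by induction. -/
theorem augProj_pow_eq_zero (h0 : 𝒜 0 ≤ Submodule.span ℚ {1})
    (hΔ : ∀ n, ∀ x ∈ 𝒜 n, comul (R := ℚ) x ∈ tensorDeg 𝒜 n) (k : ℕ) :
    ∀ n < k, ∀ x ∈ 𝒜 n, (augProj A ^ k).ofConv x = 0 := by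
  induction k with
  | zero => intro n hn; omega
  | succ k ih =>
    intro n hn x hx
    rw [pow_succ', LinearMap.convMul_def]
    have : tensorDeg 𝒜 n ≤ LinearMap.ker (LinearMap.mul' ℚ A ∘ₗ
        TensorProduct.map (augProj A).ofConv (augProj A ^ k).ofConv) := by
      refine tensorDeg_le fun p q hpq a ha b hb => ?_
      rw [LinearMap.mem_ker]
      rcases Nat.eq_zero_or_pos p with rfl | hp
      · simp [augProj_eq_zero h0 ha]
      · simp [ih q (by omega) b hb]
    exact this (hΔ n x hx)

theorem augProj_mem (h1 : (1 : A) ∈ 𝒜 0) (hε : ∀ n, n ≠ 0 → ∀ x ∈ 𝒜 n, counit (R := ℚ) x = 0)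
    {n : ℕ} {x : A} (hx : x ∈ 𝒜 n) : (augProj A).ofConv x ∈ 𝒜 n := by
  have : (augProj A).ofConv x = counit (R := ℚ) x • (1 : A) - x := by
    simp [augProj, LinearMap.convOne_def, Algebra.smul_def]
  rw [this]
  refine sub_mem ?_ hx
  rcases Nat.eq_zero_or_pos n with rfl | hn
  · exact Submodule.smul_mem _ _ h1
  · rw [hε n hn.ne' x hx, zero_smul]
    exact zero_mem _

theorem augProj_pow_mem [SetLike.GradedMonoid 𝒜]
    (hε : ∀ n, n ≠ 0 → ∀ x ∈ 𝒜 n, counit (R := ℚ) x = 0)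
    (hΔ : ∀ n, ∀ x ∈ 𝒜 n, comul (R := ℚ) x ∈ tensorDeg 𝒜 n) (k : ℕ) :
    ∀ n, ∀ x ∈ 𝒜 n, (augProj A ^ k).ofConv x ∈ 𝒜 n := by
  have h1 : (1 : A) ∈ 𝒜 0 := SetLike.GradedOne.one_mem
  induction k with
  | zero =>
    intro n x hx
    have : (augProj A ^ 0).ofConv x = counit (R := ℚ) x • (1 : A) := by
      simp [LinearMap.convOne_def, Algebra.smul_def]
    rw [this]
    rcases Nat.eq_zero_or_pos n with rfl | hn
    · exact Submodule.smul_mem _ _ h1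
    · rw [hε n hn.ne' x hx, zero_smul]
      exact zero_mem _
  | succ k ih =>
    intro n x hx
    rw [pow_succ', LinearMap.convMul_def]
    have : tensorDeg 𝒜 n ≤ (𝒜 n).comap (LinearMap.mul' ℚ A ∘ₗ
        TensorProduct.map (augProj A).ofConv (augProj A ^ k).ofConv) := by
      refine tensorDeg_le fun p q hpq a ha b hb => ?_
      subst hpq
      simpa using SetLike.mul_mem_graded (augProj_mem h1 hε ha) (ih q b hb)
    exact this (hΔ n x hx)

theorem linearMap_ext_of_isInternal {M : Type} [AddCommGroup M] [Module ℚ M]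
    (hint : DirectSum.IsInternal 𝒜) {f g : A →ₗ[ℚ] M} (h : ∀ n, ∀ x ∈ 𝒜 n, f x = g x) : f = g := by
  rw [← sub_eq_zero, ← LinearMap.ker_eq_top, eq_top_iff, ← hint.submodule_iSup_eq_top]
  refine iSup_le fun n x hx => ?_
  simp [h n x hx]

/-- A graded connected bialgebra has an antipode, which respects the degrees. -/
theorem exists_antipode [SetLike.GradedMonoid 𝒜] (hint : DirectSum.IsInternal 𝒜)
    (h0 : 𝒜 0 ≤ Submodule.span ℚ {1})
    (hε : ∀ n, n ≠ 0 → ∀ x ∈ 𝒜 n, counit (R := ℚ) x = 0)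
    (hΔ : ∀ n, ∀ x ∈ 𝒜 n, comul (R := ℚ) x ∈ tensorDeg 𝒜 n) :
    ∃ S : A →ₗ[ℚ] A,
      LinearMap.mul' ℚ A ∘ₗ S.rTensor A ∘ₗ comul = Algebra.linearMap ℚ A ∘ₗ counit ∧
      LinearMap.mul' ℚ A ∘ₗ S.lTensor A ∘ₗ comul = Algebra.linearMap ℚ A ∘ₗ counit ∧
      ∀ n, ∀ x ∈ 𝒜 n, S x ∈ 𝒜 n := by
  let f := augProj A
  -- As `id = 1 - f` in the convolution algebra, its inverse should be the sum of the powers of `f`.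
  -- In degree `n` those beyond `f ^ n` vanish, so the partial sum `g n` suffices there.
  let g : ℕ → WithConv (A →ₗ[ℚ] A) := fun n => ∑ k ∈ Finset.range (n + 1), f ^ k
  have gapp : ∀ n x, (g n).ofConv x = ∑ k ∈ Finset.range (n + 1), (f ^ k).ofConv x := by
    intro n x
    change (WithConv.linearEquiv ℚ (A →ₗ[ℚ] A) (g n)) x = _
    simp only [g, map_sum, LinearMap.sum_apply]
    rfl
  have gstab : ∀ n m, n ≤ m → ∀ x ∈ 𝒜 n, (g m).ofConv x = (g n).ofConv x := by
    intro n m hnm x hx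
    rw [gapp, gapp]
    symm
    apply Finset.sum_subset (Finset.range_mono (by omega))
    intro k _ hk
    simp only [Finset.mem_range, not_lt] at hk
    exact augProj_pow_eq_zero h0 hΔ k n (by omega) x hx
  let e := LinearEquiv.ofBijective (DirectSum.coeLinearMap 𝒜) hint
  let S : A →ₗ[ℚ] A :=
    (DirectSum.toModule ℚ ℕ A fun n => (g n).ofConv ∘ₗ (𝒜 n).subtype) ∘ₗ e.symm.toLinearMap
  have hS : ∀ n, ∀ x ∈ 𝒜 n, S x = (g n).ofConv x := by
    intro n x hx
    have : e.symm x = DirectSum.lof ℚ ℕ (fun n => 𝒜 n) n ⟨x, hx⟩ := by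
      rw [LinearEquiv.symm_apply_eq]
      exact (DirectSum.coeLinearMap_lof 𝒜 n ⟨x, hx⟩).symm
    simp [S, this]
  refine ⟨S, ?_, ?_, ?_⟩
  · refine linearMap_ext_of_isInternal hint fun n x hx => ?_
    -- On tensors of total degree `n`, the first factor has degree at most `n`, where `S` agrees
    -- with the single map `g n`. This reduces the antipode identity to a convolution product.
    have h1 : tensorDeg 𝒜 n ≤ LinearMap.ker (LinearMap.mul' ℚ A ∘ₗ S.rTensor A -
        LinearMap.mul' ℚ A ∘ₗ TensorProduct.map (g n).ofConv LinearMap.id) := by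
      refine tensorDeg_le fun p q hpq a ha b hb => ?_
      simp [hS p a ha, gstab p n (by omega) a ha]
    have h2 := h1 (hΔ n x hx)
    rw [LinearMap.mem_ker, LinearMap.sub_apply, sub_eq_zero] at h2
    have h3 : g n * toConv LinearMap.id = 1 - f ^ (n + 1) := by
      rw [← geom_sum_mul_neg f (n + 1)]
      simp [f, augProj, g]
    have h4 := congrArg (fun z => (WithConv.linearEquiv ℚ (A →ₗ[ℚ] A) z) x) h3
    simp only [map_sub, LinearMap.sub_apply] at h4
    refine h2.trans (h4.trans ?_)
    change _ - (f ^ (n + 1)).ofConv x = _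
    rw [augProj_pow_eq_zero h0 hΔ (n + 1) n (by omega) x hx, sub_zero]
    rfl
  · refine linearMap_ext_of_isInternal hint fun n x hx => ?_
    have h1 : tensorDeg 𝒜 n ≤ LinearMap.ker (LinearMap.mul' ℚ A ∘ₗ S.lTensor A -
        LinearMap.mul' ℚ A ∘ₗ TensorProduct.map LinearMap.id (g n).ofConv) := by
      refine tensorDeg_le fun p q hpq a ha b hb => ?_
      simp [hS q b hb, gstab q n (by omega) b hb]
    have h2 := h1 (hΔ n x hx)
    rw [LinearMap.mem_ker, LinearMap.sub_apply, sub_eq_zero] at h2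
    have h3 : toConv LinearMap.id * g n = 1 - f ^ (n + 1) := by
      rw [← mul_neg_geom_sum f (n + 1)]
      simp [f, augProj, g]
    have h4 := congrArg (fun z => (WithConv.linearEquiv ℚ (A →ₗ[ℚ] A) z) x) h3
    simp only [map_sub, LinearMap.sub_apply] at h4
    refine h2.trans (h4.trans ?_)
    change _ - (f ^ (n + 1)).ofConv x = _
    rw [augProj_pow_eq_zero h0 hΔ (n + 1) n (by omega) x hx, sub_zero]
    rfl
  · intro n x hx
    rw [hS n x hx, gapp]
    exact sum_mem fun k _ => augProj_pow_mem hε hΔ k n x hx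

/-- Morphisms of bialgebras commute with antipodes. -/
theorem bialgHom_map_antipode {H K : Type} [Ring H] [Ring K] [HopfAlgebra ℚ H] [HopfAlgebra ℚ K]
    (f : H →ₐc[ℚ] K) (x : H) :
    f (HopfAlgebra.antipode ℚ x) = HopfAlgebra.antipode ℚ (f x) := by
  let fl : H →ₗ[ℚ] K := (f : H →ₐ[ℚ] K).toLinearMap
  -- `f ∘ S` is a left and `S ∘ f` a right inverse of `f` under convolution, so they coincide.
  have h1 : toConv (fl ∘ₗ HopfAlgebra.antipode ℚ) * toConv fl = 1 := by
    have := LinearMap.algHom_comp_convMul_distrib (f : H →ₐ[ℚ] K)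
      (toConv (HopfAlgebra.antipode ℚ (A := H))) (toConv LinearMap.id)
    rw [LinearMap.antipode_mul_id] at this
    apply WithConv.ofConv_injective
    refine this.symm.trans ?_
    ext x
    exact (f : H →ₐ[ℚ] K).commutes (Coalgebra.counit x)
  have h2 : toConv fl * toConv (HopfAlgebra.antipode ℚ ∘ₗ fl) = 1 := by
    have := LinearMap.convMul_comp_coalgHom_distrib (toConv LinearMap.id)
      (toConv (HopfAlgebra.antipode ℚ (A := K))) (f : H →ₗc[ℚ] K)
    rw [LinearMap.id_mul_antipode] at this
    apply WithConv.ofConv_injective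
    refine this.symm.trans ?_
    ext x
    simp [LinearMap.convOne_def]
  have h3 := left_inv_eq_right_inv h1 h2
  exact LinearMap.congr_fun (WithConv.toConv_injective h3) x

end Antipode
end

noncomputable section

/-! ## Graded Hopf algebras inside a graded bialgebra -/

/-- The subspaces `S n` form a graded connected subbialgebra of the graded bialgebra `V` with
structure maps `O`. -/
structure IsGradedSub {V : Type} [AddCommGroup V] [Module ℚ V] (O : HopfOps V)
    (S : ℕ → Submodule ℚ V) : Prop where
  bialgebra : O.IsBialgebra
  indep : iSupIndep O.deg
  counit_deg : ∀ n, n ≠ 0 → ∀ x ∈ O.deg n, O.counit x = 0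
  le_deg : ∀ n, S n ≤ O.deg n
  one_mem : O.one ∈ S 0
  zero_le : S 0 ≤ Submodule.span ℚ {O.one}
  mul_mem : ∀ m n, ∀ x ∈ S m, ∀ y ∈ S n, O.mul x y ∈ S (m + n)
  comul_mem : ∀ n, ∀ x ∈ S n, O.comul x ∈ tensorDeg S n

namespace IsGradedSub

variable {V : Type} [AddCommGroup V] [Module ℚ V] {O : HopfOps V} {S : ℕ → Submodule ℚ V}

/-- The underlying space of a graded subbialgebra. -/
def Carrier (_ : IsGradedSub O S) : Type := ↥(⨆ n, S n)

variable (h : IsGradedSub O S)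

instance : AddCommGroup h.Carrier := inferInstanceAs (AddCommGroup ↥(⨆ n, S n))
instance : Module ℚ h.Carrier := inferInstanceAs (Module ℚ ↥(⨆ n, S n))

/-- The inclusion of a graded subbialgebra. -/
def incl : h.Carrier →ₗ[ℚ] V := (⨆ n, S n).subtype

theorem incl_injective : Function.Injective h.incl := Subtype.val_injective

theorem range_incl : LinearMap.range h.incl = ⨆ n, S n := Submodule.range_subtype _

theorem incl_mem (x : h.Carrier) : h.incl x ∈ ⨆ n, S n := x.2

include h in
theorem mul_mem_iSup {x y : V} (hx : x ∈ ⨆ n, S n) (hy : y ∈ ⨆ n, S n) :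
    O.mul x y ∈ ⨆ n, S n := by
  have h1 : (⨆ n, S n) ≤ (⨆ n, S n).comap (O.mul.flip y) := by
    refine iSup_le fun m x hx => ?_
    have h2 : (⨆ n, S n) ≤ (⨆ n, S n).comap (O.mul x) :=
      iSup_le fun n y hy => Submodule.mem_iSup_of_mem (m + n) (h.mul_mem m n x hx y hy)
    exact h2 hy
  exact h1 hx

instance : Mul h.Carrier := ⟨fun x y => ⟨O.mul x.1 y.1, h.mul_mem_iSup x.2 y.2⟩⟩
instance : One h.Carrier := ⟨⟨O.one, Submodule.mem_iSup_of_mem 0 h.one_mem⟩⟩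

theorem incl_mul (x y : h.Carrier) : h.incl (x * y) = O.mul (h.incl x) (h.incl y) := rfl
theorem incl_one : h.incl 1 = O.one := rfl

instance : Ring h.Carrier :=
  { (inferInstance : AddCommGroup h.Carrier), (inferInstance : Mul h.Carrier),
    (inferInstance : One h.Carrier) with
    mul_assoc := fun x y z => h.incl_injective <| by
      simp only [incl_mul, h.bialgebra.mul_assoc]
    one_mul := fun x => h.incl_injective <| by simp only [incl_mul, incl_one, h.bialgebra.one_mul]
    mul_one := fun x => h.incl_injective <| by simp only [incl_mul, incl_one, h.bialgebra.mul_one]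
    zero_mul := fun x => h.incl_injective <| by simp [incl_mul]
    mul_zero := fun x => h.incl_injective <| by simp [incl_mul]
    left_distrib := fun x y z => h.incl_injective <| by simp [incl_mul]
    right_distrib := fun x y z => h.incl_injective <| by simp [incl_mul]
    zsmul := (inferInstance : AddCommGroup h.Carrier).zsmul }

instance : Algebra ℚ h.Carrier :=
  Algebra.ofModule (fun r x y => h.incl_injective <| by simp [incl_mul])
    (fun r x y => h.incl_injective <| by simp [incl_mul])

/-- The square of the inclusion. -/
def inclSq : h.Carrier ⊗[ℚ] h.Carrier →ₗ[ℚ] V ⊗[ℚ] V := TensorProduct.map h.incl h.incl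

/-- Everything is flat over `ℚ`. This injectivity is what allows the coproduct of `V` to be pulled
back to the subspace. -/
theorem inclSq_injective : Function.Injective h.inclSq :=
  TensorProduct.map_injective_of_flat_flat _ _ h.incl_injective h.incl_injective

/-- The part of degree `n` of a graded subbialgebra. -/
def part (n : ℕ) : Submodule ℚ h.Carrier := (O.deg n).comap h.incl

theorem iSup_comap : ⨆ n, (S n).comap h.incl = ⊤ := by
  refine Submodule.map_injective_of_injective h.incl_injective ?_
  rw [Submodule.map_iSup, Submodule.map_top, range_incl]
  refine iSup_congr fun n => ?_
  rw [Submodule.map_comap_eq, range_incl, inf_eq_right]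
  exact le_iSup S n

theorem iSupIndep_part : iSupIndep h.part := by
  intro n
  rw [Submodule.disjoint_def]
  intro x hx hx'
  have h1 := Submodule.disjoint_def.1 (h.indep n) (h.incl x) hx
  have h2 : ⨆ m, ⨆ (_ : m ≠ n), h.part m ≤ (⨆ m, ⨆ (_ : m ≠ n), O.deg m).comap h.incl :=
    iSup₂_le fun m hm => Submodule.comap_mono (le_iSup₂_of_le m hm le_rfl)
  exact h.incl_injective ((h1 (h2 hx')).trans (map_zero _).symm)

/-- An element of the sum that has degree `n` differs from its component in `S n` by terms of other
degrees; by independence of the degrees that difference vanishes. -/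
theorem part_eq (n : ℕ) : h.part n = (S n).comap h.incl := by
  refine le_antisymm (fun x hx => ?_) (Submodule.comap_mono (h.le_deg n))
  have hx' : x ∈ (S n).comap h.incl ⊔ ⨆ m, ⨆ (_ : m ≠ n), (S m).comap h.incl := by
    have : x ∈ ⨆ n, (S n).comap h.incl := by rw [h.iSup_comap]; trivial
    revert this
    refine fun hx => (?_ : (⨆ n, (S n).comap h.incl) ≤ _) hx
    refine iSup_le fun m => ?_
    by_cases hm : m = n
    · subst hm
      exact le_sup_left
    · exact le_sup_of_le_right (le_iSup₂_of_le m hm le_rfl)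
  obtain ⟨y, hy, z, hz, rfl⟩ := Submodule.mem_sup.1 hx'
  have hy' : y ∈ h.part n := Submodule.comap_mono (h.le_deg n) hy
  have hz1 : z ∈ h.part n := by simpa using sub_mem hx hy'
  have hz2 : z ∈ ⨆ m, ⨆ (_ : m ≠ n), h.part m :=
    (iSup₂_mono fun m _ => Submodule.comap_mono (h.le_deg m) : _ ≤ _) hz
  rw [Submodule.disjoint_def.1 (h.iSupIndep_part n) z hz1 hz2, add_zero]
  exact hy

theorem isInternal_part : DirectSum.IsInternal h.part := by
  rw [DirectSum.isInternal_submodule_iff_iSupIndep_and_iSup_eq_top]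
  refine ⟨h.iSupIndep_part, ?_⟩
  rw [funext h.part_eq, h.iSup_comap]

theorem tensorDeg_le_map (n : ℕ) : tensorDeg S n ≤ (tensorDeg h.part n).map h.inclSq := by
  refine tensorDeg_le fun p q hpq a ha b hb => ?_
  have ha' : a ∈ ⨆ n, S n := Submodule.mem_iSup_of_mem p ha
  have hb' : b ∈ ⨆ n, S n := Submodule.mem_iSup_of_mem q hb
  let a' : h.Carrier := ⟨a, ha'⟩
  let b' : h.Carrier := ⟨b, hb'⟩
  exact ⟨a' ⊗ₜ b', tmul_mem_tensorDeg hpq (h.le_deg p ha) (h.le_deg q hb), rfl⟩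

theorem comul_incl_mem (x : h.Carrier) : O.comul (h.incl x) ∈ LinearMap.range h.inclSq := by
  have : (⨆ n, (S n).comap h.incl) ≤ (LinearMap.range h.inclSq).comap (O.comul ∘ₗ h.incl) :=
    iSup_le fun n x hx => LinearMap.map_le_range (h.tensorDeg_le_map n (h.comul_mem n _ hx))
  rw [iSup_comap] at this
  exact this trivial

instance : CoalgebraStruct ℚ h.Carrier where
  comul := (LinearEquiv.ofInjective h.inclSq h.inclSq_injective).symm.toLinearMap ∘ₗ
    (O.comul ∘ₗ h.incl).codRestrict _ h.comul_incl_mem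
  counit := O.counit ∘ₗ h.incl

theorem inclSq_comul (x : h.Carrier) :
    h.inclSq (Coalgebra.comul (R := ℚ) x) = O.comul (h.incl x) :=
  congrArg Subtype.val ((LinearEquiv.ofInjective h.inclSq h.inclSq_injective).apply_symm_apply
    ⟨O.comul (h.incl x), h.comul_incl_mem x⟩)

theorem counit_apply (x : h.Carrier) : Coalgebra.counit (R := ℚ) x = O.counit (h.incl x) := rfl

/-- Together with `map_lTensor_comul`, it moves coassociativity to `V ⊗ V ⊗ V`, into which the
triple tensor product of the carrier injects. -/
theorem map_assoc_rTensor_comul (z : h.Carrier ⊗[ℚ] h.Carrier) :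
    TensorProduct.map h.incl h.inclSq (TensorProduct.assoc ℚ _ _ _
      ((Coalgebra.comul (R := ℚ)).rTensor _ z)) =
    TensorProduct.assoc ℚ _ _ _ (O.comul.rTensor _ (h.inclSq z)) := by
  induction z with
  | zero => simp
  | add x y hx hy => simp only [map_add, hx, hy]
  | tmul a b =>
    rw [inclSq, LinearMap.rTensor_tmul, TensorProduct.map_tmul, LinearMap.rTensor_tmul,
      ← h.inclSq_comul]
    generalize (Coalgebra.comul (R := ℚ)) a = y
    induction y with
    | zero => simp
    | add x y hx hy => simp only [map_add, TensorProduct.add_tmul, hx, hy]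
    | tmul c d => simp [inclSq]

theorem map_lTensor_comul (z : h.Carrier ⊗[ℚ] h.Carrier) :
    TensorProduct.map h.incl h.inclSq ((Coalgebra.comul (R := ℚ)).lTensor _ z) =
      O.comul.lTensor _ (h.inclSq z) := by
  induction z with
  | zero => simp
  | add x y hx hy => simp only [map_add, hx, hy]
  | tmul a b => simp [inclSq]; rw [← inclSq, h.inclSq_comul]

instance : Coalgebra ℚ h.Carrier where
  coassoc := by
    ext x
    refine TensorProduct.map_injective_of_flat_flat _ _ h.incl_injective h.inclSq_injective ?_
    simp only [LinearMap.comp_apply, LinearEquiv.coe_coe]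
    rw [map_assoc_rTensor_comul, map_lTensor_comul, inclSq_comul, h.bialgebra.coassoc]
  rTensor_counit_comp_comul := by
    ext x
    have : Function.Injective (h.incl.lTensor ℚ) :=
      Module.Flat.lTensor_preserves_injective_linearMap _ h.incl_injective
    apply this
    have key : ∀ z : h.Carrier ⊗[ℚ] h.Carrier, h.incl.lTensor ℚ
        ((Coalgebra.counit (R := ℚ)).rTensor _ z) = O.counit.rTensor _ (h.inclSq z) := by
      intro z
      induction z with
      | zero => simp
      | add x y hx hy => simp only [map_add, hx, hy]
      | tmul a b => simp [inclSq, counit_apply]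
    rw [LinearMap.comp_apply, key, inclSq_comul, h.bialgebra.rTensor_counit]
    rfl
  lTensor_counit_comp_comul := by
    ext x
    have : Function.Injective (h.incl.rTensor ℚ) :=
      Module.Flat.rTensor_preserves_injective_linearMap _ h.incl_injective
    apply this
    have key : ∀ z : h.Carrier ⊗[ℚ] h.Carrier, h.incl.rTensor ℚ
        ((Coalgebra.counit (R := ℚ)).lTensor _ z) = O.counit.lTensor _ (h.inclSq z) := by
      intro z
      induction z with
      | zero => simp
      | add x y hx hy => simp only [map_add, hx, hy]
      | tmul a b => simp [inclSq, counit_apply]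
    rw [LinearMap.comp_apply, key, inclSq_comul, h.bialgebra.lTensor_counit]
    rfl

theorem inclSq_mul (z w : h.Carrier ⊗[ℚ] h.Carrier) :
    h.inclSq (z * w) = TensorProduct.map₂ O.mul O.mul (h.inclSq z) (h.inclSq w) := by
  induction z with
  | zero => simp
  | add x y hx hy => simp only [add_mul, map_add, LinearMap.add_apply, hx, hy]
  | tmul a b =>
    induction w with
    | zero => simp
    | add x y hx hy => simp only [mul_add, map_add, hx, hy]
    | tmul c d => simp [inclSq, incl_mul]

instance : Bialgebra ℚ h.Carrier :=
  Bialgebra.mk' ℚ h.Carrier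
    (by change O.counit (h.incl 1) = 1; rw [incl_one, h.bialgebra.counit_one])
    (fun {a b} => by
      change O.counit (h.incl (a * b)) = _
      rw [incl_mul, h.bialgebra.counit_mul]
      rfl)
    (h.inclSq_injective <| by
      rw [inclSq_comul, incl_one, h.bialgebra.comul_one, Algebra.TensorProduct.one_def, inclSq,
        TensorProduct.map_tmul, incl_one])
    (fun {a b} => h.inclSq_injective <| by
      rw [inclSq_comul, incl_mul, h.bialgebra.comul_mul, inclSq_mul, inclSq_comul, inclSq_comul])

instance : SetLike.GradedMonoid h.part where
  one_mem := h.le_deg 0 h.one_mem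
  mul_mem m n x y hx hy := by
    rw [part_eq] at hx hy ⊢
    exact h.mul_mem m n _ hx _ hy

theorem part_zero_le : h.part 0 ≤ Submodule.span ℚ {1} := by
  rw [part_eq]
  intro x hx
  obtain ⟨a, ha⟩ := Submodule.mem_span_singleton.1 (h.zero_le hx)
  refine Submodule.mem_span_singleton.2 ⟨a, h.incl_injective ?_⟩
  rw [map_smul, incl_one, ha]

theorem counit_part (n : ℕ) (hn : n ≠ 0) (x : h.Carrier) (hx : x ∈ h.part n) :
    Coalgebra.counit (R := ℚ) x = 0 := h.counit_deg n hn _ hx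

theorem comul_part (n : ℕ) (x : h.Carrier) (hx : x ∈ h.part n) :
    Coalgebra.comul (R := ℚ) x ∈ tensorDeg h.part n := by
  rw [part_eq] at hx
  obtain ⟨z, hz, hzx⟩ := h.tensorDeg_le_map n (h.comul_mem n _ hx)
  rw [← inclSq_comul] at hzx
  rwa [← h.inclSq_injective hzx]

instance : HopfAlgebra ℚ h.Carrier where
  antipode := (exists_antipode h.isInternal_part h.part_zero_le h.counit_part h.comul_part).choose
  mul_antipode_rTensor_comul :=
    (exists_antipode h.isInternal_part h.part_zero_le h.counit_part h.comul_part).choose_spec.1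
  mul_antipode_lTensor_comul :=
    (exists_antipode h.isInternal_part h.part_zero_le h.counit_part h.comul_part).choose_spec.2.1

/-- A graded connected subbialgebra is a graded Hopf algebra. -/
def gradedHopfOn : GradedHopfOn O (⨆ n, S n) where
  carrier := h.Carrier
  incl := h.incl
  incl_injective := h.incl_injective
  range_incl := h.range_incl
  incl_one := rfl
  incl_mul _ _ := rfl
  counit_incl _ := rfl
  comul_incl x := (h.inclSq_comul x).symm
  graded_internal := h.isInternal_part
  graded_mul := inferInstanceAs (SetLike.GradedMonoid h.part)
  graded_counit := h.counit_part
  graded_comul := h.comul_part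
  graded_antipode := (exists_antipode h.isInternal_part h.part_zero_le h.counit_part
    h.comul_part).choose_spec.2.2

end IsGradedSub

section Morphism

variable {V : Type} [AddCommGroup V] [Module ℚ V] {O : HopfOps V} {S T : ℕ → Submodule ℚ V}

/-- A linear map that respects degrees, units, products and coproducts is a morphism of graded
Hopf algebras. -/
theorem IsGradedSub.isGradedHopfMorphism (hS : IsGradedSub O S) (hT : IsGradedSub O T)
    (θ : V →ₗ[ℚ] V) (hST : ∀ n, ∀ x ∈ S n, θ x ∈ T n) (h1 : θ O.one = O.one)
    (hmul : ∀ x ∈ ⨆ n, S n, ∀ y ∈ ⨆ n, S n, θ (O.mul x y) = O.mul (θ x) (θ y))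
    (hΔ : ∀ x ∈ ⨆ n, S n, O.comul (θ x) = TensorProduct.map θ θ (O.comul x)) :
    IsGradedHopfMorphism O (⨆ n, S n) (⨆ n, T n) θ := by
  have hST' : ∀ x ∈ ⨆ n, S n, θ x ∈ ⨆ n, T n := by
    have : (⨆ n, S n) ≤ (⨆ n, T n).comap θ :=
      iSup_le fun n x hx => Submodule.mem_iSup_of_mem n (hST n x hx)
    exact fun x hx => this hx
  -- Compatibility with counits is automatic: degree 0 is spanned by the unit, and both counits
  -- vanish in positive degree.
  have hε : ∀ x ∈ ⨆ n, S n, O.counit (θ x) = O.counit x := by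
    have : (⨆ n, S n) ≤ LinearMap.ker (O.counit ∘ₗ θ - O.counit) := by
      refine iSup_le fun n x hx => ?_
      rw [LinearMap.mem_ker, LinearMap.sub_apply, LinearMap.comp_apply]
      rcases Nat.eq_zero_or_pos n with rfl | hn
      · obtain ⟨a, rfl⟩ := Submodule.mem_span_singleton.1 (hS.zero_le hx)
        simp [h1]
      · rw [hS.counit_deg n hn.ne' x (hS.le_deg n hx),
          hT.counit_deg n hn.ne' _ (hT.le_deg n (hST n x hx)), sub_zero]
    intro x hx
    have := this hx
    rwa [LinearMap.mem_ker, LinearMap.sub_apply, sub_eq_zero] at this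
  let fl : hS.Carrier →ₗ[ℚ] hT.Carrier :=
    (θ ∘ₗ hS.incl).codRestrict (⨆ n, T n) fun x => hST' _ (hS.incl_mem x)
  have hfl : ∀ x, hT.incl (fl x) = θ (hS.incl x) := fun _ => rfl
  let fa : hS.Carrier →ₐ[ℚ] hT.Carrier := AlgHom.ofLinearMap fl
    (hT.incl_injective (by rw [hfl, hS.incl_one, h1, hT.incl_one]))
    (fun x y => hT.incl_injective (by
      rw [hfl, hS.incl_mul, hT.incl_mul, hfl, hfl, hmul _ (hS.incl_mem x) _ (hS.incl_mem y)]))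
  have hfa : ∀ x, hT.incl (fa x) = θ (hS.incl x) := fun _ => rfl
  let f : hS.Carrier →ₐc[ℚ] hT.Carrier := BialgHom.ofAlgHom fa
    (by
      ext x
      exact hε _ (hS.incl_mem x))
    (by
      ext x
      apply hT.inclSq_injective
      change hT.inclSq (TensorProduct.map fl fl (Coalgebra.comul (R := ℚ) x)) =
        hT.inclSq (Coalgebra.comul (R := ℚ) (fa x))
      rw [hT.inclSq_comul, hfa, hΔ _ (hS.incl_mem x), ← hS.inclSq_comul]
      generalize (Coalgebra.comul (R := ℚ)) x = z
      induction z with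
      | zero => simp
      | add x y hx hy => simp only [map_add, hx, hy]
      | tmul a b => simp [IsGradedSub.inclSq, hfl])
  refine ⟨hS.gradedHopfOn, hT.gradedHopfOn, f, fun _ => rfl, bialgHom_map_antipode f, ?_⟩
  intro n x hx
  have hx' : x ∈ hS.part n := hx
  rw [hS.part_eq] at hx'
  exact hT.le_deg n (hST n _ hx')

end Morphism
end

noncomputable section

/-! ## Subbialgebras generated by sequences of divided powers -/

/-- The structure maps `O` respect the degrees. -/
structure HopfOps.IsGraded {V : Type} [AddCommGroup V] [Module ℚ V] (O : HopfOps V) : Prop where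
  indep : iSupIndep O.deg
  counit_deg : ∀ n, n ≠ 0 → ∀ x ∈ O.deg n, O.counit x = 0
  one_mem : O.one ∈ O.deg 0
  mul_mem : ∀ m n, ∀ x ∈ O.deg m, ∀ y ∈ O.deg n, O.mul x y ∈ O.deg (m + n)

namespace HopfOps

variable {V : Type} [AddCommGroup V] [Module ℚ V] (O : HopfOps V) {K : Type}

/-- The products of the members of a family. -/
def monomial (g : K → ℕ → V) : List (K × ℕ) → V
  | [] => O.one
  | k :: l => O.mul (g k.1 k.2) (monomial g l)

/-- The part of degree `n` of the subalgebra generated by a family. -/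
def monSpan (g : K → ℕ → V) (n : ℕ) : Submodule ℚ V :=
  Submodule.span ℚ {x | ∃ l : List (K × ℕ), (l.map Prod.snd).sum = n ∧ x = O.monomial g l}

/-- A family of sequences of divided powers. -/
structure IsDivided (g : K → ℕ → V) : Prop where
  mem_deg : ∀ k n, g k n ∈ O.deg n
  zero : ∀ k, g k 0 = O.one
  comul : ∀ k n, O.comul (g k n) =
    ∑ pq ∈ Finset.HasAntidiagonal.antidiagonal n, g k pq.1 ⊗ₜ[ℚ] g k pq.2

variable {O} {g : K → ℕ → V}

theorem monomial_append (hO : O.IsBialgebra) (l l' : List (K × ℕ)) :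
    O.monomial g (l ++ l') = O.mul (O.monomial g l) (O.monomial g l') := by
  induction l with
  | nil => simp [monomial, hO.one_mul]
  | cons k l ih => simp [monomial, ih, hO.mul_assoc]

theorem monomial_mem (g : K → ℕ → V) (l : List (K × ℕ)) :
    O.monomial g l ∈ O.monSpan g (l.map Prod.snd).sum :=
  Submodule.subset_span ⟨l, rfl, rfl⟩

theorem one_mem_monSpan (g : K → ℕ → V) : O.one ∈ O.monSpan g 0 := monomial_mem g []

theorem gen_mem_monSpan (hO : O.IsBialgebra) (g : K → ℕ → V) (k : K) (n : ℕ) :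
    g k n ∈ O.monSpan g n := by
  have := monomial_mem (O := O) g [(k, n)]
  simpa [monomial, hO.mul_one] using this

theorem mul_mem_monSpan (hO : O.IsBialgebra) {m n : ℕ} {x y : V} (hx : x ∈ O.monSpan g m)
    (hy : y ∈ O.monSpan g n) : O.mul x y ∈ O.monSpan g (m + n) := by
  induction hx using Submodule.span_induction with
  | zero => simp
  | add x x' _ _ hx hx' => simpa using add_mem hx hx'
  | smul a x _ hx => simpa using Submodule.smul_mem _ a hx
  | mem x hx =>
    obtain ⟨l, rfl, rfl⟩ := hx
    induction hy using Submodule.span_induction with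
    | zero => simp
    | add x x' _ _ hx hx' => simpa using add_mem hx hx'
    | smul a x _ hx => simpa using Submodule.smul_mem _ a hx
    | mem y hy =>
      obtain ⟨l', rfl, rfl⟩ := hy
      rw [← monomial_append hO]
      have := monomial_mem (O := O) g (l ++ l')
      simpa using this

theorem map₂_mem_tensorDeg {S : ℕ → Submodule ℚ V}
    (hS : ∀ m n, ∀ x ∈ S m, ∀ y ∈ S n, O.mul x y ∈ S (m + n)) {m n : ℕ} {z w : V ⊗[ℚ] V}
    (hz : z ∈ tensorDeg S m) (hw : w ∈ tensorDeg S n) :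
    TensorProduct.map₂ O.mul O.mul z w ∈ tensorDeg S (m + n) := by
  have h1 : tensorDeg S m ≤
      (tensorDeg S (m + n)).comap ((TensorProduct.map₂ O.mul O.mul).flip w) := by
    refine tensorDeg_le fun p q hpq a ha b hb => ?_
    have h2 : tensorDeg S n ≤
        (tensorDeg S (m + n)).comap (TensorProduct.map₂ O.mul O.mul (a ⊗ₜ[ℚ] b)) := by
      refine tensorDeg_le fun p' q' hpq' a' ha' b' hb' => ?_
      exact tmul_mem_tensorDeg (p := p + p') (q := q + q') (by omega)
        (hS _ _ a ha a' ha') (hS _ _ b hb b' hb')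
    exact h2 hw
  exact h1 hz

/-- The coproduct is multiplicative, so it stays in the tensor square on monomials once it does on
the generators. A monomial of degree 0 only has factors `g k 0`, equal to the unit, which gives
connectedness. -/
theorem IsDivided.isGradedSub (hO : O.IsBialgebra) (hdeg : O.IsGraded) (hg : O.IsDivided g) :
    IsGradedSub O (O.monSpan g) where
  bialgebra := hO
  indep := hdeg.indep
  counit_deg := hdeg.counit_deg
  le_deg n := by
    refine Submodule.span_le.2 ?_
    rintro _ ⟨l, rfl, rfl⟩
    induction l with
    | nil => exact hdeg.one_mem
    | cons k l ih => exact hdeg.mul_mem _ _ _ (hg.mem_deg _ _) _ ih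
  one_mem := one_mem_monSpan g
  zero_le := by
    refine Submodule.span_le.2 ?_
    rintro _ ⟨l, hl, rfl⟩
    have : O.monomial g l = O.one := by
      induction l with
      | nil => rfl
      | cons k l ih =>
        simp only [List.map_cons, List.sum_cons, Nat.add_eq_zero_iff] at hl
        rw [monomial, ih hl.2, hl.1, hg.zero, hO.mul_one]
    rw [this]
    exact Submodule.mem_span_singleton_self _
  mul_mem m n x hx y hy := mul_mem_monSpan hO hx hy
  comul_mem n x hx := by
    induction hx using Submodule.span_induction with
    | zero => simp
    | add x x' _ _ hx hx' => simpa using add_mem hx hx'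
    | smul a x _ hx => simpa using Submodule.smul_mem _ a hx
    | mem x hx =>
      obtain ⟨l, rfl, rfl⟩ := hx
      induction l with
      | nil =>
        rw [monomial, hO.comul_one]
        change _ ∈ tensorDeg (O.monSpan g) 0
        exact tmul_mem_tensorDeg (p := 0) (q := 0) rfl (one_mem_monSpan g) (one_mem_monSpan g)
      | cons k l ih =>
        rw [monomial, hO.comul_mul]
        refine map₂_mem_tensorDeg (fun m n x hx y hy => mul_mem_monSpan hO hx hy) ?_ ih
        rw [hg.comul]
        refine sum_mem fun pq hpq => ?_
        exact tmul_mem_tensorDeg (Finset.HasAntidiagonal.mem_antidiagonal.1 hpq)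
          (gen_mem_monSpan hO g _ _) (gen_mem_monSpan hO g _ _)

theorem map_mem_monSpan (hO : O.IsBialgebra) {K' : Type} {g' : K' → ℕ → V} {θ : V →ₗ[ℚ] V}
    (h1 : θ O.one = O.one) (hmul : ∀ x y, θ (O.mul x y) = O.mul (θ x) (θ y))
    (hg : ∀ k n, θ (g k n) ∈ O.monSpan g' n) {n : ℕ} {x : V} (hx : x ∈ O.monSpan g n) :
    θ x ∈ O.monSpan g' n := by
  induction hx using Submodule.span_induction with
  | zero => simp
  | add x x' _ _ hx hx' => simpa using add_mem hx hx'
  | smul a x _ hx => simpa using Submodule.smul_mem _ a hx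
  | mem x hx =>
    obtain ⟨l, rfl, rfl⟩ := hx
    induction l with
    | nil =>
      rw [monomial, h1]
      exact one_mem_monSpan g'
    | cons k l ih =>
      rw [monomial, hmul]
      exact mul_mem_monSpan hO (hg _ _) ih

theorem map_map₂_mul {θ : V →ₗ[ℚ] V} (hmul : ∀ x y, θ (O.mul x y) = O.mul (θ x) (θ y))
    (z w : V ⊗[ℚ] V) :
    TensorProduct.map θ θ (TensorProduct.map₂ O.mul O.mul z w) =
      TensorProduct.map₂ O.mul O.mul (TensorProduct.map θ θ z) (TensorProduct.map θ θ w) := by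
  induction z with
  | zero => simp
  | add x y hx hy => simp only [map_add, LinearMap.add_apply, hx, hy]
  | tmul a b =>
    induction w with
    | zero => simp
    | add x y hx hy => simp only [map_add, hx, hy]
    | tmul c d => simp [hmul]

/-- A morphism of algebras that sends sequences of divided powers to sequences of divided powers
is a morphism of the graded Hopf algebras that they generate. -/
theorem isGradedHopfMorphism (hO : O.IsBialgebra) (hdeg : O.IsGraded) {K' : Type}
    {g' : K' → ℕ → V} (hg : O.IsDivided g) (hg' : O.IsDivided g') {θ : V →ₗ[ℚ] V}
    (h1 : θ O.one = O.one) (hmul : ∀ x y, θ (O.mul x y) = O.mul (θ x) (θ y))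
    (hmem : ∀ k n, θ (g k n) ∈ O.monSpan g' n) (hθ : O.IsDivided fun k n => θ (g k n)) :
    IsGradedHopfMorphism O (⨆ n, O.monSpan g n) (⨆ n, O.monSpan g' n) θ := by
  refine (hg.isGradedSub hO hdeg).isGradedHopfMorphism (hg'.isGradedSub hO hdeg) θ
    (fun n x hx => map_mem_monSpan hO h1 hmul hmem hx) h1 (fun x _ y _ => hmul x y) ?_
  -- Both `Δ ∘ θ` and `(θ ⊗ θ) ∘ Δ` are multiplicative, and they agree on the generators because `g`
  -- and its image under `θ` consist of divided powers.
  have : (⨆ n, O.monSpan g n) ≤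
      LinearMap.ker (O.comul ∘ₗ θ - TensorProduct.map θ θ ∘ₗ O.comul) := by
    refine iSup_le fun n => Submodule.span_le.2 ?_
    rintro _ ⟨l, -, rfl⟩
    rw [SetLike.mem_coe, LinearMap.mem_ker, LinearMap.sub_apply, sub_eq_zero]
    induction l with
    | nil => simp [monomial, h1, hO.comul_one]
    | cons k l ih =>
      simp only [LinearMap.comp_apply] at ih ⊢
      rw [monomial, hmul, hO.comul_mul, hO.comul_mul, map_map₂_mul hmul, ih, hθ.comul, hg.comul]
      simp
  intro x hx
  have := this hx
  rwa [LinearMap.mem_ker, LinearMap.sub_apply, sub_eq_zero] at this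

end HopfOps

/-! ## Forgetting signs -/

open TotalAlg

section Graded

variable {G : ℕ → Type} [∀ n, Group (G n)] [∀ n, Fintype (G n)]
  {emb : ∀ n, SymPerm n → G n} {prod : ∀ p q, G p → G q → G (p + q)}

theorem elt_mem_deg {n : ℕ} (w : G n) : elt w ∈ (externalOps G emb prod).deg n := ⟨_, rfl⟩

theorem deg_le_iff {n : ℕ} {N : Submodule ℚ (TotalAlg G)} :
    (externalOps G emb prod).deg n ≤ N ↔ ∀ w : G n, elt w ∈ N := by
  refine ⟨fun h w => h (elt_mem_deg w), fun h => ?_⟩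
  rintro _ ⟨x, rfl⟩
  have : N.mkQ ∘ₗ DirectSum.lof ℚ ℕ (fun n => MonoidAlgebra ℚ (G n)) n = 0 := by
    ext w
    simpa [elt] using h w
  simpa using LinearMap.congr_fun this x

theorem externalOps_isGraded : (externalOps G emb prod).IsGraded where
  indep n := by
    rw [Submodule.disjoint_def]
    rintro _ ⟨a, rfl⟩ hx
    have h1 : ⨆ m, ⨆ (_ : m ≠ n), (externalOps G emb prod).deg m ≤
        LinearMap.ker (DirectSum.component ℚ ℕ (fun n => MonoidAlgebra ℚ (G n)) n) := by
      refine iSup₂_le fun m hm => ?_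
      rintro _ ⟨b, rfl⟩
      rw [LinearMap.mem_ker, DirectSum.component.of, dif_neg hm]
    have h2 := h1 hx
    rw [LinearMap.mem_ker, DirectSum.component.lof_self] at h2
    rw [h2, map_zero]
  counit_deg n hn := by
    have : (externalOps G emb prod).deg n ≤ LinearMap.ker (externalOps G emb prod).counit :=
      deg_le_iff.2 fun w => by simp [hn]
    exact fun x hx => this hx
  one_mem := elt_mem_deg _
  mul_mem m n x hx y hy := by
    have h1 : (externalOps G emb prod).deg m ≤ ((externalOps G emb prod).deg (m + n)).comap
        ((externalOps G emb prod).mul.flip y) := by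
      refine deg_le_iff.2 fun u => ?_
      have h2 : (externalOps G emb prod).deg n ≤ ((externalOps G emb prod).deg (m + n)).comap
          ((externalOps G emb prod).mul (elt u)) := by
        refine deg_le_iff.2 fun v => ?_
        rw [Submodule.mem_comap, externalOps_mul_elt]
        exact sum_mem fun ξ _ => elt_mem_deg _
      exact h2 hy
    exact h1 hx

theorem classElt_mem_deg {n : ℕ} (P : G n → Prop) :
    classElt P ∈ (externalOps G emb prod).deg n := by
  classical
  exact sum_mem fun w _ => elt_mem_deg w

end Graded

/-- The linear map from `ℚB` to `ℚS` that forgets signs. -/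
def forgetSigns : TotalAlg SignedPerm →ₗ[ℚ] TotalAlg SymPerm :=
  TotalAlg.lift fun _ w => elt w.perm

@[simp] theorem forgetSigns_elt {n : ℕ} (w : SignedPerm n) :
    forgetSigns (elt w) = (elt w.perm : TotalAlg SymPerm) := by
  simp [forgetSigns]

theorem forgetSigns_surjective : Function.Surjective forgetSigns := by
  intro x
  induction x using induction_elt with
  | h n u => exact ⟨elt (SignedPerm.ofPerm u), by simp⟩
  | h0 => exact ⟨0, map_zero _⟩
  | hadd x y hx hy =>
    obtain ⟨a, rfl⟩ := hx
    obtain ⟨b, rfl⟩ := hy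
    exact ⟨a + b, map_add _ _ _⟩
  | hsmul a x hx =>
    obtain ⟨b, rfl⟩ := hx
    exact ⟨a • b, map_smul _ _ _⟩

theorem forgetSigns_one : forgetSigns opsB.one = opsA.one := forgetSigns_elt _

theorem forgetSigns_mul (x y : TotalAlg SignedPerm) :
    forgetSigns (opsB.mul x y) = opsA.mul (forgetSigns x) (forgetSigns y) := by
  induction x using induction_elt with
  | h n u =>
    induction y using induction_elt with
    | h p v => simp [opsA, opsB, externalOps_mul_elt]
    | h0 => simp
    | hadd x y hx hy => simp [hx, hy]
    | hsmul a x hx => simp [hx]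
  | h0 => simp
  | hadd x y hx hy => simp [hx, hy]
  | hsmul a x hx => simp [hx]

theorem forgetSigns_counit (x : TotalAlg SignedPerm) :
    opsA.counit (forgetSigns x) = opsB.counit x := by
  induction x using induction_elt with
  | h n u => simp [opsA, opsB]
  | h0 => simp
  | hadd x y hx hy => simp [hx, hy]
  | hsmul a x hx => simp [hx]

/-- Forgetting the signs in the factorization of `w` gives that of its underlying permutation, with
the same shuffle, so the unique terms in each bidegree correspond. -/
theorem forgetSigns_comul (x : TotalAlg SignedPerm) :
    TensorProduct.map forgetSigns forgetSigns (opsB.comul x) = opsA.comul (forgetSigns x) := by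
  induction x using induction_elt with
  | h n w =>
    rw [forgetSigns_elt, opsA, opsB, externalOps_comul_elt, externalOps_comul_elt, map_sum]
    refine Finset.sum_congr rfl ?_
    rintro ⟨p, q⟩ hpq
    obtain rfl := Finset.HasAntidiagonal.mem_antidiagonal.1 hpq
    obtain ⟨u, v, ξ, hξ, rfl⟩ := isExternal_signedPerm.exists_eq_prod_mul_inv w
    rw [isExternal_signedPerm.comulTerm_eq u v hξ, TensorProduct.map_tmul, forgetSigns_elt,
      forgetSigns_elt]
    exact (isExternal_symPerm.comulTerm_eq u.perm v.perm hξ).symm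
  | h0 => simp
  | hadd x y hx hy => simp only [map_add, hx, hy]
  | hsmul a x hx => simp only [map_smul, hx]

/-- `forgetSigns` is surjective and respects all structure maps, so each law is the image of the
corresponding law for `ℚB`. -/
theorem opsA_isBialgebra : opsA.IsBialgebra where
  mul_assoc x y z := by
    obtain ⟨x, rfl⟩ := forgetSigns_surjective x
    obtain ⟨y, rfl⟩ := forgetSigns_surjective y
    obtain ⟨z, rfl⟩ := forgetSigns_surjective z
    simp only [← forgetSigns_mul, opsB_isBialgebra.mul_assoc]
  one_mul x := by
    obtain ⟨x, rfl⟩ := forgetSigns_surjective x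
    rw [← forgetSigns_one, ← forgetSigns_mul, opsB_isBialgebra.one_mul]
  mul_one x := by
    obtain ⟨x, rfl⟩ := forgetSigns_surjective x
    rw [← forgetSigns_one, ← forgetSigns_mul, opsB_isBialgebra.mul_one]
  coassoc x := by
    obtain ⟨x, rfl⟩ := forgetSigns_surjective x
    have h1 : ∀ z, opsA.comul.lTensor _ (TensorProduct.map forgetSigns forgetSigns z) =
        TensorProduct.map forgetSigns (TensorProduct.map forgetSigns forgetSigns)
          (opsB.comul.lTensor _ z) := by
      intro z
      induction z with
      | zero => simp
      | add x y hx hy => simp only [map_add, hx, hy]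
      | tmul a b => simp [forgetSigns_comul]
    have h2 : ∀ z, opsA.comul.rTensor _ (TensorProduct.map forgetSigns forgetSigns z) =
        TensorProduct.map (TensorProduct.map forgetSigns forgetSigns) forgetSigns
          (opsB.comul.rTensor _ z) := by
      intro z
      induction z with
      | zero => simp
      | add x y hx hy => simp only [map_add, hx, hy]
      | tmul a b => simp [forgetSigns_comul]
    have h3 : ∀ z, TensorProduct.assoc ℚ _ _ _
        (TensorProduct.map (TensorProduct.map forgetSigns forgetSigns) forgetSigns z) =
        TensorProduct.map forgetSigns (TensorProduct.map forgetSigns forgetSigns)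
          (TensorProduct.assoc ℚ _ _ _ z) := by
      intro z
      rw [TensorProduct.map_map_assoc]
    rw [← forgetSigns_comul, h1, h2, h3, opsB_isBialgebra.coassoc]
  rTensor_counit x := by
    obtain ⟨x, rfl⟩ := forgetSigns_surjective x
    have h1 : ∀ z, opsA.counit.rTensor _ (TensorProduct.map forgetSigns forgetSigns z) =
        forgetSigns.lTensor _ (opsB.counit.rTensor _ z) := by
      intro z
      induction z with
      | zero => simp
      | add x y hx hy => simp only [map_add, hx, hy]
      | tmul a b => simp [forgetSigns_counit]
    rw [← forgetSigns_comul, h1, opsB_isBialgebra.rTensor_counit, LinearMap.lTensor_tmul]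
  lTensor_counit x := by
    obtain ⟨x, rfl⟩ := forgetSigns_surjective x
    have h1 : ∀ z, opsA.counit.lTensor _ (TensorProduct.map forgetSigns forgetSigns z) =
        forgetSigns.rTensor _ (opsB.counit.lTensor _ z) := by
      intro z
      induction z with
      | zero => simp
      | add x y hx hy => simp only [map_add, hx, hy]
      | tmul a b => simp [forgetSigns_counit]
    rw [← forgetSigns_comul, h1, opsB_isBialgebra.lTensor_counit, LinearMap.rTensor_tmul]
  counit_one := by
    rw [← forgetSigns_one, forgetSigns_counit, opsB_isBialgebra.counit_one]
  counit_mul x y := by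
    obtain ⟨x, rfl⟩ := forgetSigns_surjective x
    obtain ⟨y, rfl⟩ := forgetSigns_surjective y
    simp only [← forgetSigns_mul, forgetSigns_counit, opsB_isBialgebra.counit_mul]
  comul_one := by
    rw [← forgetSigns_one, ← forgetSigns_comul, opsB_isBialgebra.comul_one, TensorProduct.map_tmul]
  comul_mul x y := by
    obtain ⟨x, rfl⟩ := forgetSigns_surjective x
    obtain ⟨y, rfl⟩ := forgetSigns_surjective y
    have h1 : ∀ z w, TensorProduct.map forgetSigns forgetSigns
        (TensorProduct.map₂ opsB.mul opsB.mul z w) =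
        TensorProduct.map₂ opsA.mul opsA.mul (TensorProduct.map forgetSigns forgetSigns z)
          (TensorProduct.map forgetSigns forgetSigns w) := by
      intro z w
      induction z with
      | zero => simp
      | add x y hx hy => simp only [map_add, LinearMap.add_apply, hx, hy]
      | tmul a b =>
        induction w with
        | zero => simp
        | add x y hx hy => simp only [map_add, hx, hy]
        | tmul c d => simp [forgetSigns_mul]
    rw [← forgetSigns_mul, ← forgetSigns_comul, opsB_isBialgebra.comul_mul, h1, forgetSigns_comul,
      forgetSigns_comul]

theorem HopfOps.IsDivided.forgetSigns {K : Type} {g : K → ℕ → TotalAlg SignedPerm}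
    (hg : opsB.IsDivided g) : opsA.IsDivided fun k n => forgetSigns (g k n) where
  mem_deg k n := by
    have : opsB.deg n ≤ (opsA.deg n).comap _root_.forgetSigns := by
      refine deg_le_iff.2 fun w => ?_
      rw [Submodule.mem_comap, forgetSigns_elt]
      exact elt_mem_deg _
    exact this (hg.mem_deg k n)
  zero k := by rw [hg.zero, forgetSigns_one]
  comul k n := by
    rw [← forgetSigns_comul, hg.comul, map_sum]
    simp

end

noncomputable section

/-! ## Entries of shuffles -/

theorem exists_fin_succ {n i : ℕ} (h1 : 1 ≤ i) (h2 : i ≤ n) : ∃ k : Fin n, i = k + 1 :=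
  ⟨⟨i - 1, by omega⟩, by simp; omega⟩

namespace SignedPerm

theorem entry_succ {n : ℕ} (w : SignedPerm n) (i : Fin n) :
    w.entry (i + 1) = w.sign i * ((w.perm i : ℕ) + 1) := by
  have : 1 ≤ (i : ℕ) + 1 ∧ (i : ℕ) + 1 ≤ n := ⟨by omega, i.2⟩
  simp [entry, this]

theorem sign_entry_succ {n : ℕ} (w : SignedPerm n) (i : Fin n) :
    (w.entry (i + 1)).sign = w.sign i := by
  have h : (0 : ℤ) < (w.perm i : ℕ) + 1 := by omega
  rw [entry_succ, Int.sign_mul, Int.sign_eq_one_of_pos h]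
  rcases Int.units_eq_one_or (w.sign i) with h | h <;> simp [h]

theorem abs_entry_succ {n : ℕ} (w : SignedPerm n) (i : Fin n) :
    |w.entry (i + 1)| = (w.perm i : ℕ) + 1 := by
  have h : (0 : ℤ) ≤ (w.perm i : ℕ) + 1 := by omega
  rw [entry_succ, abs_mul, abs_of_nonneg h]
  rcases Int.units_eq_one_or (w.sign i) with h | h <;> simp [h]

/-- A relabelling of the absolute values that keeps their order does not affect comparisons of
signed symbols; the `+ 1` makes the symbols nonzero. -/
theorem sign_mul_lt_sign_mul_iff {a b a' b' : ℕ} (h1 : a < b ↔ a' < b') (h2 : b < a ↔ b' < a')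
    (s t : ℤˣ) : (s : ℤ) * (a + 1) < t * (b + 1) ↔ (s : ℤ) * (a' + 1) < t * (b' + 1) := by
  rcases Int.units_eq_one_or s with rfl | rfl <;> rcases Int.units_eq_one_or t with rfl | rfl <;>
    simp <;> omega

variable {p q : ℕ} {ξ : SymPerm (p + q)} (u : SignedPerm p) (v : SignedPerm q)

theorem entry_shuffle_left (ξ : SymPerm (p + q)) (i : Fin p) :
    (ofPerm ξ * prod u v).entry (i + 1) =
      u.sign i * ((ξ (Fin.castAdd q (u.perm i)) : ℕ) + 1) := by
  have := (ofPerm ξ * prod u v).entry_succ (Fin.castAdd q i)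
  simpa using this

theorem entry_shuffle_right (ξ : SymPerm (p + q)) (j : Fin q) :
    (ofPerm ξ * prod u v).entry (p + (j + 1)) =
      v.sign j * ((ξ (Fin.natAdd p (v.perm j)) : ℕ) + 1) := by
  have := (ofPerm ξ * prod u v).entry_succ (Fin.natAdd p j)
  simpa [add_assoc] using this

theorem entry_shuffle_lt_left (hξ : ξ ∈ shuffles p q) {i j : ℕ} (hi : 1 ≤ i) (hip : i ≤ p)
    (hj : 1 ≤ j) (hjp : j ≤ p) :
    (ofPerm ξ * prod u v).entry i < (ofPerm ξ * prod u v).entry j ↔ u.entry i < u.entry j := by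
  obtain ⟨i, rfl⟩ := exists_fin_succ hi hip
  obtain ⟨j, rfl⟩ := exists_fin_succ hj hjp
  rw [entry_shuffle_left, entry_shuffle_left, entry_succ, entry_succ]
  exact sign_mul_lt_sign_mul_iff (mem_shuffles.1 hξ).1.lt_iff_lt (mem_shuffles.1 hξ).1.lt_iff_lt _ _

theorem entry_shuffle_lt_right (hξ : ξ ∈ shuffles p q) {i j : ℕ} (hi : 1 ≤ i) (hiq : i ≤ q)
    (hj : 1 ≤ j) (hjq : j ≤ q) :
    (ofPerm ξ * prod u v).entry (p + i) < (ofPerm ξ * prod u v).entry (p + j) ↔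
      v.entry i < v.entry j := by
  obtain ⟨i, rfl⟩ := exists_fin_succ hi hiq
  obtain ⟨j, rfl⟩ := exists_fin_succ hj hjq
  rw [entry_shuffle_right, entry_shuffle_right, entry_succ, entry_succ]
  exact sign_mul_lt_sign_mul_iff (mem_shuffles.1 hξ).2.lt_iff_lt (mem_shuffles.1 hξ).2.lt_iff_lt _ _

end SignedPerm

namespace SymPerm

theorem entry_eq {n : ℕ} (w : SymPerm n) (i : ℕ) :
    (entry w i : ℤ) = (SignedPerm.ofPerm w).entry i := by
  rw [entry, SignedPerm.entry]
  split_ifs <;> simp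

variable {p q : ℕ} {ξ : SymPerm (p + q)} (u : SymPerm p) (v : SymPerm q)

theorem ofPerm_prod : SignedPerm.ofPerm (prod u v) =
    SignedPerm.prod (SignedPerm.ofPerm u) (SignedPerm.ofPerm v) := by
  apply SignedPerm.ext
  · rfl
  · ext k
    refine Fin.addCases (fun i => ?_) (fun j => ?_) k <;> simp

theorem entry_shuffle_lt_left (hξ : ξ ∈ shuffles p q) {i j : ℕ} (hi : 1 ≤ i) (hip : i ≤ p)
    (hj : 1 ≤ j) (hjp : j ≤ p) :
    entry (ξ * prod u v) i < entry (ξ * prod u v) j ↔ entry u i < entry u j := by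
  zify
  simp only [entry_eq, SignedPerm.ofPerm_mul, ofPerm_prod]
  exact SignedPerm.entry_shuffle_lt_left _ _ hξ hi hip hj hjp

theorem entry_shuffle_lt_right (hξ : ξ ∈ shuffles p q) {i j : ℕ} (hi : 1 ≤ i) (hiq : i ≤ q)
    (hj : 1 ≤ j) (hjq : j ≤ q) :
    entry (ξ * prod u v) (p + i) < entry (ξ * prod u v) (p + j) ↔ entry v i < entry v j := by
  zify
  simp only [entry_eq, SignedPerm.ofPerm_mul, ofPerm_prod]
  exact SignedPerm.entry_shuffle_lt_right _ _ hξ hi hiq hj hjq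

theorem entry_succ {n : ℕ} (w : SymPerm n) (i : Fin n) : entry w (i + 1) = (w i : ℕ) + 1 := by
  have : 1 ≤ (i : ℕ) + 1 ∧ (i : ℕ) + 1 ≤ n := ⟨by omega, i.2⟩
  simp [entry, this]

end SymPerm

/-! ## Descent classes -/

section DescentClass

open TotalAlg

variable {G : ℕ → Type} [∀ n, Group (G n)] [∀ n, Fintype (G n)]
  {emb : ∀ n, SymPerm n → G n} {prod : ∀ p q, G p → G q → G (p + q)}

/-- A notion of descent that is compatible with the embeddings `G p × G q → G (p + q)` and with
shuffles. -/
structure IsDescentStat (emb : ∀ n, SymPerm n → G n) (prod : ∀ p q, G p → G q → G (p + q))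
    (D : ∀ n, G n → ℕ → Prop) : Prop where
  left : ∀ p q, ∀ ξ ∈ shuffles p q, ∀ u v i, 1 ≤ i → i < p →
    (D (p + q) (emb (p + q) ξ * prod p q u v) i ↔ D p u i)
  right : ∀ p q, ∀ ξ ∈ shuffles p q, ∀ u v i, 1 ≤ i → i < q →
    (D (p + q) (emb (p + q) ξ * prod p q u v) (p + i) ↔ D q v i)

/-- The sum of the elements with descents contained in `J`. -/
def sumDesSubset (D : ∀ n, G n → ℕ → Prop) (n : ℕ) (J : Finset ℕ) : TotalAlg G :=
  classElt fun w : G n => ∀ i, 1 ≤ i → i < n → D n w i → i ∈ J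

/-- The sum of the elements with set of descents `J`. -/
def sumDesEq (D : ∀ n, G n → ℕ → Prop) (n : ℕ) (J : Finset ℕ) : TotalAlg G :=
  classElt fun w : G n => ∀ i, 1 ≤ i → i < n → (D n w i ↔ i ∈ J)

variable {D : ∀ n, G n → ℕ → Prop}

/-- Shuffles preserve the descents inside each block, and nothing is imposed at the junction `p`,
which therefore joins the set of allowed descents. -/
theorem mul_sumDesSubset (hG : IsExternal G emb prod) (hD : IsDescentStat emb prod D) (p q : ℕ)
    (J : Finset ℕ) :
    (externalOps G emb prod).mul (sumDesSubset D p ∅) (sumDesSubset D q J) =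
      sumDesSubset D (p + q) (insert p (J.map (addLeftEmbedding p))) := by
  refine hG.mul_classElt _ _ _ fun ξ hξ u v => ⟨fun h => ⟨fun i h1 h2 h3 => ?_,
    fun i h1 h2 h3 => ?_⟩, fun h i h1 h2 h3 => ?_⟩
  · have := h i h1 (by omega) ((hD.left p q ξ hξ u v i h1 h2).2 h3)
    simp only [Finset.mem_insert, Finset.mem_map, addLeftEmbedding_apply] at this
    omega
  · have := h (p + i) (by omega) (by omega) ((hD.right p q ξ hξ u v i h1 h2).2 h3)
    simp only [Finset.mem_insert, Finset.mem_map, addLeftEmbedding_apply, add_right_inj,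
      exists_eq_right] at this
    rcases this with h | h
    · omega
    · exact h
  · rcases lt_trichotomy i p with hip | rfl | hip
    · have := h.1 i h1 hip ((hD.left p q ξ hξ u v i h1 hip).1 h3)
      simp at this
    · simp
    · obtain ⟨j, rfl⟩ := Nat.exists_eq_add_of_lt hip
      rw [show p + j + 1 = p + (j + 1) by ring] at *
      have := h.2 (j + 1) (by omega) (by omega)
        ((hD.right p q ξ hξ u v _ (by omega) (by omega)).1 h3)
      simp [this]

theorem sumDesSubset_congr {n : ℕ} {J K : Finset ℕ}
    (h : ∀ i, 1 ≤ i → i < n → (i ∈ J ↔ i ∈ K)) : sumDesSubset D n J = sumDesSubset D n K :=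
  classElt_congr fun _ => forall_congr' fun i =>
    ⟨fun hw h1 h2 h3 => (h i h1 h2).1 (hw h1 h2 h3), fun hw h1 h2 h3 => (h i h1 h2).2 (hw h1 h2 h3)⟩

/-- The generators of the algebra of sums over descent classes. -/
def desGen (D : ∀ n, G n → ℕ → Prop) (_ : Unit) (n : ℕ) : TotalAlg G := sumDesSubset D n ∅

/-- This reads `mul_sumDesSubset` backwards: the least element `p` of `J` in `[1, n)` splits off a
generator of degree `p`, and the rest of `J`, shifted by `p`, has smaller degree. -/
theorem sumDesSubset_mem_monSpan (hG : IsExternal G emb prod) (hD : IsDescentStat emb prod D)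
    (hO : (externalOps G emb prod).IsBialgebra) (n : ℕ) :
    ∀ J : Finset ℕ, sumDesSubset D n J ∈ (externalOps G emb prod).monSpan (desGen D) n := by
  induction n using Nat.strong_induction_on with
  | _ n ih =>
    intro J
    by_cases hJ : ∃ i, 1 ≤ i ∧ i < n ∧ i ∈ J
    · classical
      obtain ⟨p, ⟨h1, h2, h3⟩, hp⟩ : ∃ p, (1 ≤ p ∧ p < n ∧ p ∈ J) ∧
          ∀ i < p, ¬ (1 ≤ i ∧ i < n ∧ i ∈ J) :=
        ⟨Nat.find hJ, Nat.find_spec hJ, fun i hi => Nat.find_min hJ hi⟩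
      have hmin : ∀ i, 1 ≤ i → i < p → i ∉ J := fun i hi1 hi2 hi3 =>
        hp i hi2 ⟨hi1, by omega, hi3⟩
      obtain ⟨q, rfl⟩ : ∃ q, n = p + (q + 1) := ⟨n - p - 1, by omega⟩
      have key := mul_sumDesSubset hG hD p (q + 1)
        ((Finset.range (q + 1)).filter fun j => p + j ∈ J)
      have hrw : sumDesSubset D (p + (q + 1)) J = sumDesSubset D (p + (q + 1)) (insert p
          (((Finset.range (q + 1)).filter fun j => p + j ∈ J).map (addLeftEmbedding p))) := by
        refine sumDesSubset_congr fun i hi1 hi2 => ?_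
        simp only [Finset.mem_insert, Finset.mem_map, Finset.mem_filter, Finset.mem_range,
          addLeftEmbedding_apply]
        constructor
        · intro hi
          have : p ≤ i := not_lt.1 fun h => hmin i hi1 h hi
          exact Or.inr ⟨i - p, ⟨by omega, by rwa [Nat.add_sub_cancel' this]⟩, by omega⟩
        · rintro (rfl | ⟨j, ⟨-, hj⟩, rfl⟩)
          · exact h3
          · exact hj
      rw [hrw, ← key]
      exact HopfOps.mul_mem_monSpan hO (HopfOps.gen_mem_monSpan hO (desGen D) () p)
        (ih _ (by omega) _)
    · push Not at hJ
      rw [sumDesSubset_congr (K := ∅) fun i h1 h2 => by simp [hJ i h1 h2]]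
      exact HopfOps.gen_mem_monSpan hO (desGen D) () n

theorem monSpan_desGen (hG : IsExternal G emb prod) (hD : IsDescentStat emb prod D)
    (hO : (externalOps G emb prod).IsBialgebra)
    (h1 : (externalOps G emb prod).one = sumDesSubset D 0 ∅) (n : ℕ) :
    (externalOps G emb prod).monSpan (desGen D) n =
      Submodule.span ℚ {x | ∃ J ⊆ Finset.Ico 1 n, x = sumDesSubset D n J} := by
  apply le_antisymm
  · refine Submodule.span_le.2 ?_
    rintro _ ⟨l, rfl, rfl⟩
    have : ∃ J, (externalOps G emb prod).monomial (desGen D) l =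
        sumDesSubset D (l.map Prod.snd).sum J := by
      induction l with
      | nil => exact ⟨∅, h1⟩
      | cons k l ih =>
        obtain ⟨J, hJ⟩ := ih
        refine ⟨insert k.2 (J.map (addLeftEmbedding k.2)), ?_⟩
        rw [HopfOps.monomial, hJ]
        exact mul_sumDesSubset hG hD _ _ J
    obtain ⟨J, hJ⟩ := this
    rw [hJ]
    -- The set `J` may contain 0 or the total degree, which come from generators of degree 0 and
    -- from the last factor; these positions impose nothing and are discarded.
    refine Submodule.subset_span ⟨J.filter (· ∈ Finset.Ico 1 (l.map Prod.snd).sum), ?_, ?_⟩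
    · intro i hi
      exact (Finset.mem_filter.1 hi).2
    · refine sumDesSubset_congr fun i h1 h2 => ?_
      simp [h1, h2]
  · refine Submodule.span_le.2 ?_
    rintro _ ⟨J, -, rfl⟩
    exact sumDesSubset_mem_monSpan hG hD hO n J

theorem sumDesSubset_eq_sum {n : ℕ} {J : Finset ℕ} (hJ : J ⊆ Finset.Ico 1 n) :
    sumDesSubset D n J = ∑ K ∈ J.powerset, sumDesEq D n K := by
  classical
  simp only [sumDesSubset, sumDesEq, classElt]
  rw [← Finset.sum_biUnion]
  · refine Finset.sum_congr ?_ fun _ _ => rfl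
    ext w
    simp only [Finset.mem_filter, Finset.mem_univ, true_and, Finset.mem_biUnion,
      Finset.mem_powerset]
    constructor
    · intro h
      refine ⟨J.filter fun i => D n w i, Finset.filter_subset _ _, fun i h1 h2 => ?_⟩
      rw [Finset.mem_filter]
      exact ⟨fun h3 => ⟨h i h1 h2 h3, h3⟩, fun h3 => h3.2⟩
    · rintro ⟨K, hK, h⟩ i h1 h2 h3
      exact hK ((h i h1 h2).1 h3)
  · intro K hK L hL hne
    rw [Function.onFun, Finset.disjoint_left]
    intro w h1 h2
    simp only [Finset.mem_filter, Finset.mem_univ, true_and] at h1 h2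
    refine hne (Finset.ext fun i => ?_)
    simp only [Finset.coe_powerset, Set.mem_preimage, Set.mem_powerset_iff, Finset.coe_subset] at hK hL
    constructor
    · intro hi
      have := Finset.mem_Ico.1 (hJ (hK hi))
      exact (h2 i this.1 this.2).1 ((h1 i this.1 this.2).2 hi)
    · intro hi
      have := Finset.mem_Ico.1 (hJ (hL hi))
      exact (h1 i this.1 this.2).1 ((h2 i this.1 this.2).2 hi)

/-- The passage between prescribed and bounded descent sets is triangular for inclusion. -/
theorem sumDesEq_mem_span {n : ℕ} (J : Finset ℕ) :
    J ⊆ Finset.Ico 1 n → sumDesEq D n J ∈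
      Submodule.span ℚ {x | ∃ J ⊆ Finset.Ico 1 n, x = sumDesSubset D n J} := by
  induction J using Finset.strongInduction with
  | H J ih =>
    intro hJ
    have h := sumDesSubset_eq_sum (D := D) hJ
    rw [← Finset.insert_erase (Finset.mem_powerset_self J), Finset.sum_insert (by simp)] at h
    rw [← sub_eq_iff_eq_add] at h
    rw [← h]
    refine sub_mem (Submodule.subset_span ⟨J, hJ, rfl⟩) (sum_mem fun K hK => ?_)
    rw [Finset.mem_erase, Finset.mem_powerset] at hK
    exact ih K (hK.2.ssubset_of_ne hK.1) (hK.2.trans hJ)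

theorem span_sumDesEq (n : ℕ) :
    Submodule.span ℚ {x | ∃ J ⊆ Finset.Ico 1 n, x = sumDesEq D n J} =
      Submodule.span ℚ {x | ∃ J ⊆ Finset.Ico 1 n, x = sumDesSubset D n J} := by
  apply le_antisymm
  · refine Submodule.span_le.2 ?_
    rintro _ ⟨J, hJ, rfl⟩
    exact sumDesEq_mem_span J hJ
  · refine Submodule.span_le.2 ?_
    rintro _ ⟨J, hJ, rfl⟩
    rw [sumDesSubset_eq_sum hJ]
    exact sum_mem fun K hK => Submodule.subset_span ⟨K, (Finset.mem_powerset.1 hK).trans hJ, rfl⟩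

end DescentClass

/-- Descents of signed permutations. -/
def SignedPerm.IsDes (n : ℕ) (w : SignedPerm n) (i : ℕ) : Prop := w.entry (i + 1) < w.entry i

/-- Descents of permutations. -/
def SymPerm.IsDes (n : ℕ) (w : SymPerm n) (i : ℕ) : Prop :=
  SymPerm.entry w (i + 1) < SymPerm.entry w i

theorem isDescentStat_signedPerm :
    IsDescentStat (fun _ => SignedPerm.ofPerm) (fun _ _ => SignedPerm.prod) SignedPerm.IsDes where
  left p q ξ hξ u v i h1 h2 :=
    SignedPerm.entry_shuffle_lt_left u v hξ (by omega) (by omega) h1 (by omega)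
  right p q ξ hξ u v i h1 h2 :=
    SignedPerm.entry_shuffle_lt_right u v hξ (i := i + 1) (by omega) (by omega) h1 (by omega)

theorem isDescentStat_symPerm :
    IsDescentStat (fun _ ξ => ξ) (fun _ _ => SymPerm.prod) SymPerm.IsDes where
  left p q ξ hξ u v i h1 h2 :=
    SymPerm.entry_shuffle_lt_left u v hξ (by omega) (by omega) h1 (by omega)
  right p q ξ hξ u v i h1 h2 :=
    SymPerm.entry_shuffle_lt_right u v hξ (i := i + 1) (by omega) (by omega) h1 (by omega)

theorem totalSubspace_span {G : ℕ → Type} [∀ n, Group (G n)]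
    (X : ∀ n, Set (MonoidAlgebra ℚ (G n))) :
    totalSubspace (fun n => Submodule.span ℚ (X n)) =
      ⨆ n, Submodule.span ℚ
        (DirectSum.lof ℚ ℕ (fun n => MonoidAlgebra ℚ (G n)) n '' X n) := by
  simp only [totalSubspace, Submodule.map_span]

/-- A descent at 0 is always allowed in `X⁰_J`, so only the positions from 1 on matter. -/
theorem lof_X0 (n : ℕ) (J : Finset ℕ) :
    DirectSum.lof ℚ ℕ (fun n => MonoidAlgebra ℚ (SignedPerm n)) n (X0 n J) =
      sumDesSubset SignedPerm.IsDes n J := by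
  rw [X0, lof_classSum']
  refine classElt_congr fun w => ?_
  simp only [SignedPerm.des, Finset.subset_iff, Finset.mem_filter, Finset.mem_range,
    Finset.mem_insert, SignedPerm.IsDes]
  constructor
  · intro h i h1 h2 h3
    rcases h ⟨h2, h3⟩ with h | h
    · omega
    · exact h
  · rintro h i ⟨h2, h3⟩
    rcases Nat.eq_zero_or_pos i with h0 | h0
    · exact Or.inl h0
    · exact Or.inr (h i h0 h2 h3)

theorem opsB_one_eq : opsB.one = sumDesSubset SignedPerm.IsDes 0 ∅ := by
  have : (Finset.univ : Finset (SignedPerm 0)) = {1} := by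
    ext w
    simp only [Finset.mem_univ, Finset.mem_singleton, true_iff]
    ext i <;> exact i.elim0
  simp [sumDesSubset, classElt, this, opsB, externalOps]

theorem totalSubspace_canonicalIdeal :
    totalSubspace canonicalIdeal = ⨆ n, opsB.monSpan (desGen SignedPerm.IsDes) n := by
  unfold canonicalIdeal
  rw [totalSubspace_span]
  refine iSup_congr fun n => ?_
  refine Eq.trans ?_ (monSpan_desGen isExternal_signedPerm isDescentStat_signedPerm
    opsB_isBialgebra opsB_one_eq n).symm
  congr 1
  ext x
  constructor
  · rintro ⟨_, ⟨J, hJ, rfl⟩, rfl⟩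
    exact ⟨J, hJ, lof_X0 n J⟩
  · rintro ⟨J, hJ, rfl⟩
    exact ⟨_, ⟨J, hJ, rfl⟩, lof_X0 n J⟩

theorem lof_descentY {n : ℕ} {J : Finset ℕ} (hJ : J ⊆ Finset.Ico 1 n) :
    DirectSum.lof ℚ ℕ (fun n => MonoidAlgebra ℚ (SymPerm n)) n (descentY n J) =
      sumDesEq SymPerm.IsDes n J := by
  rw [descentY, lof_classSum']
  refine classElt_congr fun w => ?_
  simp only [SymPerm.des, Finset.ext_iff, Finset.mem_filter, Finset.mem_Ico, SymPerm.IsDes]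
  constructor
  · intro h i h1 h2
    rw [← h i]
    simp [h1, h2]
  · intro h i
    constructor
    · rintro ⟨⟨h1, h2⟩, h3⟩
      exact (h i h1 h2).1 h3
    · intro hi
      have := Finset.mem_Ico.1 (hJ hi)
      exact ⟨this, (h i this.1 this.2).2 hi⟩

theorem opsA_one_eq : opsA.one = sumDesSubset SymPerm.IsDes 0 ∅ := by
  simp [sumDesSubset, classElt, opsA, externalOps]

theorem totalSubspace_solA :
    totalSubspace solA = ⨆ n, opsA.monSpan (desGen SymPerm.IsDes) n := by
  unfold solA
  rw [totalSubspace_span]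
  refine iSup_congr fun n => ?_
  refine Eq.trans ?_ ((monSpan_desGen isExternal_symPerm isDescentStat_symPerm
    opsA_isBialgebra opsA_one_eq n).trans (span_sumDesEq n).symm).symm
  congr 1
  ext x
  constructor
  · rintro ⟨_, ⟨J, hJ, rfl⟩, rfl⟩
    exact ⟨J, hJ, lof_descentY hJ⟩
  · rintro ⟨J, hJ, rfl⟩
    exact ⟨_, ⟨J, hJ, rfl⟩, lof_descentY hJ⟩

end

noncomputable section

open TotalAlg

/-! ## Sums of monotone signed permutations -/

namespace SignedPerm

variable {n : ℕ}

/-- The entries of a signed permutation, as a function on `Fin n`. -/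
def val (w : SignedPerm n) (i : Fin n) : ℤ := w.sign i * ((w.perm i : ℕ) + 1)

theorem units_mul_succ_injective {s t : ℤˣ} {a b : ℕ}
    (h : (s : ℤ) * ((a : ℤ) + 1) = t * ((b : ℤ) + 1)) : a = b ∧ s = t := by
  rcases Int.units_eq_one_or s with rfl | rfl <;> rcases Int.units_eq_one_or t with rfl | rfl <;>
    simp at h ⊢ <;> omega

theorem val_injective (w : SignedPerm n) : Function.Injective w.val := fun _ _ h =>
  w.perm.injective (Fin.ext (units_mul_succ_injective h).1)

theorem val_mul_ofPerm (w : SignedPerm n) (σ : SymPerm n) (i : Fin n) :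
    (w * ofPerm σ).val i = w.val (σ i) := by
  simp [val]

/-- The signed permutation all the signs of which are `s`. -/
def constSign (n : ℕ) (s : ℤˣ) : SignedPerm n := ⟨1, fun _ => s⟩

theorem val_mul_constSign (w : SignedPerm n) (s : ℤˣ) (i : Fin n) :
    (w * constSign n s).val i = s * w.val i := by
  simp [val, constSign]
  ring

/-- The entries, multiplied by the sign `s`, increase. -/
def Mono (s : ℤˣ) (w : SignedPerm n) : Prop := ∀ i j : Fin n, i < j → s * w.val i < s * w.val j

theorem mono_one_iff {w : SignedPerm n} : Mono 1 w ↔ StrictMono w.val := by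
  simp [Mono, StrictMono]

theorem mono_iff_forall_entry (s : ℤˣ) (w : SignedPerm n) :
    Mono s w ↔ ∀ i, 1 ≤ i → i < n → s * w.entry i < s * w.entry (i + 1) := by
  constructor
  · intro h i h1 h2
    obtain ⟨k, rfl⟩ := exists_fin_succ h1 h2.le
    have := h k ⟨k + 1, h2⟩ (Fin.mk_lt_mk.2 (Nat.lt_succ_self _))
    have e := entry_succ w ⟨k + 1, h2⟩
    simp only at e
    rw [entry_succ, e]
    exact this
  · intro h i j hij
    have key : ∀ a b, 1 ≤ a → a + 1 ≤ b → b ≤ n → s * w.entry a < s * w.entry b := by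
      intro a b ha hab
      induction b, hab using Nat.le_induction with
      | base => exact fun hb => h a ha hb
      | succ b hb ih => exact fun hb' => (ih (by omega)).trans (h b (by omega) hb')
    have := key (i + 1) (j + 1) (by omega) (by have := Fin.lt_def.1 hij; omega) (by omega)
    rwa [entry_succ, entry_succ] at this

theorem entry_injective (w : SignedPerm n) {i j : ℕ} (hi : 1 ≤ i) (hin : i ≤ n)
    (hj : 1 ≤ j) (hjn : j ≤ n) (h : w.entry i = w.entry j) : i = j := by
  obtain ⟨i, rfl⟩ := exists_fin_succ hi hin
  obtain ⟨j, rfl⟩ := exists_fin_succ hj hjn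
  rw [entry_succ, entry_succ] at h
  rw [w.val_injective h]

end SignedPerm

/-- Cutting a word may change the keys of its second half but not their relative order; this allows
the second half to be renormalized. -/
theorem std_congr {n : ℕ} {c c' : Fin n → Letter}
    (h1 : ∀ i j, (c i).1 < (c j).1 ↔ (c' i).1 < (c' j).1) (h2 : ∀ i, (c i).2 = (c' i).2) :
    std c = std c' := by
  have hs : (Tuple.sort fun i => (c i).1) = Tuple.sort fun i => (c' i).1 := by
    rw [eq_sort_iff_forall]
    intro i j hij
    have h := (eq_sort_iff_forall (fun i => (c i).1) _).1 rfl i j hij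
    rw [h1] at h
    refine h.imp id fun h => ⟨le_antisymm ?_ ?_, h.2⟩
    · rw [← not_lt, ← h1, h.1]
      exact lt_irrefl _
    · rw [← not_lt, ← h1, h.1]
      exact lt_irrefl _
  apply SignedPerm.ext
  · exact hs
  · ext i
    simp only [std, hs, h2]

/-- The word of the signed permutation with monotone entries and a given set of entries. -/
def signWord (s : ℤˣ) {n : ℕ} (ε : Fin n → ℤˣ) (i : Fin n) : Letter :=
  (s * (ε i * ((i : ℕ) + 1)), ε i)

/-- The sum of the signed permutations with monotone entries. -/
def monoSum (s : ℤˣ) (n : ℕ) : TotalAlg SignedPerm := classElt (SignedPerm.Mono (n := n) s)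

/-- A signed permutation whose entries times `s` increase is determined by the signs of its symbols,
which can be chosen freely: list the signed symbols in the order of `s` times their value. Distinct
symbols have distinct keys, so there are no ties. -/
theorem monoSum_eq_sum_wordFn (s : ℤˣ) (n : ℕ) :
    monoSum s n = ∑ ε : Fin n → ℤˣ, wordFn (signWord s ε) := by
  classical
  symm
  have hval : ∀ (ε : Fin n → ℤˣ) i, s * (std (signWord s ε)).val i =
      (signWord s ε ((std (signWord s ε)).perm i)).1 := fun ε i => rfl
  refine Finset.sum_bij (fun ε _ => std (signWord s ε)) ?_ ?_ ?_ ?_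
  · intro ε _
    rw [Finset.mem_filter]
    refine ⟨Finset.mem_univ _, fun i j hij => ?_⟩
    rw [hval, hval]
    refine ((eq_sort_iff_forall _ (std (signWord s ε)).perm).1 rfl i j hij).resolve_right ?_
    rintro ⟨h1, h2⟩
    have := SignedPerm.units_mul_succ_injective (s.isUnit.mul_left_cancel h1)
    rw [Fin.lt_def] at h2
    omega
  · intro ε _ ε' _ h
    have key : ∀ ε : Fin n → ℤˣ,
        ε = fun i => (std (signWord s ε)).sign ((std (signWord s ε)).perm.symm i) := by
      intro ε
      ext i
      simp [std, signWord]
    rw [key ε, key ε', h]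
  · intro w hw
    rw [Finset.mem_filter] at hw
    refine ⟨fun i => w.sign (w.perm.symm i), Finset.mem_univ _, ?_⟩
    have h : w.perm = Tuple.sort fun i => (signWord s (fun i => w.sign (w.perm.symm i)) i).1 := by
      rw [eq_sort_iff_forall]
      intro i j hij
      left
      simpa [signWord, SignedPerm.val] using hw.2 i j hij
    apply SignedPerm.ext
    · exact h.symm
    · ext i
      simp only [std, ← h]
      simp [signWord]
  · intros; rfl

theorem opsB_comul_wordFn {n : ℕ} (c : Fin n → Letter) :
    opsB.comul (wordFn c) = ∑ pq ∈ Finset.HasAntidiagonal.antidiagonal n,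
      comulTerm (fun _ => SignedPerm.ofPerm) (fun _ _ => SignedPerm.prod) (std c) pq := by
  rw [wordFn, opsB, externalOps_comul_elt]

/-- Cutting a word after `p` letters cuts the vector of signs into two independent ones, so the sum
over sign vectors factors. -/
theorem monoSum_isDivided {K : Type} (f : K → ℤˣ) :
    opsB.IsDivided fun k n => monoSum (f k) n where
  mem_deg k n := classElt_mem_deg _
  zero k := by
    rw [monoSum_eq_sum_wordFn, Fintype.sum_unique, ← word_ofFn, List.ofFn_zero, word_nil]
  comul k n := by
    generalize f k = s
    rw [monoSum_eq_sum_wordFn, map_sum]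
    simp only [opsB_comul_wordFn]
    rw [Finset.sum_comm]
    refine Finset.sum_congr rfl ?_
    rintro ⟨p, q⟩ hpq
    obtain rfl := Finset.HasAntidiagonal.mem_antidiagonal.1 hpq
    simp only [comulTerm_std]
    rw [← (Fin.appendEquiv p q).sum_comp, Fintype.sum_prod_type, monoSum_eq_sum_wordFn,
      monoSum_eq_sum_wordFn, TensorProduct.sum_tmul]
    refine Finset.sum_congr rfl fun ε₁ _ => ?_
    rw [TensorProduct.tmul_sum]
    refine Finset.sum_congr rfl fun ε₂ _ => ?_
    congr 1
    · rw [wordFn, wordFn]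
      congr 2
      ext i <;> simp [signWord, Fin.appendEquiv]
    · rw [wordFn, wordFn]
      congr 1
      -- The second half has keys `± (p + j + 1)` where `± (j + 1)` is wanted. Increasing all
      -- absolute values by `p` preserves the comparisons.
      refine std_congr (fun i j => ?_) fun i => by simp [signWord, Fin.appendEquiv]
      simp only [signWord, Fin.appendEquiv, Equiv.coe_fn_mk, Fin.append_right, Fin.val_natAdd]
      rcases Int.units_eq_one_or s with rfl | rfl <;>
        rcases Int.units_eq_one_or (ε₂ i) with h | h <;>
        rcases Int.units_eq_one_or (ε₂ j) with h' | h' <;> simp [h, h'] <;> omega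

theorem monoSum_one_eq (n : ℕ) : monoSum 1 n = sumDesSubset SignedPerm.IsDes n ∅ := by
  refine classElt_congr fun w => ?_
  rw [SignedPerm.mono_iff_forall_entry]
  refine forall_congr' fun i => forall_congr' fun h1 => forall_congr' fun h2 => ?_
  have := w.entry_injective h1 h2.le (by omega : 1 ≤ i + 1) h2
  simp only [SignedPerm.IsDes, Units.val_one, one_mul, Finset.notMem_empty, imp_false, not_lt]
  exact ⟨fun h => h.le, fun h => h.lt_of_ne fun h => by have := this h; omega⟩

theorem monoSum_neg_one_eq (n : ℕ) :
    monoSum (-1) n = sumDesEq SignedPerm.IsDes n (Finset.Ico 1 n) := by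
  refine classElt_congr fun w => ?_
  rw [SignedPerm.mono_iff_forall_entry]
  refine forall_congr' fun i => forall_congr' fun h1 => forall_congr' fun h2 => ?_
  simp [SignedPerm.IsDes, h1, h2]

/-! ## The type B transform -/

open scoped Classical in
theorem lmap_mulLeft_classSum_elt {G : ℕ → Type} [∀ n, Group (G n)] [∀ n, Fintype (G n)]
    (P : ∀ n, G n → Prop) {n : ℕ} (w : G n) :
    DirectSum.lmap (fun n => LinearMap.mulLeft ℚ (classSum (P n))) (elt w) =
      ∑ u ∈ Finset.univ.filter (P n), (elt (u * w) : TotalAlg G) := by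
  rw [elt, DirectSum.lmap_lof]
  simp [classSum, Finset.sum_mul, MonoidAlgebra.single_mul_single, elt]

open scoped Classical in
/-- The signed permutations with increasing entries. -/
def incPerms (n : ℕ) : Finset (SignedPerm n) := Finset.univ.filter (SignedPerm.Mono 1)

theorem mem_incPerms {n : ℕ} {w : SignedPerm n} : w ∈ incPerms n ↔ StrictMono w.val := by
  simp [incPerms, SignedPerm.mono_one_iff]

theorem mono_one_iff_des {n : ℕ} (w : SignedPerm n) :
    SignedPerm.Mono 1 w ↔ w.des ⊆ insert 0 ∅ := by
  rw [SignedPerm.mono_iff_forall_entry]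
  simp only [SignedPerm.des, Finset.subset_iff, Finset.mem_filter, Finset.mem_range,
    Finset.mem_insert, Units.val_one, one_mul, Finset.notMem_empty, or_false]
  constructor
  · rintro h i ⟨h1, h2⟩
    by_contra h0
    have := h i (by omega) h1
    omega
  · intro h i h1 h2
    have := w.entry_injective h1 h2.le (by omega : 1 ≤ i + 1) h2
    rcases lt_trichotomy (w.entry i) (w.entry (i + 1)) with h3 | h3 | h3
    · exact h3
    · have := this h3
      omega
    · have := h ⟨h2, h3⟩
      omega

theorem thetaPM_elt {n : ℕ} (w : SignedPerm n) :
    thetaPM (elt w) = ∑ u ∈ incPerms n, elt (u * w) := by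
  classical
  unfold thetaPM X0
  rw [lmap_mulLeft_classSum_elt]
  refine Finset.sum_congr ?_ fun _ _ => rfl
  ext u
  simp only [incPerms, Finset.mem_filter, mono_one_iff_des]

/-- Right multiplication by the element with all signs `s` multiplies every entry by `s`, and it is
an involution, so it exchanges the increasing elements with those counted by `monoSum s`. -/
theorem thetaPM_constSign (s : ℤˣ) (n : ℕ) :
    thetaPM (elt (SignedPerm.constSign n s)) = monoSum s n := by
  classical
  rw [thetaPM_elt]
  have hs : (s : ℤ) * s = 1 := Int.units_coe_mul_self s
  refine Finset.sum_bij (fun u _ => u * SignedPerm.constSign n s) ?_ ?_ ?_ ?_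
  · intro u hu
    rw [Finset.mem_filter]
    refine ⟨Finset.mem_univ _, fun i j hij => ?_⟩
    rw [SignedPerm.val_mul_constSign, SignedPerm.val_mul_constSign, ← mul_assoc, ← mul_assoc, hs,
      one_mul, one_mul]
    exact mem_incPerms.1 hu hij
  · intro u _ v _ h
    exact mul_right_cancel h
  · intro w hw
    rw [Finset.mem_filter] at hw
    refine ⟨w * SignedPerm.constSign n s, mem_incPerms.2 fun i j hij => ?_, ?_⟩
    · rw [SignedPerm.val_mul_constSign, SignedPerm.val_mul_constSign]
      exact hw.2 i j hij
    · rw [mul_assoc]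
      convert mul_one w
      ext i <;> simp [SignedPerm.constSign]
  · intros; rfl

/-! ### Multiplicativity of the type B transform -/

theorem strictMono_comp_perm {n : ℕ} {f : Fin n → ℤ} (hf : StrictMono f) {τ : SymPerm n}
    (h : StrictMono fun i => f (τ i)) : τ = 1 :=
  perm_eq_one_of_strictMono fun _ _ hij => hf.lt_iff_lt.1 (h hij)

open scoped Classical in
/-- The signed permutations with entries increasing on `{1, ..., p}` and on `{p + 1, ..., p + q}`. -/
def blockIncPerms (p q : ℕ) : Finset (SignedPerm (p + q)) :=
  Finset.univ.filter fun w => StrictMono (fun i : Fin p => w.val (Fin.castAdd q i)) ∧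
    StrictMono (fun j : Fin q => w.val (Fin.natAdd p j))

theorem mem_blockIncPerms {p q : ℕ} {w : SignedPerm (p + q)} :
    w ∈ blockIncPerms p q ↔ StrictMono (fun i : Fin p => w.val (Fin.castAdd q i)) ∧
      StrictMono (fun j : Fin q => w.val (Fin.natAdd p j)) := by
  simp [blockIncPerms]

/-- Sorting all the entries of `w` by some `σ` makes it increasing, and when `w` already increases
on each block, `σ⁻¹` is a shuffle. Uniqueness holds because an increasing sequence has only one
increasing rearrangement. -/
theorem sum_incPerms_mul_shuffles {M : Type} [AddCommGroup M] {p q : ℕ}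
    (F : SignedPerm (p + q) → M) :
    ∑ ξ ∈ shuffles p q, ∑ w ∈ incPerms (p + q), F (w * SignedPerm.ofPerm ξ) =
      ∑ w ∈ blockIncPerms p q, F w := by
  rw [← Finset.sum_product']
  refine Finset.sum_bij (fun t _ => t.2 * SignedPerm.ofPerm t.1) ?_ ?_ ?_ ?_
  · rintro ⟨ξ, w⟩ h
    rw [Finset.mem_product, mem_incPerms, mem_shuffles] at h
    rw [mem_blockIncPerms]
    simp only [SignedPerm.val_mul_ofPerm]
    exact ⟨h.2.comp h.1.1, h.2.comp h.1.2⟩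
  · rintro ⟨ξ, w⟩ h ⟨ξ', w'⟩ h' he
    rw [Finset.mem_product, mem_incPerms] at h h'
    simp only at h h' he
    have h1 : w' = w * SignedPerm.ofPerm (ξ * ξ'⁻¹) := by
      have h2 : SignedPerm.ofPerm ξ' * SignedPerm.ofPerm ξ'⁻¹ = 1 := by
        rw [← SignedPerm.ofPerm_mul, mul_inv_cancel]
        rfl
      rw [SignedPerm.ofPerm_mul, ← mul_assoc, he, mul_assoc, h2, mul_one]
    have h3 : ξ * ξ'⁻¹ = 1 := by
      refine strictMono_comp_perm h.2 ?_
      have := h'.2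
      rw [h1] at this
      intro i j hij
      simpa only [SignedPerm.val_mul_ofPerm] using this hij
    have h4 := mul_inv_eq_one.1 h3
    subst h4
    rw [mul_right_cancel he]
  · intro w hw
    rw [mem_blockIncPerms] at hw
    set σ := Tuple.sort w.val with hσ
    refine ⟨(σ⁻¹, w * SignedPerm.ofPerm σ), ?_, ?_⟩
    · rw [Finset.mem_product, mem_incPerms, mem_shuffles]
      refine ⟨⟨fun i j hij => ?_, fun i j hij => ?_⟩, fun i j hij => ?_⟩
      · exact (sort_lt_sort_iff w.val _ _).2 (Or.inl (hw.1 hij))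
      · exact (sort_lt_sort_iff w.val _ _).2 (Or.inl (hw.2 hij))
      · rw [SignedPerm.val_mul_ofPerm, SignedPerm.val_mul_ofPerm]
        exact (Tuple.monotone_sort w.val).strictMono_of_injective
          (w.val_injective.comp σ.injective) hij
    · simp only [mul_assoc, ← SignedPerm.ofPerm_mul, mul_inv_cancel]
      exact mul_one w
  · intros; rfl

/-- In `ξ · (u × v)` the shuffle preserves comparisons within each block, so the entries increase on
both blocks exactly when those of `u` and of `v` do. -/
theorem sum_shuffles_mul_incPerms {M : Type} [AddCommGroup M] {p q : ℕ}
    (F : SignedPerm (p + q) → M) :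
    ∑ u ∈ incPerms p, ∑ v ∈ incPerms q, ∑ ξ ∈ shuffles p q,
      F (SignedPerm.ofPerm ξ * SignedPerm.prod u v) = ∑ w ∈ blockIncPerms p q, F w := by
  have key : ∀ ξ ∈ shuffles p q, ∀ u v, SignedPerm.ofPerm ξ * SignedPerm.prod u v ∈
      blockIncPerms p q ↔ u ∈ incPerms p ∧ v ∈ incPerms q := by
    intro ξ hξ u v
    rw [mem_blockIncPerms, mem_incPerms, mem_incPerms]
    refine and_congr (forall_congr' fun i => forall_congr' fun j => forall_congr' fun _ => ?_)
      (forall_congr' fun i => forall_congr' fun j => forall_congr' fun _ => ?_)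
    · have := SignedPerm.sign_mul_lt_sign_mul_iff
        ((mem_shuffles.1 hξ).1.lt_iff_lt (a := u.perm i) (b := u.perm j))
        ((mem_shuffles.1 hξ).1.lt_iff_lt (a := u.perm j) (b := u.perm i)) (u.sign i) (u.sign j)
      simpa [SignedPerm.val] using this
    · have := SignedPerm.sign_mul_lt_sign_mul_iff
        ((mem_shuffles.1 hξ).2.lt_iff_lt (a := v.perm i) (b := v.perm j))
        ((mem_shuffles.1 hξ).2.lt_iff_lt (a := v.perm j) (b := v.perm i)) (v.sign i) (v.sign j)
      simpa [SignedPerm.val] using this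
  rw [← Finset.sum_product', Finset.sum_sigma']
  refine Finset.sum_bij (fun t _ => SignedPerm.ofPerm t.2 * SignedPerm.prod t.1.1 t.1.2)
    ?_ ?_ ?_ ?_
  · rintro ⟨⟨u, v⟩, ξ⟩ h
    simp only [Finset.mem_sigma, Finset.mem_product] at h
    exact (key ξ h.2 u v).2 h.1
  · rintro ⟨⟨u, v⟩, ξ⟩ h ⟨⟨u', v'⟩, ξ'⟩ h' he
    simp only [Finset.mem_sigma] at h h'
    obtain ⟨rfl, rfl, rfl⟩ := isExternal_signedPerm.injective p q _ _ _ _ _ _ h.2 h'.2 he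
    rfl
  · intro w hw
    obtain ⟨ξ, hξ, u, v, rfl⟩ := isExternal_signedPerm.exists_eq p q w
    exact ⟨⟨(u, v), ξ⟩, by simpa [hξ] using (key ξ hξ u v).1 hw, rfl⟩
  · intros; rfl

/-- Both sides are the sum of the `w · (u × v)` over the same set of elements `w` that increase on
each block. -/
theorem thetaPM_mul (x y : TotalAlg SignedPerm) :
    thetaPM (opsB.mul x y) = opsB.mul (thetaPM x) (thetaPM y) := by
  induction x using induction_elt with
  | h p u =>
    induction y using induction_elt with
    | h q v =>
      simp only [opsB, externalOps_mul_elt, map_sum, thetaPM_elt, LinearMap.sum_apply,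
        SignedPerm.prod_mul, ← mul_assoc]
      rw [Finset.sum_comm (s := incPerms q)]
      exact (sum_incPerms_mul_shuffles fun w => elt (w * SignedPerm.prod u v)).trans
        (sum_shuffles_mul_incPerms fun w => elt (w * SignedPerm.prod u v)).symm
    | h0 => simp
    | hadd x y hx hy => simp [hx, hy]
    | hsmul a x hx => simp [hx]
  | h0 => simp
  | hadd x y hx hy => simp [hx, hy]
  | hsmul a x hx => simp [hx]

theorem thetaPM_one : thetaPM opsB.one = opsB.one := by
  have h : opsB.one = elt (SignedPerm.constSign 0 1) := by
    change elt (1 : SignedPerm 0) = _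
    congr 1
  rw [h, thetaPM_constSign, ← h]
  exact (monoSum_isDivided (fun _ : Unit => 1)).zero ()

/-- The generators of the algebra of Mantaci and Reutenauer. -/
def signGen (s : ℤˣ) (n : ℕ) : TotalAlg SignedPerm := elt (SignedPerm.constSign n s)

/-- All keys are equal, so ties give the identity permutation. Cutting a constant word yields
constant words, and the divided power formula follows. -/
theorem signGen_eq_wordFn (s : ℤˣ) (n : ℕ) : signGen s n = wordFn fun _ : Fin n => (0, s) := by
  rw [signGen, wordFn]
  congr 1
  have h : (1 : SymPerm n) = Tuple.sort fun _ : Fin n => (0 : ℤ) := by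
    rw [eq_sort_iff_forall]
    intro i j hij
    exact Or.inr ⟨rfl, hij⟩
  apply SignedPerm.ext
  · exact h
  · rfl

theorem signGen_isDivided : opsB.IsDivided signGen where
  mem_deg k n := elt_mem_deg _
  zero k := by
    rw [signGen_eq_wordFn, ← word_nil]
    exact (word_ofFn fun _ : Fin 0 => (0, k)).symm
  comul k n := by
    rw [signGen_eq_wordFn, opsB_comul_wordFn]
    refine Finset.sum_congr rfl ?_
    rintro ⟨p, q⟩ hpq
    obtain rfl := Finset.HasAntidiagonal.mem_antidiagonal.1 hpq
    rw [comulTerm_std, signGen_eq_wordFn, signGen_eq_wordFn]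

end

noncomputable section

open TotalAlg

/-! ## The algebra of Mantaci and Reutenauer -/

namespace SignedPerm

/-- The absolute values increase from `w_i` to `w_{i+1}`, and the sign does not change. -/
def Run {n : ℕ} (w : SignedPerm n) (i : ℕ) : Prop :=
  |w.entry i| < |w.entry (i + 1)| ∧ (w.entry i).sign = (w.entry (i + 1)).sign

section Shuffle

variable {p q : ℕ} {ξ : SymPerm (p + q)} (u : SignedPerm p) (v : SignedPerm q)

theorem sign_entry_shuffle_left (ξ : SymPerm (p + q)) {i : ℕ} (hi : 1 ≤ i) (hip : i ≤ p) :
    ((ofPerm ξ * prod u v).entry i).sign = (u.entry i).sign := by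
  obtain ⟨i, rfl⟩ := exists_fin_succ hi hip
  have := (ofPerm ξ * prod u v).sign_entry_succ (Fin.castAdd q i)
  simpa [sign_entry_succ] using this

theorem sign_entry_shuffle_right (ξ : SymPerm (p + q)) {i : ℕ} (hi : 1 ≤ i) (hiq : i ≤ q) :
    ((ofPerm ξ * prod u v).entry (p + i)).sign = (v.entry i).sign := by
  obtain ⟨i, rfl⟩ := exists_fin_succ hi hiq
  have := (ofPerm ξ * prod u v).sign_entry_succ (Fin.natAdd p i)
  simpa [sign_entry_succ, add_assoc] using this

theorem abs_entry_shuffle_left (hξ : ξ ∈ shuffles p q) {i j : ℕ} (hi : 1 ≤ i) (hip : i ≤ p)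
    (hj : 1 ≤ j) (hjp : j ≤ p) :
    |(ofPerm ξ * prod u v).entry i| < |(ofPerm ξ * prod u v).entry j| ↔
      |u.entry i| < |u.entry j| := by
  obtain ⟨i, rfl⟩ := exists_fin_succ hi hip
  obtain ⟨j, rfl⟩ := exists_fin_succ hj hjp
  have h1 := (ofPerm ξ * prod u v).abs_entry_succ (Fin.castAdd q i)
  have h2 := (ofPerm ξ * prod u v).abs_entry_succ (Fin.castAdd q j)
  have h3 := (mem_shuffles.1 hξ).1.lt_iff_lt (a := u.perm i) (b := u.perm j)
  simp only [Fin.lt_def] at h3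
  simp only [Fin.val_castAdd, mul_perm, ofPerm_perm, prod_perm, Equiv.Perm.mul_apply,
    SymPerm.prod_castAdd] at h1 h2
  rw [h1, h2, abs_entry_succ, abs_entry_succ]
  omega

theorem abs_entry_shuffle_right (hξ : ξ ∈ shuffles p q) {i j : ℕ} (hi : 1 ≤ i) (hiq : i ≤ q)
    (hj : 1 ≤ j) (hjq : j ≤ q) :
    |(ofPerm ξ * prod u v).entry (p + i)| < |(ofPerm ξ * prod u v).entry (p + j)| ↔
      |v.entry i| < |v.entry j| := by
  obtain ⟨i, rfl⟩ := exists_fin_succ hi hiq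
  obtain ⟨j, rfl⟩ := exists_fin_succ hj hjq
  have h1 := (ofPerm ξ * prod u v).abs_entry_succ (Fin.natAdd p i)
  have h2 := (ofPerm ξ * prod u v).abs_entry_succ (Fin.natAdd p j)
  have h3 := (mem_shuffles.1 hξ).2.lt_iff_lt (a := v.perm i) (b := v.perm j)
  simp only [Fin.lt_def] at h3
  simp only [Fin.val_natAdd, mul_perm, ofPerm_perm, prod_perm, Equiv.Perm.mul_apply,
    SymPerm.prod_natAdd, add_assoc] at h1 h2
  rw [h1, h2, abs_entry_succ, abs_entry_succ]
  omega

theorem run_shuffle_left (hξ : ξ ∈ shuffles p q) {i : ℕ} (hi : 1 ≤ i) (hip : i < p) :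
    (ofPerm ξ * prod u v).Run i ↔ u.Run i := by
  rw [Run, Run, abs_entry_shuffle_left u v hξ hi hip.le (by omega) hip,
    sign_entry_shuffle_left u v ξ hi hip.le, sign_entry_shuffle_left u v ξ (by omega) hip]

theorem run_shuffle_right (hξ : ξ ∈ shuffles p q) {i : ℕ} (hi : 1 ≤ i) (hiq : i < q) :
    (ofPerm ξ * prod u v).Run (p + i) ↔ v.Run i := by
  rw [Run, Run, add_assoc, abs_entry_shuffle_right u v hξ hi hiq.le (by omega) hiq,
    sign_entry_shuffle_right u v ξ hi hiq.le, sign_entry_shuffle_right u v ξ (by omega) hiq]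

end Shuffle

theorem increasingOn_Icc_iff {n : ℕ} (w : SignedPerm n) (a b : ℕ) :
    w.IncreasingOn (Finset.Icc a b) ↔ ∀ i, a ≤ i → i < b → w.Run i := by
  constructor
  · intro h i h1 h2
    exact h i (Finset.mem_Icc.2 ⟨h1, h2.le⟩) (i + 1) (Finset.mem_Icc.2 ⟨by omega, h2⟩)
      (Nat.lt_succ_self i)
  · intro h i hi j hj hij
    rw [Finset.mem_Icc] at hi hj
    have hj' := hj.2
    clear hj
    induction j, (show i + 1 ≤ j from hij) using Nat.le_induction with
    | base => exact h i hi.1 hj'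
    | succ j hij' ih =>
      have h1 := ih (by omega) (by omega)
      have h2 := h j (by omega) (by omega)
      exact ⟨h1.1.trans h2.1, h1.2.trans h2.2⟩

end SignedPerm

/-- The sum of the absolute values of the first `i` parts. -/
def partialSum (α : List ℤ) (i : ℕ) : ℕ := ((α.take i).map Int.natAbs).sum

theorem block_eq (α : List ℤ) (i : ℕ) :
    block α i = Finset.Icc (partialSum α i + 1) (partialSum α (i + 1)) := by
  ext x
  rw [block, Finset.mem_Ioc, Finset.mem_Icc]
  exact Iff.rfl

@[simp] theorem partialSum_zero (α : List ℤ) : partialSum α 0 = 0 := by simp [partialSum]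

@[simp] theorem partialSum_cons (a : ℤ) (α : List ℤ) (i : ℕ) :
    partialSum (a :: α) (i + 1) = a.natAbs + partialSum α i := by simp [partialSum]

theorem partialSum_succ (α : List ℤ) {i : ℕ} (hi : i < α.length) :
    partialSum α (i + 1) = partialSum α i + α[i].natAbs := by
  rw [partialSum, List.take_succ_eq_append_getElem hi, List.map_append, List.sum_append,
    List.map_singleton, List.sum_singleton, partialSum]

theorem partialSum_mono (α : List ℤ) : Monotone (partialSum α) := by
  refine monotone_nat_of_le_succ fun i => ?_
  rcases lt_or_ge i α.length with hi | hi
  · rw [partialSum_succ α hi]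
    omega
  · rw [partialSum, partialSum, List.take_of_length_le hi, List.take_of_length_le (by omega)]

theorem partialSum_length (α : List ℤ) : partialSum α α.length = (α.map Int.natAbs).sum := by
  simp [partialSum]

/-- `x` is the last element of a block of `α`. -/
def IsBlockEnd (α : List ℤ) (x : ℕ) : Prop := ∃ i < α.length, x = partialSum α (i + 1)

theorem isBlockEnd_cons {a : ℤ} {α : List ℤ} {x : ℕ} :
    IsBlockEnd (a :: α) x ↔ x = a.natAbs ∨ ∃ y, IsBlockEnd α y ∧ x = a.natAbs + y := by
  constructor
  · rintro ⟨i, hi, rfl⟩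
    cases i with
    | zero => simp
    | succ i =>
      right
      exact ⟨_, ⟨i, by simpa using hi, rfl⟩, by simp⟩
  · rintro (rfl | ⟨_, ⟨i, hi, rfl⟩, rfl⟩)
    · exact ⟨0, by simp, by simp⟩
    · exact ⟨i + 1, by simpa using hi, by simp⟩

theorem isBlockEnd_nil (x : ℕ) : ¬ IsBlockEnd [] x := by
  rintro ⟨i, hi, -⟩
  simp at hi

/-- On the blocks of `α`, the function `e` is the sign of the corresponding part. -/
def HasSigns (α : List ℤ) (e : ℕ → ℤ) : Prop :=
  ∀ i (hi : i < α.length), ∀ j ∈ block α i, e j = α[i].sign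

theorem hasSigns_nil (e : ℕ → ℤ) : HasSigns [] e := by
  intro i hi
  simp at hi

theorem hasSigns_cons {a : ℤ} {α : List ℤ} {e : ℕ → ℤ} :
    HasSigns (a :: α) e ↔ (∀ j, 1 ≤ j → j ≤ a.natAbs → e j = a.sign) ∧
      HasSigns α fun j => e (a.natAbs + j) := by
  constructor
  · intro h
    refine ⟨fun j h1 h2 => h 0 (by simp) j ?_, fun i hi j hj => ?_⟩
    · rw [block_eq, Finset.mem_Icc]
      simpa using ⟨h1, h2⟩
    · have := h (i + 1) (by simpa using hi) (a.natAbs + j)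
      simp only [block_eq, Finset.mem_Icc, partialSum_cons, List.getElem_cons_succ] at this hj
      exact this ⟨by omega, by omega⟩
  · rintro ⟨h1, h2⟩ i hi j hj
    rw [block_eq, Finset.mem_Icc] at hj
    cases i with
    | zero =>
      simp at hj
      exact h1 j (by omega) hj.2
    | succ i =>
      simp only [partialSum_cons] at hj
      have := h2 i (by simpa using hi) (j - a.natAbs)
        (by rw [block_eq, Finset.mem_Icc]; omega)
      simp only [show a.natAbs + (j - a.natAbs) = j by omega] at this
      simpa using this

/-- The signed permutations in the sum `T_α`. -/
def HasType (n : ℕ) (α : List ℤ) (w : SignedPerm n) : Prop :=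
  (∀ i, 1 ≤ i → i < n → (w.Run i ↔ ¬ IsBlockEnd α i)) ∧ HasSigns α fun j => (w.entry j).sign

/-- Maximality of the blocks means that runs break exactly at block ends: if a run continued past a
block end, the block could be enlarged, and conversely an interval larger than a block contains a
break next to it. -/
theorem classT_iff {n : ℕ} {α : List ℤ} (hα : IsSignedComposition n α) (w : SignedPerm n) :
    (∀ i (hi : i < α.length),
      w.IncreasingOn (block α i) ∧ (∀ j ∈ block α i, (w.entry j).sign = α[i].sign) ∧
      ∀ a b, 1 ≤ a → b ≤ n → block α i ⊆ Finset.Icc a b → w.IncreasingOn (Finset.Icc a b) →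
        Finset.Icc a b = block α i) ↔ HasType n α w := by
  obtain ⟨h0, hn⟩ := hα
  rw [← partialSum_length] at hn
  have hpos : ∀ i (hi : i < α.length), partialSum α i < partialSum α (i + 1) := by
    intro i hi
    rw [partialSum_succ α hi]
    have : α[i] ≠ 0 := fun h => h0 (h ▸ List.getElem_mem hi)
    omega
  have hle : ∀ i, i ≤ α.length → partialSum α i ≤ n := fun i hi => hn ▸ partialSum_mono α hi
  constructor
  · intro h
    refine ⟨fun x h1 h2 => ?_, fun i hi => (h i hi).2.1⟩
    -- The partial sums go from 0 to `n`, so `x` lies in some block `i`.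
    obtain ⟨i, hi, hx1, hx2⟩ : ∃ i < α.length, partialSum α i < x ∧ x ≤ partialSum α (i + 1) := by
      by_contra! hcon
      have : ∀ i ≤ α.length, partialSum α i < x := by
        intro i
        induction i with
        | zero => intro; rw [partialSum_zero]; omega
        | succ i ih =>
          intro hi
          exact hcon i (by omega) (ih (by omega))
      have := this α.length le_rfl
      omega
    obtain ⟨h3, -, h5⟩ := h i hi
    rw [block_eq] at h3 h5
    rcases hx2.lt_or_eq with hx2 | hx2
    · refine iff_of_true ((w.increasingOn_Icc_iff _ _).1 h3 x hx1 hx2) ?_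
      rintro ⟨j, hj, rfl⟩
      rcases lt_or_ge j i with hji | hji
      · have := partialSum_mono α (show j + 1 ≤ i from hji)
        omega
      · have := partialSum_mono α (show i + 1 ≤ j + 1 by omega)
        omega
    · refine iff_of_false (fun hrun => ?_) (not_not.2 ⟨i, hi, hx2⟩)
      -- A run at the block end `x` would allow the block to be extended to `x + 1`.
      have h6 := h5 (partialSum α i + 1) (x + 1) (by omega) h2
        (Finset.Icc_subset_Icc le_rfl (by omega))
        ((w.increasingOn_Icc_iff _ _).2 fun k hk1 hk2 => ?_)
      · have : x + 1 ∈ Finset.Icc (partialSum α i + 1) (x + 1) := by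
          rw [Finset.mem_Icc]; omega
        rw [h6, Finset.mem_Icc] at this
        omega
      · rcases (show k ≤ x by omega).lt_or_eq with hk | rfl
        · exact (w.increasingOn_Icc_iff _ _).1 h3 k hk1 (by omega)
        · exact hrun
  · rintro ⟨h1, h2⟩ i hi
    have hp := hpos i hi
    have hl := hle (i + 1) hi
    refine ⟨?_, h2 i hi, ?_⟩
    · rw [block_eq, SignedPerm.increasingOn_Icc_iff]
      intro x hx1 hx2
      rw [h1 x (by omega) (by omega)]
      rintro ⟨j, hj, rfl⟩
      rcases lt_or_ge j i with hji | hji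
      · have := partialSum_mono α (show j + 1 ≤ i from hji)
        omega
      · have := partialSum_mono α (show i + 1 ≤ j + 1 by omega)
        omega
    · intro a b ha hb hsub hinc
      rw [SignedPerm.increasingOn_Icc_iff] at hinc
      rw [block_eq] at hsub ⊢
      have ha' := (Finset.mem_Icc.1 (hsub (Finset.left_mem_Icc.2 hp))).1
      have hb' := (Finset.mem_Icc.1 (hsub (Finset.right_mem_Icc.2 hp))).2
      have hae : a = partialSum α i + 1 := by
        by_contra hne
        cases i with
        | zero => simp at ha' hne; omega
        | succ i =>
          exact (h1 (partialSum α (i + 1)) (by omega) (by omega)).1 (hinc _ (by omega) (by omega))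
            ⟨i, by omega, rfl⟩
      have hbe : b = partialSum α (i + 1) := by
        by_contra hne
        exact (h1 (partialSum α (i + 1)) (by omega) (by omega)).1 (hinc _ (by omega) (by omega))
          ⟨i, by omega, rfl⟩
      rw [hae, hbe]

/-- The element `T_α` of `ℚB`. -/
def typeSum (n : ℕ) (α : List ℤ) : TotalAlg SignedPerm := classElt (HasType n α)

theorem lof_classT {n : ℕ} {α : List ℤ} (hα : IsSignedComposition n α) :
    DirectSum.lof ℚ ℕ (fun n => MonoidAlgebra ℚ (SignedPerm n)) n (classT n α) = typeSum n α := by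
  rw [classT, lof_classSum']
  exact classElt_congr (classT_iff hα)

theorem eq_constSign_iff {n : ℕ} (s : ℤˣ) (w : SignedPerm n) :
    w = SignedPerm.constSign n s ↔
      (∀ i, 1 ≤ i → i < n → w.Run i) ∧ ∀ j, 1 ≤ j → j ≤ n → (w.entry j).sign = s := by
  constructor
  · rintro rfl
    refine ⟨fun i h1 h2 => ?_, fun j h1 h2 => ?_⟩
    · obtain ⟨k, rfl⟩ := exists_fin_succ h1 h2.le
      have e1 := (SignedPerm.constSign n s).sign_entry_succ ⟨k + 1, h2⟩
      have e2 := (SignedPerm.constSign n s).abs_entry_succ ⟨k + 1, h2⟩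
      simp only at e1 e2
      rw [SignedPerm.Run, e1, e2, SignedPerm.sign_entry_succ, SignedPerm.abs_entry_succ]
      simp [SignedPerm.constSign]
    · obtain ⟨k, rfl⟩ := exists_fin_succ h1 h2
      rw [SignedPerm.sign_entry_succ]
      rfl
  · rintro ⟨h1, h2⟩
    have h3 : w.IncreasingOn (Finset.Icc 1 n) := (w.increasingOn_Icc_iff 1 n).2 h1
    apply SignedPerm.ext
    · refine perm_eq_one_of_strictMono fun i j hij => ?_
      have := (h3 (i + 1) (Finset.mem_Icc.2 ⟨by omega, i.2⟩) (j + 1)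
        (Finset.mem_Icc.2 ⟨by omega, j.2⟩) (by have := Fin.lt_def.1 hij; omega)).1
      rw [SignedPerm.abs_entry_succ, SignedPerm.abs_entry_succ] at this
      rw [Fin.lt_def]
      omega
    · funext i
      have := h2 (i + 1) (by omega) i.2
      rw [SignedPerm.sign_entry_succ] at this
      exact Units.ext this

theorem elt_eq_classElt {G : ℕ → Type} [∀ n, Group (G n)] [∀ n, Fintype (G n)] {n : ℕ}
    (w₀ : G n) : (elt w₀ : TotalAlg G) = classElt fun w => w = w₀ := by
  rw [classElt, Finset.sum_filter, Finset.sum_eq_single w₀]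
  · rw [if_pos rfl]
  · intro w _ hw
    rw [if_neg hw]
  · intro h
    exact absurd (Finset.mem_univ _) h

theorem signGen_eq_classElt (s : ℤˣ) (n : ℕ) :
    signGen s n = classElt fun w : SignedPerm n => w = SignedPerm.constSign n s :=
  elt_eq_classElt _

theorem signGen_eq_typeSum {n : ℕ} {a : ℤ} {s : ℤˣ} (h : a.natAbs = n) (hs : a.sign = s) :
    signGen s n = typeSum n [a] := by
  rw [signGen_eq_classElt]
  refine classElt_congr fun w => ?_
  rw [eq_constSign_iff, HasType, hasSigns_cons, h, hs]
  refine and_congr (forall_congr' fun i => forall_congr' fun h1 => forall_congr' fun h2 => ?_)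
    (and_iff_left (hasSigns_nil _)).symm
  have : ¬ IsBlockEnd [a] i := by
    rw [isBlockEnd_cons]
    rintro (h3 | ⟨y, h3, -⟩)
    · omega
    · exact isBlockEnd_nil y h3
  exact (iff_true_right this).symm

theorem typeSum_nil : typeSum 0 [] = opsB.one := by
  rw [← signGen_isDivided.zero 1, signGen_eq_classElt]
  refine classElt_congr fun w => iff_of_true ⟨fun i h1 h2 => by omega, hasSigns_nil _⟩ ?_
  apply SignedPerm.ext
  · ext i
    exact i.elim0
  · ext i
    exact i.elim0

/-! ### Products of generators with the elements `T_α` -/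

theorem hasSigns_merge {a b : ℤ} {r : List ℤ} {e : ℕ → ℤ} (hs : a.sign = b.sign) :
    HasSigns ((a + b) :: r) e ↔ HasSigns (a :: b :: r) e := by
  have habs : (a + b).natAbs = a.natAbs + b.natAbs := by
    rcases lt_trichotomy a 0 with h | h | h
    · rw [Int.sign_eq_neg_one_of_neg h, eq_comm, Int.sign_eq_neg_one_iff_neg] at hs
      omega
    · omega
    · rw [Int.sign_eq_one_of_pos h, eq_comm, Int.sign_eq_one_iff_pos] at hs
      omega
  have hsign : (a + b).sign = a.sign := by
    rcases lt_trichotomy a 0 with h | h | h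
    · rw [Int.sign_eq_neg_one_of_neg h, eq_comm, Int.sign_eq_neg_one_iff_neg] at hs
      rw [Int.sign_eq_neg_one_of_neg h, Int.sign_eq_neg_one_of_neg (by omega)]
    · subst h
      simpa using hs.symm
    · rw [Int.sign_eq_one_of_pos h, eq_comm, Int.sign_eq_one_iff_pos] at hs
      rw [Int.sign_eq_one_of_pos h, Int.sign_eq_one_of_pos (by omega)]
  rw [hasSigns_cons, hasSigns_cons, hasSigns_cons, habs, hsign, ← and_assoc]
  refine and_congr ⟨fun h => ⟨fun j h1 h2 => h j h1 (by omega),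
    fun j h1 h2 => hs ▸ h _ (by omega) (by omega)⟩, fun h j h1 h2 => ?_⟩ (by simp only [add_assoc])
  rcases le_or_gt j a.natAbs with h3 | h3
  · exact h.1 j h1 h3
  · have := h.2 (j - a.natAbs) (by omega) (by omega)
    rwa [show a.natAbs + (j - a.natAbs) = j by omega, ← hs] at this

theorem natAbs_add_of_sign_eq {a b : ℤ} (hs : a.sign = b.sign) :
    (a + b).natAbs = a.natAbs + b.natAbs := by
  rcases lt_trichotomy a 0 with h | h | h
  · rw [Int.sign_eq_neg_one_of_neg h, eq_comm, Int.sign_eq_neg_one_iff_neg] at hs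
    omega
  · omega
  · rw [Int.sign_eq_one_of_pos h, eq_comm, Int.sign_eq_one_iff_pos] at hs
    omega

theorem classElt_eq_add {G : ℕ → Type} [∀ n, Group (G n)] [∀ n, Fintype (G n)] {n : ℕ}
    (R Q : G n → Prop) :
    (classElt R : TotalAlg G) = classElt (fun w => R w ∧ Q w) + classElt (fun w => R w ∧ ¬ Q w) := by
  simp only [classElt, Finset.sum_filter]
  rw [← Finset.sum_add_distrib]
  refine Finset.sum_congr rfl fun w _ => ?_
  by_cases h1 : R w <;> by_cases h2 : Q w <;> simp [h1, h2]

theorem classElt_eq_zero {G : ℕ → Type} [∀ n, Group (G n)] [∀ n, Fintype (G n)] {n : ℕ}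
    {R : G n → Prop} (h : ∀ w, ¬ R w) : (classElt R : TotalAlg G) = 0 := by
  simp [classElt, h]

open scoped Classical in
-- In the product the junction `p` is left free. If the run breaks there, the type is `a :: b :: r`;
-- if it continues, the two parts merge, which requires equal signs.
theorem signGen_mul_typeSum {q : ℕ} {a b : ℤ} {r : List ℤ} {s : ℤˣ} (hs : a.sign = s)
    (hα : IsSignedComposition q (b :: r)) :
    opsB.mul (signGen s a.natAbs) (typeSum q (b :: r)) =
      typeSum (a.natAbs + q) (a :: b :: r) +
        if a.sign = b.sign then typeSum (a.natAbs + q) ((a + b) :: r) else 0 := by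
  set p := a.natAbs with hp
  have hp0 : 0 < p := by
    have : a ≠ 0 := by
      rintro rfl
      rcases Int.units_eq_one_or s with rfl | rfl <;> simp at hs
    omega
  have hb0 : 0 < b.natAbs := by
    have : b ≠ 0 := fun h => hα.1 (by simp [h])
    omega
  have hbq : b.natAbs ≤ q := by
    have := hα.2
    simp at this
    omega
  let R : SignedPerm (p + q) → Prop := fun w =>
    (∀ i, 1 ≤ i → i < p + q → i ≠ p → (w.Run i ↔ ¬ IsBlockEnd (a :: b :: r) i)) ∧
      HasSigns (a :: b :: r) fun j => (w.entry j).sign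
  have hR : opsB.mul (signGen s p) (typeSum q (b :: r)) = classElt R := by
    rw [signGen_eq_classElt]
    refine isExternal_signedPerm.mul_classElt _ _ _ fun ξ hξ u v => ?_
    rw [eq_constSign_iff, HasType]
    have hsg : HasSigns (a :: b :: r) (fun j =>
        ((SignedPerm.ofPerm ξ * SignedPerm.prod u v).entry j).sign) ↔
        (∀ j, 1 ≤ j → j ≤ p → (u.entry j).sign = s) ∧
          HasSigns (b :: r) fun j => (v.entry j).sign := by
      rw [hasSigns_cons, ← hp, hs]
      refine and_congr (forall_congr' fun i => forall_congr' fun h1 => forall_congr' fun h2 => ?_)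
        (forall_congr' fun i => forall_congr' fun hi => forall_congr' fun j =>
          forall_congr' fun hj => ?_)
      · rw [SignedPerm.sign_entry_shuffle_left u v ξ h1 h2]
      · rw [block_eq, Finset.mem_Icc] at hj
        have := partialSum_mono (b :: r) (show i + 1 ≤ (b :: r).length from hi)
        rw [partialSum_length, hα.2] at this
        beta_reduce
        rw [SignedPerm.sign_entry_shuffle_right u v ξ (by omega) (by omega)]
    have hend1 : ∀ i, i < p → ¬ IsBlockEnd (a :: b :: r) i := by
      intro i hi
      rw [isBlockEnd_cons]
      rintro (h | ⟨y, -, h⟩) <;> omega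
    have hend2 : ∀ i, 1 ≤ i → (IsBlockEnd (a :: b :: r) (p + i) ↔ IsBlockEnd (b :: r) i) := by
      intro i hi
      rw [isBlockEnd_cons]
      constructor
      · rintro (h | ⟨y, h1, h2⟩)
        · omega
        · obtain rfl : i = y := by omega
          exact h1
      · intro h
        exact Or.inr ⟨i, h, rfl⟩
    simp only [R]
    rw [hsg]
    constructor
    · rintro ⟨h1, h2, h3⟩
      refine ⟨⟨fun i hi1 hi2 => ?_, h2⟩, fun i hi1 hi2 => ?_, h3⟩
      · have := h1 i hi1 (by omega) (by omega)
        rw [SignedPerm.run_shuffle_left u v hξ hi1 hi2] at this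
        exact this.2 (hend1 i hi2)
      · have := h1 (p + i) (by omega) (by omega) (by omega)
        rwa [SignedPerm.run_shuffle_right u v hξ hi1 hi2, hend2 i hi1] at this
    · rintro ⟨⟨h1, h2⟩, h3, h4⟩
      refine ⟨fun i hi1 hi2 hi3 => ?_, h2, h4⟩
      rcases lt_or_ge i p with h | h
      · rw [SignedPerm.run_shuffle_left u v hξ hi1 h]
        exact iff_of_true (h1 i hi1 h) (hend1 i h)
      · obtain ⟨j, rfl⟩ := Nat.exists_eq_add_of_le h
        rw [SignedPerm.run_shuffle_right u v hξ (by omega) (by omega), hend2 j (by omega)]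
        exact h3 j (by omega) (by omega)
  rw [hR, classElt_eq_add R fun w => ¬ w.Run p]
  have hendp : IsBlockEnd (a :: b :: r) p := isBlockEnd_cons.2 (Or.inl rfl)
  congr 1
  · refine classElt_congr fun w => ⟨?_, ?_⟩
    · rintro ⟨⟨h1, h2⟩, h3⟩
      refine ⟨fun i hi1 hi2 => ?_, h2⟩
      by_cases hi : i = p
      · rw [hi]
        exact iff_of_false h3 (not_not.2 hendp)
      · exact h1 i hi1 hi2 hi
    · rintro ⟨h1, h2⟩
      exact ⟨⟨fun i hi1 hi2 _ => h1 i hi1 hi2, h2⟩,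
        fun h => (h1 p hp0 (by omega)).1 h hendp⟩
  · split_ifs with hab
    · refine classElt_congr fun w => ?_
      rw [not_not]
      have hend : ∀ i, IsBlockEnd ((a + b) :: r) i ↔ i ≠ p ∧ IsBlockEnd (a :: b :: r) i := by
        intro i
        simp only [isBlockEnd_cons, natAbs_add_of_sign_eq hab, ← hp]
        constructor
        · rintro (rfl | ⟨y, h1, rfl⟩)
          · exact ⟨by omega, Or.inr ⟨_, Or.inl rfl, rfl⟩⟩
          · exact ⟨by omega, Or.inr ⟨_, Or.inr ⟨y, h1, rfl⟩, by omega⟩⟩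
        · rintro ⟨h1, h2 | ⟨_, rfl | ⟨y, h2, rfl⟩, rfl⟩⟩
          · exact absurd h2 h1
          · exact Or.inl rfl
          · exact Or.inr ⟨y, h2, by omega⟩
      rw [HasType, hasSigns_merge hab]
      constructor
      · rintro ⟨⟨h1, h2⟩, h3⟩
        refine ⟨fun i hi1 hi2 => ?_, h2⟩
        rw [hend]
        by_cases hi : i = p
        · rw [hi]
          exact iff_of_true h3 fun h => h.1 rfl
        · rw [h1 i hi1 hi2 hi]
          simp [hi]
      · rintro ⟨h1, h2⟩
        refine ⟨⟨fun i hi1 hi2 hi => ?_, h2⟩, ?_⟩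
        · rw [h1 i hi1 hi2, hend]
          simp [hi]
        · rw [h1 p hp0 (by omega), hend]
          exact fun h => h.1 rfl
    · refine classElt_eq_zero ?_
      rintro w ⟨⟨-, h2⟩, h3⟩
      rw [not_not] at h3
      rw [hasSigns_cons, hasSigns_cons] at h2
      have e1 := h2.1 p hp0 le_rfl
      have e2 := h2.2.1 1 le_rfl hb0
      exact hab (e1.symm.trans (h3.2.trans e2))

/-- Induction on the number of parts: in `signGen_mul_typeSum`, every term other than that of `a ::
b :: r` involves a signed composition with one part fewer. -/
theorem typeSum_mem_monSpan (k : ℕ) : ∀ n α, IsSignedComposition n α → α.length = k →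
    typeSum n α ∈ opsB.monSpan signGen n := by
  classical
  induction k using Nat.strong_induction_on with
  | _ k ih =>
    intro n α hα hk
    have hsgn : ∀ a : ℤ, a ≠ 0 → ∃ s : ℤˣ, a.sign = s := by
      intro a ha
      rcases lt_or_gt_of_ne ha with h | h
      · exact ⟨-1, by simpa using h⟩
      · exact ⟨1, by simpa using h⟩
    match α, hα, hk with
    | [], hα, _ =>
      obtain rfl : 0 = n := by simpa using hα.2
      rw [typeSum_nil]
      exact HopfOps.one_mem_monSpan _
    | [a], hα, _ =>
      obtain ⟨s, hs⟩ := hsgn a fun h => hα.1 (by simp [h])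
      rw [← signGen_eq_typeSum (by simpa using hα.2) hs]
      exact HopfOps.gen_mem_monSpan opsB_isBialgebra _ s n
    | a :: b :: r, hα, hk =>
      obtain ⟨s, hs⟩ := hsgn a fun h => hα.1 (by simp [h])
      obtain ⟨q, rfl⟩ : ∃ q, n = a.natAbs + q :=
        ⟨_, by simpa using hα.2.symm⟩
      have h0 := hα.1
      have hsum := hα.2
      simp only [List.mem_cons, not_or, List.map_cons, List.sum_cons] at h0 hsum
      have hα' : IsSignedComposition q (b :: r) := ⟨by simp [h0.2.1, h0.2.2], by simp; omega⟩
      have h := signGen_mul_typeSum hs hα'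
      rw [← sub_eq_iff_eq_add] at h
      rw [← h]
      simp only [List.length_cons] at hk
      refine sub_mem (HopfOps.mul_mem_monSpan opsB_isBialgebra
        (HopfOps.gen_mem_monSpan opsB_isBialgebra _ s _) (ih (r.length + 1) (by omega) q _ hα' rfl)) ?_
      split_ifs with hab
      · have := natAbs_add_of_sign_eq hab
        refine ih (r.length + 1) (by omega) _ _ ⟨?_, ?_⟩ rfl
        · simp only [List.mem_cons, not_or]
          exact ⟨by omega, h0.2.2⟩
        · simp
          omega
      · exact zero_mem _

theorem signGen_mul_typeSum_mem (s : ℤˣ) {p q : ℕ} {x : TotalAlg SignedPerm}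
    (hx : x ∈ Submodule.span ℚ {x | ∃ α, IsSignedComposition q α ∧ x = typeSum q α}) :
    opsB.mul (signGen s p) x ∈
      Submodule.span ℚ {x | ∃ α, IsSignedComposition (p + q) α ∧ x = typeSum (p + q) α} := by
  classical
  rcases Nat.eq_zero_or_pos p with rfl | hp
  · rw [signGen_isDivided.zero, opsB_isBialgebra.one_mul, zero_add]
    exact hx
  · induction hx using Submodule.span_induction with
    | zero => simp
    | add x y _ _ hx hy => simpa using add_mem hx hy
    | smul a x _ hx => simpa using Submodule.smul_mem _ a hx
    | mem x hx =>
      obtain ⟨α, hα, rfl⟩ := hx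
      -- The degree and the sign of the generator are encoded in the single part `s * p`.
      have hab : ((s : ℤ) * p).natAbs = p := by
        rcases Int.units_eq_one_or s with rfl | rfl <;> simp
      have hsg : ((s : ℤ) * p).sign = s := by
        rcases Int.units_eq_one_or s with rfl | rfl <;> simp <;> omega
      generalize (s : ℤ) * p = a at hab hsg
      subst hab
      match α, hα with
      | [], hα =>
        obtain rfl : 0 = q := by simpa using hα.2
        rw [typeSum_nil, opsB_isBialgebra.mul_one, signGen_eq_typeSum rfl hsg]
        exact Submodule.subset_span ⟨[a], ⟨by simp; omega, by simp⟩, rfl⟩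
      | b :: r, hα =>
        rw [signGen_mul_typeSum hsg hα]
        have h0 := hα.1
        have hsum := hα.2
        simp only [List.mem_cons, not_or, List.map_cons, List.sum_cons] at h0 hsum
        refine add_mem (Submodule.subset_span ⟨_, ⟨?_, ?_⟩, rfl⟩) ?_
        · simp only [List.mem_cons, not_or]
          exact ⟨by omega, h0⟩
        · simp
          omega
        · split_ifs with hab
          · have := natAbs_add_of_sign_eq hab
            refine Submodule.subset_span ⟨_, ⟨?_, ?_⟩, rfl⟩
            · simp only [List.mem_cons, not_or]
              exact ⟨by omega, h0.2⟩
            · simp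
              omega
          · exact zero_mem _

theorem monSpan_signGen (n : ℕ) : opsB.monSpan signGen n =
    Submodule.span ℚ {x | ∃ α, IsSignedComposition n α ∧ x = typeSum n α} := by
  apply le_antisymm
  · refine Submodule.span_le.2 ?_
    rintro _ ⟨l, rfl, rfl⟩
    induction l with
    | nil => exact Submodule.subset_span ⟨[], ⟨by simp, rfl⟩, typeSum_nil.symm⟩
    | cons k l ih => exact signGen_mul_typeSum_mem k.1 ih
  · refine Submodule.span_le.2 ?_
    rintro _ ⟨α, hα, rfl⟩
    exact typeSum_mem_monSpan _ n α hα rfl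

theorem totalSubspace_omegaB :
    totalSubspace omegaB = ⨆ n, opsB.monSpan signGen n := by
  unfold omegaB
  rw [totalSubspace_span]
  refine iSup_congr fun n => ?_
  rw [monSpan_signGen]
  congr 1
  ext x
  constructor
  · rintro ⟨_, ⟨α, hα, rfl⟩, rfl⟩
    exact ⟨α, hα, lof_classT hα⟩
  · rintro ⟨α, hα, rfl⟩
    exact ⟨_, ⟨α, hα, rfl⟩, lof_classT hα⟩

end

noncomputable section

open TotalAlg

/-! ## Signed permutations with increasing entries and permutations without interior peaks -/

namespace SymPerm

variable {n : ℕ}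

theorem mem_intPeak {w : SymPerm n} {i : ℕ} : i ∈ intPeak w ↔
    (2 ≤ i ∧ i < n) ∧ entry w (i - 1) < entry w i ∧ entry w (i + 1) < entry w i := by
  rw [intPeak, Finset.mem_filter, Finset.mem_Ico]

theorem isIntPeakSet_intPeak (w : SymPerm n) : IsIntPeakSet n (intPeak w) := by
  refine ⟨Finset.filter_subset _ _, fun i hi hi' => ?_⟩
  rw [mem_intPeak] at hi hi'
  have := hi'.2.1
  rw [Nat.add_sub_cancel] at this
  have := hi.2.2
  omega

/-- There is no interior peak at `i + 1`, in terms of the values of `w`. -/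
theorem not_peak_of_intPeak_eq_empty {w : SymPerm n} (h : intPeak w = ∅) {i : ℕ}
    (hi : i + 2 < n) (h1 : w ⟨i, by omega⟩ < w ⟨i + 1, by omega⟩) :
    w ⟨i + 1, by omega⟩ < w ⟨i + 2, hi⟩ := by
  have h2 : i + 2 ∉ intPeak w := by simp [h]
  rw [mem_intPeak] at h2
  have e0 := entry_succ w ⟨i, by omega⟩
  have e1 := entry_succ w ⟨i + 1, by omega⟩
  have e2 := entry_succ w ⟨i + 2, hi⟩
  simp only [add_assoc, Nat.reduceAdd] at e0 e1 e2
  rw [show i + 2 - 1 = i + 1 by omega, add_assoc, e0, e1, e2] at h2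
  have hne : (w ⟨i + 1, by omega⟩ : ℕ) ≠ w ⟨i + 2, hi⟩ := fun h => by
    have := w.injective (Fin.ext h)
    simp at this
  rw [Fin.lt_def] at h1 ⊢
  omega

/-- The step after the smallest symbol is an ascent, and without peaks an ascent is followed by
ascents only. -/
theorem lt_succ_of_intPeak_eq_empty {w : SymPerm (n + 1)} (h : intPeak w = ∅) {i : ℕ}
    (hi : i + 1 < n + 1) (hk : (w.symm 0 : ℕ) ≤ i) :
    w ⟨i, by omega⟩ < w ⟨i + 1, hi⟩ := by
  induction i, hk using Nat.le_induction with
  | base =>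
    have h0 : w ⟨w.symm 0, by omega⟩ = 0 := by simp
    rw [h0, Fin.pos_iff_ne_zero]
    intro h1
    have := w.injective (h0.trans h1.symm)
    simp [Fin.ext_iff] at this
  | succ i hk ih => exact not_peak_of_intPeak_eq_empty h hi (ih (by omega))

/-- An ascent before the smallest symbol would propagate up to the step that reaches this symbol,
which is impossible. -/
theorem succ_lt_of_intPeak_eq_empty {w : SymPerm (n + 1)} (h : intPeak w = ∅) {i : ℕ}
    (hi : i + 1 < n + 1) (hk : i < (w.symm 0 : ℕ)) :
    w ⟨i + 1, hi⟩ < w ⟨i, by omega⟩ := by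
  by_contra hcon
  have h1 : w ⟨i, by omega⟩ < w ⟨i + 1, hi⟩ := by
    refine lt_of_le_of_ne (not_lt.1 hcon) fun h1 => ?_
    have := w.injective h1
    simp at this
  have h2 : ∀ j, i < j → ∀ hj : j < n + 1, w ⟨j - 1, by omega⟩ < w ⟨j, hj⟩ := by
    intro j hij
    induction j, (show i + 1 ≤ j from hij) using Nat.le_induction with
    | base => exact fun _ => h1
    | succ j hij ih =>
      intro hj
      obtain ⟨j, rfl⟩ := Nat.exists_eq_succ_of_ne_zero (show j ≠ 0 by omega)
      exact not_peak_of_intPeak_eq_empty h hj (ih (by omega) (by omega))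
  have h3 := h2 _ hk (w.symm 0).2
  simp at h3

end SymPerm

namespace SignedPerm

variable {n : ℕ}

/-- The comparison of two entries is decided by the sign of the one of larger absolute value. -/
theorem val_lt_of_lt {w : SignedPerm n} (hw : StrictMono w.val) {i j : Fin n} (hij : i < j) :
    (w.perm i < w.perm j → w.sign j = 1) ∧ (w.perm j < w.perm i → w.sign i = -1) := by
  have h := hw hij
  simp only [val] at h
  constructor
  · intro h1
    rcases Int.units_eq_one_or (w.sign j) with h2 | h2
    · exact h2
    · rw [h2] at h
      rw [Fin.lt_def] at h1
      rcases Int.units_eq_one_or (w.sign i) with h3 | h3 <;> simp [h3] at h <;> omega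
  · intro h1
    rcases Int.units_eq_one_or (w.sign i) with h2 | h2
    · rw [h2] at h
      rw [Fin.lt_def] at h1
      rcases Int.units_eq_one_or (w.sign j) with h3 | h3 <;> simp [h3] at h <;> omega
    · exact h2

/-- At a peak, comparison with the left neighbour would force a positive sign and comparison with
the right neighbour a negative one. -/
theorem intPeak_perm_of_strictMono {w : SignedPerm n} (hw : StrictMono w.val) :
    SymPerm.intPeak w.perm = ∅ := by
  rw [Finset.eq_empty_iff_forall_notMem]
  intro i hi
  obtain ⟨⟨h1, h2⟩, h3, h4⟩ := SymPerm.mem_intPeak.1 hi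
  obtain ⟨i, rfl⟩ := Nat.exists_eq_add_of_le' h1
  have e0 := SymPerm.entry_succ w.perm ⟨i, by omega⟩
  have e1 := SymPerm.entry_succ w.perm ⟨i + 1, by omega⟩
  have e2 := SymPerm.entry_succ w.perm ⟨i + 2, h2⟩
  simp only [add_assoc, Nat.reduceAdd] at e0 e1 e2
  rw [show i + 2 - 1 = i + 1 by omega, e0, e1] at h3
  rw [add_assoc, e1, e2] at h4
  have h5 := (val_lt_of_lt hw (i := ⟨i, by omega⟩) (j := ⟨i + 1, by omega⟩)
    (Fin.mk_lt_mk.2 (by omega))).1 (Fin.lt_def.2 (by omega))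
  have h6 := (val_lt_of_lt hw (i := ⟨i + 1, by omega⟩) (j := ⟨i + 2, h2⟩)
    (Fin.mk_lt_mk.2 (by omega))).2 (Fin.lt_def.2 (by omega))
  rw [h5] at h6
  exact absurd h6 (by decide)

/-- The signs that make the entries of a permutation without interior peaks increase, where `s` is
the sign of the smallest symbol. -/
def valleySign (w : SymPerm (n + 1)) (s : ℤˣ) (i : Fin (n + 1)) : ℤˣ :=
  if i < w.symm 0 then -1 else if i = w.symm 0 then s else 1

/-- Comparing the smallest symbol with every other entry forces all signs but its own. -/
theorem sign_eq_valleySign {w : SignedPerm (n + 1)} (hw : StrictMono w.val) :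
    w.sign = valleySign w.perm (w.sign (w.perm.symm 0)) := by
  funext i
  rw [valleySign]
  have h0 : ∀ i ≠ w.perm.symm 0, w.perm (w.perm.symm 0) < w.perm i := by
    intro i hi
    rw [Equiv.apply_symm_apply, Fin.pos_iff_ne_zero]
    intro h
    exact hi (by rw [← h, Equiv.symm_apply_apply])
  split_ifs with h1 h2
  · exact (val_lt_of_lt hw h1).2 (h0 i h1.ne)
  · rw [← h2]
  · exact (val_lt_of_lt hw (lt_of_le_of_ne (not_lt.1 h1) (Ne.symm h2))).1 (h0 i h2)

theorem strictMono_val_valleySign {w : SymPerm (n + 1)} (hw : SymPerm.intPeak w = ∅) (s : ℤˣ) :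
    StrictMono (SignedPerm.val ⟨w, valleySign w s⟩) := by
  rw [Fin.strictMono_iff_lt_succ]
  intro i
  have hi : (i : ℕ) + 1 < n + 1 := by omega
  have ei : i.castSucc = ⟨i, by omega⟩ := rfl
  have ej : i.succ = ⟨i + 1, hi⟩ := rfl
  simp only [val]
  rcases lt_or_ge (i : ℕ) (w.symm 0 : ℕ) with h | h
  · have h1 := Fin.lt_def.1 (SymPerm.succ_lt_of_intPeak_eq_empty hw hi h)
    have h2 : valleySign w s i.castSucc = -1 := if_pos (Fin.lt_def.2 h)
    rw [h2, ei, ej]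
    rcases Int.units_eq_one_or (valleySign w s ⟨i + 1, hi⟩) with h3 | h3 <;> simp [h3] <;> omega
  · have h1 := Fin.lt_def.1 (SymPerm.lt_succ_of_intPeak_eq_empty hw hi h)
    have h2 : valleySign w s i.succ = 1 := by
      rw [valleySign, if_neg, if_neg]
      · rw [Fin.ext_iff, Fin.val_succ]
        omega
      · rw [Fin.lt_def, Fin.val_succ]
        omega
    rw [h2, ei, ej]
    rcases Int.units_eq_one_or (valleySign w s ⟨i, by omega⟩) with h3 | h3 <;> simp [h3] <;> omega

end SignedPerm

/-- Over each permutation without interior peaks there are exactly two increasing signed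
permutations, which differ by the sign of the symbol 1. This is the source of the factor 2 in
`Θ(1)`. -/
theorem sum_incPerms_perm {M : Type} [AddCommGroup M] [Module ℚ M] (n : ℕ)
    (F : SymPerm (n + 1) → M) :
    ∑ w ∈ incPerms (n + 1), F w.perm =
      (2 : ℚ) • ∑ w ∈ Finset.univ.filter fun w => SymPerm.intPeak w = ∅, F w := by
  classical
  have h : ∑ t ∈ (Finset.univ.filter fun w : SymPerm (n + 1) => SymPerm.intPeak w = ∅) ×ˢ
      (Finset.univ : Finset ℤˣ), F t.1 =
      (2 : ℚ) • ∑ w ∈ Finset.univ.filter fun w => SymPerm.intPeak w = ∅, F w := by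
    rw [Finset.sum_product, Finset.smul_sum]
    refine Finset.sum_congr rfl fun w _ => ?_
    simp only
    rw [Finset.sum_const, Finset.card_univ, Fintype.card_units_int, two_smul, two_smul]
  rw [← h]
  refine Finset.sum_bij' (fun w _ => (w.perm, w.sign (w.perm.symm 0)))
    (fun t _ => ⟨t.1, SignedPerm.valleySign t.1 t.2⟩) ?_ ?_ ?_ ?_ ?_
  · intro w hw
    rw [Finset.mem_product, Finset.mem_filter]
    exact ⟨⟨Finset.mem_univ _, SignedPerm.intPeak_perm_of_strictMono (mem_incPerms.1 hw)⟩,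
      Finset.mem_univ _⟩
  · rintro ⟨w, s⟩ h
    simp only [Finset.mem_product, Finset.mem_filter, Finset.mem_univ, true_and, and_true] at h
    exact mem_incPerms.2 (SignedPerm.strictMono_val_valleySign h s)
  · intro w hw
    exact SignedPerm.ext rfl (SignedPerm.sign_eq_valleySign (mem_incPerms.1 hw)).symm
  · rintro ⟨w, s⟩ -
    simp [SignedPerm.valleySign]
  · intros
    rfl

theorem theta_forgetSigns (x : TotalAlg SignedPerm) :
    theta (forgetSigns x) = forgetSigns (thetaPM x) := by
  classical
  induction x using induction_elt with
  | h n w =>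
    rw [thetaPM_elt, map_sum, forgetSigns_elt]
    simp only [forgetSigns_elt, SignedPerm.mul_perm]
    rw [theta, elt, DirectSum.lmap_lof]
    cases n with
    -- In degree 0 there is no symbol 1 whose sign could be chosen, so the factor 2 disappears, in
    -- accordance with the convention in `thetaGen`.
    | zero =>
      have : incPerms 0 = {1} := by
        ext u
        rw [mem_incPerms, Finset.mem_singleton]
        refine iff_of_true (fun i => i.elim0) ?_
        apply SignedPerm.ext
        · ext i
          exact i.elim0
        · ext i
          exact i.elim0
      rw [this, Finset.sum_singleton]
      simp [thetaGen, elt]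
    | succ n =>
      rw [sum_incPerms_perm n fun u => (elt (u * w.perm) : TotalAlg SymPerm)]
      simp [thetaGen, intPeakP, classSum, Finset.sum_mul, MonoidAlgebra.single_mul_single, elt]
      congr!
  | h0 => simp
  | hadd x y hx hy => simp [hx, hy]
  | hsmul a x hx => simp [hx]

theorem theta_one : theta opsA.one = opsA.one := by
  rw [← forgetSigns_one, theta_forgetSigns, thetaPM_one]

theorem theta_mul (x y : TotalAlg SymPerm) :
    theta (opsA.mul x y) = opsA.mul (theta x) (theta y) := by
  obtain ⟨x, rfl⟩ := forgetSigns_surjective x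
  obtain ⟨y, rfl⟩ := forgetSigns_surjective y
  simp only [← forgetSigns_mul, theta_forgetSigns, thetaPM_mul]

/-- The generators of the peak algebra. -/
def peakGen (_ : Unit) (n : ℕ) : TotalAlg SymPerm := forgetSigns (monoSum 1 n)

theorem peakGen_isDivided : opsA.IsDivided peakGen :=
  (monoSum_isDivided fun _ : Unit => 1).forgetSigns

/-- The sum of the permutations with set of interior peaks `F`. -/
def peakSum (n : ℕ) (F : Finset ℕ) : TotalAlg SymPerm :=
  classElt fun w : SymPerm n => SymPerm.intPeak w = F

theorem peakGen_succ (n : ℕ) : peakGen () (n + 1) = (2 : ℚ) • peakSum (n + 1) ∅ := by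
  classical
  have h : monoSum 1 (n + 1) = ∑ w ∈ incPerms (n + 1), elt w := rfl
  rw [peakGen, h, map_sum]
  simp only [forgetSigns_elt]
  rw [sum_incPerms_perm n fun u => (elt u : TotalAlg SymPerm), peakSum, classElt]
  congr!

/-! ## The peak algebra -/

theorem peakSum_eq_zero {n : ℕ} {F : Finset ℕ} (hF : ¬ IsIntPeakSet n F) : peakSum n F = 0 := by
  refine classElt_eq_zero fun w h => hF ?_
  rw [← h]
  exact SymPerm.isIntPeakSet_intPeak w

theorem classElt_intPeak (n : ℕ) (Q : Finset ℕ → Prop) [DecidablePred Q] :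
    classElt (fun w : SymPerm n => Q (SymPerm.intPeak w)) =
      ∑ F ∈ (Finset.range n).powerset.filter Q, peakSum n F := by
  classical
  have h := Finset.sum_fiberwise_of_maps_to
    (s := Finset.univ.filter fun w : SymPerm n => Q (SymPerm.intPeak w))
    (t := (Finset.range n).powerset.filter Q) (g := SymPerm.intPeak)
    (fun w hw => Finset.mem_filter.2 ⟨Finset.mem_powerset.2 fun i hi =>
      Finset.mem_range.2 (SymPerm.mem_intPeak.1 hi).1.2, (Finset.mem_filter.1 hw).2⟩)
    (fun w => (elt w : TotalAlg SymPerm))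
  refine Eq.trans ?_ (h.symm.trans (Finset.sum_congr rfl fun F hF => ?_))
  · rw [classElt]
    congr!
  rw [Finset.filter_filter, peakSum, classElt]
  refine Finset.sum_congr ?_ fun _ _ => rfl
  ext w
  simp only [Finset.mem_filter, Finset.mem_univ, true_and]
  exact ⟨fun h => h.2, fun h => ⟨h ▸ (Finset.mem_filter.1 hF).2, h⟩⟩

theorem intPeak_shuffle_left {p q : ℕ} {ξ : SymPerm (p + q)} (hξ : ξ ∈ shuffles p q)
    (u : SymPerm p) (v : SymPerm q) {i : ℕ} (hip : i < p) :
    i ∈ SymPerm.intPeak (ξ * SymPerm.prod u v) ↔ i ∈ SymPerm.intPeak u := by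
  rw [SymPerm.mem_intPeak, SymPerm.mem_intPeak]
  rcases lt_or_ge i 2 with hi | hi
  · exact iff_of_false (by omega) (by omega)
  · rw [SymPerm.entry_shuffle_lt_left u v hξ (by omega) (by omega) (by omega) (by omega),
      SymPerm.entry_shuffle_lt_left u v hξ (by omega) (by omega) (by omega) (by omega)]
    exact and_congr_left' (iff_of_true ⟨hi, by omega⟩ ⟨hi, hip⟩)

theorem intPeak_shuffle_right {p q : ℕ} {ξ : SymPerm (p + q)} (hξ : ξ ∈ shuffles p q)
    (u : SymPerm p) (v : SymPerm q) {i : ℕ} (hi : 2 ≤ i) :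
    p + i ∈ SymPerm.intPeak (ξ * SymPerm.prod u v) ↔ i ∈ SymPerm.intPeak v := by
  rw [SymPerm.mem_intPeak, SymPerm.mem_intPeak]
  rcases le_or_gt q i with hiq | hiq
  · exact iff_of_false (by omega) (by omega)
  · rw [Nat.add_sub_assoc (by omega), add_assoc,
      SymPerm.entry_shuffle_lt_right u v hξ (by omega) (by omega) (by omega) (by omega),
      SymPerm.entry_shuffle_lt_right u v hξ (by omega) (by omega) (by omega) (by omega)]
    exact and_congr_left' (iff_of_true ⟨by omega, by omega⟩ ⟨hi, hiq⟩)

/-- Whether `i` is a peak depends on the positions `i - 1`, `i`, `i + 1`. Only `p` and `p + 1`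
involve both blocks, and these two are left free. -/
theorem peakSum_mul_peakSum (p q : ℕ) (F G : Finset ℕ) (hF : F ⊆ Finset.Ico 2 p)
    (hG : G ⊆ Finset.Ico 2 q) :
    opsA.mul (peakSum p F) (peakSum q G) = classElt fun w : SymPerm (p + q) =>
      (∀ i < p, i ∈ SymPerm.intPeak w ↔ i ∈ F) ∧
        ∀ i, 2 ≤ i → (p + i ∈ SymPerm.intPeak w ↔ i ∈ G) := by
  refine isExternal_symPerm.mul_classElt _ _ _ fun ξ hξ u v => and_congr ?_ ?_
  · rw [Finset.ext_iff]
    refine forall_congr' fun i => ?_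
    rcases lt_or_ge i p with h | h
    · simp only [h, forall_const]
      rw [intPeak_shuffle_left hξ u v h]
    · refine iff_of_true (fun h' => by omega) (iff_of_false (fun h' => ?_) fun h' => ?_)
      · have := (SymPerm.mem_intPeak.1 h').1
        omega
      · have := Finset.mem_Ico.1 (hF h')
        omega
  · rw [Finset.ext_iff]
    refine forall_congr' fun i => ?_
    rcases lt_or_ge i 2 with h | h
    · refine iff_of_true (fun h' => by omega) (iff_of_false (fun h' => ?_) fun h' => ?_)
      · have := (SymPerm.mem_intPeak.1 h').1
        omega
      · have := Finset.mem_Ico.1 (hG h')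
        omega
    · simp only [h, forall_const]
      rw [intPeak_shuffle_right hξ u v h]

theorem peakSum_zero_empty : peakSum 0 ∅ = opsA.one := by
  classical
  change _ = elt (1 : SymPerm 0)
  rw [peakSum, classElt, Finset.sum_filter, Fintype.sum_unique, if_pos]
  · congr 1
  · rfl

/-- Let `f` be the least peak of `F` and `G` the others. Multiplying the sum without peaks in degree
`f` by a suitable peak sum leaves `f` and `f + 1` free; as these cannot both be peaks, the product
is the sum of the terms for `insert f G`, `insert (f + 1) G` and `G`, and one solves for the first.
-/
theorem peakSum_mem_monSpan (n : ℕ) : ∀ F, peakSum n F ∈ opsA.monSpan peakGen n := by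
  classical
  induction n using Nat.strong_induction_on with
  | _ n ih =>
    intro F
    -- This weight drops both when the least peak is removed and when it moves one step to the
    -- right.
    induction hm : ∑ g ∈ F, (n - g) using Nat.strong_induction_on generalizing F with
    | _ m ihm =>
      subst hm
      by_cases hF : IsIntPeakSet n F
      swap
      · rw [peakSum_eq_zero hF]
        exact zero_mem _
      rcases F.eq_empty_or_nonempty with rfl | hne
      · cases n with
        | zero =>
          rw [peakSum_zero_empty]
          exact HopfOps.one_mem_monSpan _
        | succ n =>
          have : peakSum (n + 1) ∅ = (2 : ℚ)⁻¹ • peakGen () (n + 1) := by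
            rw [peakGen_succ, inv_smul_smul₀ two_ne_zero]
          rw [this]
          exact Submodule.smul_mem _ _ (HopfOps.gen_mem_monSpan opsA_isBialgebra _ _ _)
      · obtain ⟨f, G, hfG, rfl, hmin⟩ : ∃ f G, f ∉ G ∧ insert f G = F ∧ ∀ g ∈ G, f < g := by
          refine ⟨F.min' hne, F.erase (F.min' hne), Finset.notMem_erase _ _,
            Finset.insert_erase (Finset.min'_mem _ _), fun g hg => ?_⟩
          rw [Finset.mem_erase] at hg
          exact lt_of_le_of_ne (Finset.min'_le _ _ hg.2) (Ne.symm hg.1)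
        obtain ⟨hF1, hF2⟩ := hF
        have hf := Finset.mem_Ico.1 (hF1 (Finset.mem_insert_self f G))
        have hfG' : f + 1 ∉ G := fun h =>
          hF2 f (Finset.mem_insert_self f G) (Finset.mem_insert_of_mem h)
        obtain ⟨q, rfl⟩ := Nat.exists_eq_add_of_le hf.2.le
        rw [Finset.sum_insert hfG] at ihm
        have h1 : peakSum (f + q) G ∈ opsA.monSpan peakGen (f + q) :=
          ihm _ (by omega) G rfl
        have h2 : peakSum (f + q) (insert (f + 1) G) ∈ opsA.monSpan peakGen (f + q) :=
          ihm _ (by rw [Finset.sum_insert hfG']; omega) _ rfl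
        -- These are the remaining peaks, seen from the second block; no peak is lost at `f + 1`,
        -- since `F` has no two consecutive elements.
        let G' : Finset ℕ := (Finset.Ico 2 q).filter fun i => f + i ∈ G
        have h3 : opsA.mul (peakSum f ∅) (peakSum q G') ∈ opsA.monSpan peakGen (f + q) :=
          HopfOps.mul_mem_monSpan opsA_isBialgebra (ih f hf.2 ∅) (ih q (by omega) G')
        rw [peakSum_mul_peakSum f q ∅ G' (Finset.empty_subset _) (Finset.filter_subset _ _),
          classElt_congr (Q := fun w : SymPerm (f + q) =>
            ∀ i, i ≠ f → i ≠ f + 1 → (i ∈ SymPerm.intPeak w ↔ i ∈ G)) fun w => ?_,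
          classElt_eq_add _ fun w => f ∈ SymPerm.intPeak w,
          classElt_eq_add (fun w : SymPerm (f + q) => _ ∧ f ∉ SymPerm.intPeak w)
            fun w => f + 1 ∈ SymPerm.intPeak w] at h3
        · have e1 : classElt (fun w : SymPerm (f + q) =>
              (∀ i, i ≠ f → i ≠ f + 1 → (i ∈ SymPerm.intPeak w ↔ i ∈ G)) ∧
                f ∈ SymPerm.intPeak w) = peakSum (f + q) (insert f G) := by
            refine classElt_congr fun w => ?_
            simp only [Finset.ext_iff, Finset.mem_insert]
            constructor
            · rintro ⟨h4, h5⟩ i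
              have h6 := (SymPerm.isIntPeakSet_intPeak w).2 f h5
              by_cases hi : i = f
              · simp [hi, h5]
              by_cases hi' : i = f + 1
              · simp [hi', h6, hfG']
              simp [h4 i hi hi', hi]
            · intro h4
              exact ⟨fun i hi hi' => by simp [h4, hi], (h4 f).2 (Or.inl rfl)⟩
          have e2 : classElt (fun w : SymPerm (f + q) =>
              ((∀ i, i ≠ f → i ≠ f + 1 → (i ∈ SymPerm.intPeak w ↔ i ∈ G)) ∧
                f ∉ SymPerm.intPeak w) ∧ f + 1 ∈ SymPerm.intPeak w) =
              peakSum (f + q) (insert (f + 1) G) := by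
            refine classElt_congr fun w => ?_
            simp only [Finset.ext_iff, Finset.mem_insert]
            constructor
            · rintro ⟨⟨h4, h5⟩, h6⟩ i
              by_cases hi : i = f
              · simp [hi, h5, hfG]
              by_cases hi' : i = f + 1
              · simp [hi', h6]
              simp [h4 i hi hi', hi']
            · intro h4
              exact ⟨⟨fun i hi hi' => by simp [h4, hi'], by simp [h4, hfG]⟩,
                (h4 (f + 1)).2 (Or.inl rfl)⟩
          have e3 : classElt (fun w : SymPerm (f + q) =>
              ((∀ i, i ≠ f → i ≠ f + 1 → (i ∈ SymPerm.intPeak w ↔ i ∈ G)) ∧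
                f ∉ SymPerm.intPeak w) ∧ f + 1 ∉ SymPerm.intPeak w) = peakSum (f + q) G := by
            refine classElt_congr fun w => ?_
            simp only [Finset.ext_iff]
            constructor
            · rintro ⟨⟨h4, h5⟩, h6⟩ i
              by_cases hi : i = f
              · simp [hi, h5, hfG]
              by_cases hi' : i = f + 1
              · simp [hi', h6, hfG']
              exact h4 i hi hi'
            · intro h4
              exact ⟨⟨fun i _ _ => h4 i, by simp [h4, hfG]⟩, by simp [h4, hfG']⟩
          rw [e1, e2, e3] at h3
          exact (Submodule.add_mem_iff_left _ (add_mem h2 h1)).1 h3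
        · simp only [Finset.notMem_empty, iff_false, G', Finset.mem_filter, Finset.mem_Ico]
          constructor
          · rintro ⟨h4, h5⟩ i hi hi'
            rcases lt_or_ge i f with h | h
            · refine iff_of_false (h4 i h) fun h' => ?_
              have := hmin i h'
              omega
            · obtain ⟨k, rfl⟩ := Nat.exists_eq_add_of_le h
              rw [h5 k (by omega)]
              refine and_iff_right_of_imp fun h' => ⟨by omega, ?_⟩
              have := Finset.mem_Ico.1 (hF1 (Finset.mem_insert_of_mem h'))
              omega
          · intro h4
            refine ⟨fun i hi h' => ?_, fun i hi => ?_⟩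
            · have := hmin i ((h4 i (by omega) (by omega)).1 h')
              omega
            · rw [h4 (f + i) (by omega) (by omega)]
              refine (and_iff_right_of_imp fun h' => ⟨by omega, ?_⟩).symm
              have := Finset.mem_Ico.1 (hF1 (Finset.mem_insert_of_mem h'))
              omega

theorem monSpan_peakGen (n : ℕ) : opsA.monSpan peakGen n =
    Submodule.span ℚ {x | ∃ F, IsIntPeakSet n F ∧ x = peakSum n F} := by
  classical
  apply le_antisymm
  · have hmem : ∀ n F, peakSum n F ∈
        Submodule.span ℚ {x | ∃ F, IsIntPeakSet n F ∧ x = peakSum n F} := by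
      intro n F
      by_cases hF : IsIntPeakSet n F
      · exact Submodule.subset_span ⟨F, hF, rfl⟩
      · rw [peakSum_eq_zero hF]
        exact zero_mem _
    have hmul : ∀ p q x, x ∈ Submodule.span ℚ {x | ∃ F, IsIntPeakSet q F ∧ x = peakSum q F} →
        opsA.mul (peakGen () p) x ∈
          Submodule.span ℚ {x | ∃ F, IsIntPeakSet (p + q) F ∧ x = peakSum (p + q) F} := by
      intro p q x hx
      cases p with
      | zero =>
        rw [peakGen_isDivided.zero, opsA_isBialgebra.one_mul, zero_add]
        exact hx
      | succ p =>
        rw [peakGen_succ, map_smul, LinearMap.smul_apply]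
        refine Submodule.smul_mem _ _ ?_
        induction hx using Submodule.span_induction with
        | zero => simp
        | add x y _ _ hx hy => simpa using add_mem hx hy
        | smul a x _ hx => simpa using Submodule.smul_mem _ a hx
        | mem x hx =>
          obtain ⟨F, hF, rfl⟩ := hx
          -- Membership in the product class depends only on the set of interior peaks, so the
          -- product is a sum of peak sums.
          rw [peakSum_mul_peakSum _ _ _ _ (Finset.empty_subset _) hF.1,
            classElt_intPeak (p + 1 + q) fun S => (∀ i < p + 1, i ∈ S ↔ i ∈ (∅ : Finset ℕ)) ∧
              ∀ i, 2 ≤ i → (p + 1 + i ∈ S ↔ i ∈ F)]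
          exact sum_mem fun F _ => hmem _ F
    refine Submodule.span_le.2 ?_
    rintro _ ⟨l, rfl, rfl⟩
    induction l with
    | nil =>
      rw [HopfOps.monomial, ← peakSum_zero_empty]
      exact hmem 0 ∅
    | cons k l ih => exact hmul k.2 _ _ ih
  · refine Submodule.span_le.2 ?_
    rintro _ ⟨F, -, rfl⟩
    exact peakSum_mem_monSpan n F

theorem lof_intPeakP (n : ℕ) (F : Finset ℕ) :
    DirectSum.lof ℚ ℕ (fun n => MonoidAlgebra ℚ (SymPerm n)) n (intPeakP n F) = peakSum n F := by
  rw [intPeakP, lof_classSum', peakSum]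

theorem totalSubspace_peakIdeal :
    totalSubspace peakIdeal = ⨆ n, opsA.monSpan peakGen n := by
  unfold peakIdeal
  rw [totalSubspace_span]
  refine iSup_congr fun n => ?_
  rw [monSpan_peakGen]
  congr 1
  ext x
  constructor
  · rintro ⟨_, ⟨F, hF, rfl⟩, rfl⟩
    exact ⟨F, hF, lof_intPeakP n F⟩
  · rintro ⟨F, hF, rfl⟩
    exact ⟨_, ⟨F, hF, rfl⟩, lof_intPeakP n F⟩

end

noncomputable section

open TotalAlg

/-! ## The morphisms of graded Hopf algebras -/

theorem desGen_signedPerm : desGen SignedPerm.IsDes = fun _ n => monoSum 1 n := by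
  funext _ n
  exact (monoSum_one_eq n).symm

theorem thetaPM_signGen (s : ℤˣ) (n : ℕ) : thetaPM (signGen s n) = monoSum s n :=
  thetaPM_constSign s n

/-- For `s = -1` the entries decrease, so the descents in `[1, n)` form the full set; this class
lies in the span by triangularity. -/
theorem monoSum_mem_monSpan (s : ℤˣ) (n : ℕ) :
    monoSum s n ∈ opsB.monSpan (desGen SignedPerm.IsDes) n := by
  rcases Int.units_eq_one_or s with rfl | rfl
  · rw [monoSum_one_eq]
    exact HopfOps.gen_mem_monSpan opsB_isBialgebra _ () n
  · rw [monoSum_neg_one_eq]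
    exact (monSpan_desGen isExternal_signedPerm isDescentStat_signedPerm
      opsB_isBialgebra opsB_one_eq n).symm ▸ sumDesEq_mem_span _ (Finset.Subset.refl _)

/-- Only the identity has no descents. Thus the generators of `Sol(A)` are the unsigned images of
one of the two families that generate `Ω(B)`. -/
theorem desGen_symPerm :
    desGen SymPerm.IsDes = fun _ n => forgetSigns (signGen 1 n) := by
  funext _ n
  rw [signGen, forgetSigns_elt, elt_eq_classElt, desGen]
  refine classElt_congr fun w => ⟨fun h => ?_, ?_⟩
  · cases n with
    | zero =>
      ext i
      exact i.elim0
    | succ n =>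
      refine perm_eq_one_of_strictMono (Fin.strictMono_iff_lt_succ.2 fun i => ?_)
      have h1 := h (i + 1) (by omega) (by omega)
      have e0 := SymPerm.entry_succ w i.castSucc
      have e1 := SymPerm.entry_succ w i.succ
      simp only [Fin.val_castSucc, Fin.val_succ] at e0 e1
      simp only [SymPerm.IsDes, e0, e1, Finset.notMem_empty, imp_false] at h1
      have h2 : w i.castSucc ≠ w i.succ := fun h => (Fin.castSucc_lt_succ).ne (w.injective h)
      rw [Ne, Fin.ext_iff] at h2
      rw [Fin.lt_def]
      omega
  · rintro rfl i h1 h2 h3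
    obtain ⟨k, rfl⟩ := exists_fin_succ h1 h2.le
    have e1 := SymPerm.entry_succ (SignedPerm.constSign n 1).perm ⟨k + 1, h2⟩
    simp only at e1
    rw [SymPerm.IsDes, SymPerm.entry_succ, e1] at h3
    simp [SignedPerm.constSign] at h3

theorem mainTheorem11 :
    IsGradedHopfMorphism opsB (totalSubspace omegaB) (totalSubspace canonicalIdeal) thetaPM ∧
    IsGradedHopfMorphism opsA (totalSubspace solA) (totalSubspace peakIdeal) theta := by
  constructor
  · rw [totalSubspace_omegaB, totalSubspace_canonicalIdeal]
    refine HopfOps.isGradedHopfMorphism opsB_isBialgebra externalOps_isGraded signGen_isDivided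
      ?_ thetaPM_one thetaPM_mul (fun s n => ?_) ?_
    · rw [desGen_signedPerm]
      exact monoSum_isDivided fun _ => 1
    · rw [thetaPM_signGen]
      exact monoSum_mem_monSpan s n
    · simp only [thetaPM_signGen]
      exact monoSum_isDivided id
  · rw [totalSubspace_solA, totalSubspace_peakIdeal, desGen_symPerm]
    -- `Θ` matches the generators of `Sol(A)` with those of `P°`, and both sequences are images
    -- under `forgetSigns` of divided powers in `ℚB`.
    have h : ∀ n, theta (forgetSigns (signGen 1 n)) = peakGen () n := fun n => by
      rw [theta_forgetSigns, thetaPM_signGen, peakGen]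
    refine HopfOps.isGradedHopfMorphism opsA_isBialgebra externalOps_isGraded ?_ peakGen_isDivided
      theta_one theta_mul (fun k n => ?_) ?_
    · exact (⟨fun _ => signGen_isDivided.mem_deg 1, fun _ => signGen_isDivided.zero 1,
        fun _ => signGen_isDivided.comul 1⟩ : opsB.IsDivided fun (_ : Unit) n =>
          signGen 1 n).forgetSigns
    · rw [h]
      exact HopfOps.gen_mem_monSpan opsA_isBialgebra _ () n
    · simp only [h]
      exact peakGen_isDivided

end
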